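/- Let $K$ be a smooth knot in $\mathbb{R}^3$, that is, the image of a smooth embedding of the oriented circle, let $v$ be a unit vector, and let $P(K)$ be the orthogonal projection of $K$ to the plane $v^{\perp}$, with an orthonormal basis. Suppose that $P(K)$ is a regular projection (an immersed closed curve whose only multiple points are finitely many transverse double points) and that it is in spiral form, i.e. it has no s-inflection point: there is no point, and no interval of vanishing curvature, at which the signed planar curvature switches sign. Smoothing every crossing in accordance with the orientation of $K$ yields the Seifert circles of $P(K)$; the sides of a Seifert circle are its arcs between crossings. A Seifert circle is an o-circle if all its sides curve towards its inside (the curvature vector, wherever it is nonzero, points into the bounded region enclosed by the circle; the sides "bulge out"), and an i-circle if all its sides curve away from its inside (the curvature vector, wherever it is nonzero, points into the unbounded region; the sides "bulge in"). If all sides of a Seifert circle are straight segments, they are regarded as curving to the side, left or right of the direction of travel, to which $P(K)$ bends elsewhere. Then $P(K)$ has finitely many Seifert circles, each of which is either an o-circle or an i-circle, and not both. Moreover, for every unit vector $w$ in the plane of projection, the number of local maxima of $P(K)$ in the direction $w$ (a flat maximum along a straight segment counts as one maximum) is finite, independent of $w$, and equal to the number of o-circles minus the number of i-circles. In other words, the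 spiral number of $P(K)$, which is this number of maxima, satisfies $$sp(P(K)) = \#\{\text{o-circles}\} - \#\{\text{i-circles}\}.$$ -/

import Mathlib

open Set Filter Topology
open scoped ContDiff

namespace SpiralIndex

/-- Euclidean three-space. -/
abbrev Space := EuclideanSpace ℝ (Fin 3)

/-- The Euclidean plane. -/
abbrev Plane := EuclideanSpace ℝ (Fin 2)

/-- A smooth oriented knot in three-space, given by a regular smooth parametrization
`toFun : ℝ → Space` of period `1` that is injective on the parameter circle `ℝ / ℤ`. -/
structure Knot where
  toFun : ℝ → Space
  smooth : ContDiff ℝ ∞ toFun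
  periodic : Function.Periodic toFun 1
  regular : ∀ t, deriv toFun t ≠ 0
  injective : ∀ s t, toFun s = toFun t → (s : UnitAddCircle) = (t : UnitAddCircle)

/-- The orthogonal projection of the knot onto the plane through the origin orthogonal to `v`,
read in Cartesian coordinates (an orthonormal basis `b`) of that plane. -/
noncomputable def Knot.projection (K : Knot) (v : Space)
    (b : OrthonormalBasis (Fin 2) ℝ (Submodule.span ℝ {v})ᗮ) (t : ℝ) : Plane :=
  b.repr ((Submodule.span ℝ {v})ᗮ.orthogonalProjectionOnto (K.toFun t))

/-! ### Plane geometry of curves of period one -/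

/-- The determinant of two plane vectors. -/
def det (x y : Plane) : ℝ := x 0 * y 1 - x 1 * y 0

/-- Counterclockwise rotation of a plane vector by a right angle. -/
def rot (x : Plane) : Plane := !₂[-x 1, x 0]

/-- The signed curvature of a plane curve. -/
noncomputable def curvature (γ : ℝ → Plane) (t : ℝ) : ℝ :=
  det (deriv γ t) (deriv (deriv γ) t) / ‖deriv γ t‖ ^ 3

/-- `t` is an s-inflection point: the curvature vanishes at `t` and switches sign there.
If the curvature vanishes on a whole interval around `t`, then the switch is between the
two ends of an interval `[a, b]` of vanishing curvature that contains `t`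
(`a = b = t` if the zero of the curvature at `t` is isolated). -/
def IsSInflection (γ : ℝ → Plane) (t : ℝ) : Prop :=
  ∃ a b : ℝ, a ≤ t ∧ t ≤ b ∧ (∀ x ∈ Icc a b, curvature γ x = 0) ∧
    ∀ ε > 0, (∃ x ∈ Ioo (a - ε) (b + ε), 0 < curvature γ x) ∧
      (∃ x ∈ Ioo (a - ε) (b + ε), curvature γ x < 0)

/-- Spiral form: there are no s-inflection points. -/
def IsSpiralForm (γ : ℝ → Plane) : Prop := ∀ t, ¬ IsSInflection γ t

/-- Two different points `s`, `t` of the parameter circle have the same image. -/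
def IsCrossing (γ : ℝ → Plane) (s t : ℝ) : Prop :=
  (s : UnitAddCircle) ≠ (t : UnitAddCircle) ∧ γ s = γ t

/-- The parameters at which the curve passes through a crossing. -/
def crossingParams (γ : ℝ → Plane) : Set ℝ := {s | ∃ t, IsCrossing γ s t}

/-- A regular projection: an immersed curve whose only multiple points are finitely many
transverse double points. -/
structure IsRegularProjection (γ : ℝ → Plane) : Prop where
  immersed : ∀ t, deriv γ t ≠ 0
  transverse : ∀ s t, IsCrossing γ s t → det (deriv γ s) (deriv γ t) ≠ 0
  double : ∀ s t u, IsCrossing γ s t → IsCrossing γ s u →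
    (t : UnitAddCircle) = (u : UnitAddCircle)
  finite : ((fun t : ℝ => (t : UnitAddCircle)) '' crossingParams γ).Finite

/-! ### Maxima -/

/-- `[a, b]` is a local maximum of `f` for some `b ≥ a`: the function is constant on `[a, b]`
and strictly smaller just before `a` and just after `b`. If `a = b` this is a strict local
maximum at a point, otherwise a flat one, and `a` is its initial point. -/
def IsMaximumStart (f : ℝ → ℝ) (a : ℝ) : Prop :=
  ∃ b, a ≤ b ∧ (∀ x ∈ Icc a b, f x = f a) ∧
    (∀ᶠ x in 𝓝[<] a, f x < f a) ∧ (∀ᶠ x in 𝓝[>] b, f x < f a)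

/-- The maxima of the curve in the direction `w`, each recorded by its initial point on the
parameter circle. -/
def maxima (γ : ℝ → Plane) (w : Plane) : Set UnitAddCircle :=
  (fun t : ℝ => (t : UnitAddCircle)) '' {a | IsMaximumStart (fun t => inner ℝ (γ t) w) a}

/-! ### Seifert circles -/

/-- Moves along the curve that stay on one and the same Seifert circle: passing to another
parameter of the same point of the parameter circle, moving along a side that contains no
crossing, and reaching a crossing on one strand (at the parameter `a`) and leaving it on the
other strand (at the parameter `b`), both in the direction of the orientation. -/
inductive SeifertStep (γ : ℝ → Plane) : ℝ → ℝ → Prop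
  | period (t : ℝ) (ht : t ∉ crossingParams γ) : SeifertStep γ t (t + 1)
  | along (s t : ℝ) (hst : s ≤ t) (h : Disjoint (Icc s t) (crossingParams γ)) :
      SeifertStep γ s t
  | switch (s a b t : ℝ) (hs : s < a) (hsa : Disjoint (Ico s a) (crossingParams γ))
      (hab : IsCrossing γ a b) (ht : b < t) (hbt : Disjoint (Ioc b t) (crossingParams γ)) :
      SeifertStep γ s t

/-- The Seifert circles, each given as the set of all parameters, other than those of
crossings, at which the curve runs through that circle. -/
def seifertCircles (γ : ℝ → Plane) : Set (Set ℝ) :=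
  {C | ∃ t, t ∉ crossingParams γ ∧
    C = {s | s ∉ crossingParams γ ∧ Relation.EqvGen (SeifertStep γ) t s}}

/-- The closed curve in the plane traced by a Seifert circle, with its vertices: taking the
closure adds the two end parameters of every side. -/
def trace (γ : ℝ → Plane) (C : Set ℝ) : Set Plane := γ '' closure C

/-- `p` lies inside `S`: in a bounded component of the complement of `S`. -/
def Inside (S : Set Plane) (p : Plane) : Prop :=
  p ∉ S ∧ Bornology.IsBounded (connectedComponentIn Sᶜ p)

/-- `p` lies outside `S`: in an unbounded component of the complement of `S`. -/
def Outside (S : Set Plane) (p : Plane) : Prop :=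
  p ∉ S ∧ ¬ Bornology.IsBounded (connectedComponentIn Sᶜ p)

/-- The normal vector `w` at `t` points to the side to which the Seifert circle `C` curves.
At a point of nonzero curvature it is a positive multiple of the curvature vector. If all sides
of `C` are straight, they are counted as curving to the side (left or right of the direction of
travel) to which the curve `γ` bends elsewhere. -/
def CurvesToward (γ : ℝ → Plane) (C : Set ℝ) (t : ℝ) (w : Plane) : Prop :=
  (curvature γ t ≠ 0 ∧ w = curvature γ t • rot (deriv γ t)) ∨
    ((∀ u ∈ C, curvature γ u = 0) ∧
      ∃ s, curvature γ s ≠ 0 ∧ w = curvature γ s • rot (deriv γ t))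

/-- An o-circle: all its sides curve towards its inside, so that they bulge out. -/
def IsOCircle (γ : ℝ → Plane) (C : Set ℝ) : Prop :=
  ∀ t ∈ C, ∀ w, CurvesToward γ C t w → ∀ᶠ ε in 𝓝[>] (0 : ℝ), Inside (trace γ C) (γ t + ε • w)

/-- An i-circle: all its sides curve away from its inside, so that they bulge in. -/
def IsICircle (γ : ℝ → Plane) (C : Set ℝ) : Prop :=
  ∀ t ∈ C, ∀ w, CurvesToward γ C t w → ∀ᶠ ε in 𝓝[>] (0 : ℝ), Outside (trace γ C) (γ t + ε • w)

end SpiralIndex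

/-! Let `n` be the rotation number of the projection, the number of full turns of its tangent over
one period. Up to the sign of the curvature, both sides of the formula equal `n`.

Maxima. Without s-inflection points the curvature never changes sign
(`IsSpiralForm.curvature_nonneg_or_nonpos`), so the tangent angle is monotone. A maximum in the
direction `w` is then an arrival of the angle at one prescribed value modulo 2π, and this happens
|n| times per period (`ncard_maxima`).

Circles. At a crossing the two corners produced by smoothing have opposite exterior angles
(`IsSides.sum_arg`), so 2πn is the sum of the total turnings of the Seifert circles. Each of these
is a simple closed curve with corners; Hopf's secant argument (`PiecewiseLoop.turning`) leads to a
turning of ±2π, positive exactly when the bounded side is on the left. Hence `n` counts circles with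
sign (`PlaneLoop.rotation_eq`). For nonnegative curvature the curvature vector points left and the
positive circles are the o-circles; for nonpositive curvature both the roles and the sign are
exchanged.

Two points need an argument. A Seifert circle is simple because of Alexander numbering: the winding
number of the whole curve about points just to its left (`leftIndex`) survives smoothing, yet
differs between the two incoming strands of a crossing (`exists_smoothing`). And the Jordan curve
theorem is replaced by a count: in units of 2π the turning is 2l − 1 = 2r + 1, where l and r are the
winding numbers of the circle about points on the left and right of its base point
(`turning_eq_wind`). The regions on the two sides are the same all along the circle (`sides_eq`),
and one of them is the unbounded region (`exists_unbounded_side`), where the winding number is 0.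
This fixes the turning and makes the other side bounded (`circle_dichotomy`). -/

namespace SpiralIndex

/-! ### Angle lifts of nonvanishing complex functions -/

/-- `Θ` is a continuous determination of the argument of `f` on `K`. -/
def AngleLift {X : Type*} [TopologicalSpace X] (f : X → ℂ) (Θ : X → ℝ) (K : Set X) : Prop :=
  ContinuousOn Θ K ∧ ∀ x ∈ K, f x = ‖f x‖ * Complex.exp (Θ x * Complex.I)

/-- A convex set contracts along segments to `x0`, where `log` provides a start. The contraction
lifts through the covering `exp`, and the imaginary part of the lift at time 1 is an angle. -/
theorem exists_angleLift_of_convex {E : Type*} [NormedAddCommGroup E] [NormedSpace ℝ E]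
    {K : Set E} (hK : Convex ℝ K) {f : E → ℂ} (hf : ContinuousOn f K) (h0 : ∀ x ∈ K, f x ≠ 0) :
    ∃ Θ : E → ℝ, AngleLift f Θ K := by
  classical
  rcases K.eq_empty_or_nonempty with rfl | ⟨x0, hx0⟩
  · exact ⟨fun _ => 0, by simp [AngleLift]⟩
  have hmem : ∀ (r : unitInterval) (x : K), x0 + (r : ℝ) • ((x : E) - x0) ∈ K := by
    intro r x
    have := hK.add_smul_sub_mem hx0 x.2 r.2
    exact this
  let H : C(unitInterval × K, {z : ℂ // z ≠ 0}) :=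
    ⟨fun q => ⟨f (x0 + (q.1 : ℝ) • ((q.2 : E) - x0)), h0 _ (hmem q.1 q.2)⟩, by
      refine Continuous.subtype_mk ?_ _
      exact hf.comp_continuous (by fun_prop) (fun q => hmem q.1 q.2)⟩
  let c0 : ℂ := Complex.log (f x0)
  let F : C(K, ℂ) := ContinuousMap.const K c0
  have hH0 : ∀ a : K, H (0, a) =
      (fun z : ℂ ↦ (⟨_, z.exp_ne_zero⟩ : {z : ℂ // z ≠ 0})) (F a) := by
    intro a
    apply Subtype.ext
    simp [H, F, c0, Complex.exp_log (h0 _ hx0)]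
  let L := Complex.isCoveringMap_exp.liftHomotopy H F hH0
  have hL := Complex.isCoveringMap_exp.liftHomotopy_lifts H F hH0
  have hL1 : ∀ x : K, Complex.exp (L (1, x)) = f x := by
    intro x
    have := congrArg Subtype.val (congrFun hL (1, x))
    change Complex.exp (L (1, x)) = f (x0 + ((1 : unitInterval) : ℝ) • ((x : E) - x0)) at this
    simpa only [Set.Icc.coe_one, one_smul, add_sub_cancel] using this
  refine ⟨fun x => if h : x ∈ K then (L (1, ⟨x, h⟩)).im else 0, ?_, ?_⟩
  · rw [continuousOn_iff_continuous_domRestrict]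
    have : K.domRestrict (fun x => if h : x ∈ K then (L (1, ⟨x, h⟩)).im else 0) =
        fun x : K => (L (1, x)).im := by
      ext x
      simp
    rw [this]
    fun_prop
  · intro x hx
    simp only [hx, dite_true]
    rw [← hL1 ⟨x, hx⟩, Complex.norm_exp, Complex.ofReal_exp, ← Complex.exp_add, Complex.re_add_im]

theorem AngleLift.mono {X : Type*} [TopologicalSpace X] {f : X → ℂ} {Θ : X → ℝ} {K K' : Set X}
    (h : AngleLift f Θ K) (hK : K' ⊆ K) : AngleLift f Θ K' :=
  ⟨h.1.mono hK, fun x hx => h.2 x (hK hx)⟩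

theorem AngleLift.comp {X Y : Type*} [TopologicalSpace X] [TopologicalSpace Y] {f : X → ℂ}
    {Θ : X → ℝ} {K : Set X} (h : AngleLift f Θ K) {φ : Y → X} {K' : Set Y}
    (hφ : ContinuousOn φ K') (hm : MapsTo φ K' K) :
    AngleLift (fun y => f (φ y)) (fun y => Θ (φ y)) K' :=
  ⟨h.1.comp hφ hm, fun _ hy => h.2 _ (hm hy)⟩

theorem AngleLift.congr {X : Type*} [TopologicalSpace X] {f g : X → ℂ} {Θ : X → ℝ} {K : Set X}
    (h : AngleLift f Θ K) (hg : ∀ x ∈ K, g x = f x) : AngleLift g Θ K :=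
  ⟨h.1, fun x hx => by rw [hg x hx]; exact h.2 x hx⟩

/-- A lift of a function lifts every product of it with a positive function. -/
theorem AngleLift.smul_pos {X : Type*} [TopologicalSpace X] {f g : X → ℂ} {Θ : X → ℝ} {K : Set X}
    (h : AngleLift f Θ K) (r : X → ℝ) (hr : ∀ x ∈ K, 0 ≤ r x) (hg : ∀ x ∈ K, g x = r x * f x) :
    AngleLift g Θ K := by
  refine ⟨h.1, fun x hx => ?_⟩
  have := h.2 x hx
  rw [hg x hx, norm_mul, Complex.norm_real, Real.norm_eq_abs, abs_of_nonneg (hr x hx)]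
  push_cast
  rw [mul_assoc, ← this]

/-- A lift of a function, shifted by a constant, lifts a constant multiple. -/
theorem AngleLift.mul_const {X : Type*} [TopologicalSpace X] {f : X → ℂ} {Θ : X → ℝ} {K : Set X}
    (h : AngleLift f Θ K) (m : ℂ) :
    AngleLift (fun x => f x * m) (fun x => Θ x + m.arg) K := by
  refine ⟨h.1.add continuousOn_const, fun x hx => ?_⟩
  have h1 := h.2 x hx
  have h2 := Complex.norm_mul_exp_arg_mul_I m
  change f x * m = _
  conv_lhs => rw [h1, ← h2]
  rw [norm_mul]
  push_cast
  rw [add_mul, Complex.exp_add]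
  ring

/-- Two lifts of functions of the same direction differ by a constant on a preconnected set. -/
theorem AngleLift.sub_eq_sub {X : Type*} [TopologicalSpace X] {f g : X → ℂ} {Θ Ψ : X → ℝ}
    {K : Set X} (hK : IsPreconnected K) (h : AngleLift f Θ K) (h' : AngleLift g Ψ K)
    (r : X → ℝ) (hr : ∀ x ∈ K, 0 < r x) (hg : ∀ x ∈ K, g x = r x * f x) (h0 : ∀ x ∈ K, f x ≠ 0)
    {x y : X} (hx : x ∈ K) (hy : y ∈ K) : Θ x - Θ y = Ψ x - Ψ y := by
  have hΘ := h.smul_pos r (fun z hz => (hr z hz).le) hg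
  -- The two angles differ by integer multiples of 2π; an integer-valued continuous function is
  -- constant on a preconnected set.
  have key : ∀ x ∈ K, ∃ n : ℤ, Θ x = Ψ x + n * (2 * Real.pi) := by
    intro x hx
    have e1 := hΘ.2 x hx
    have e2 := h'.2 x hx
    have hn : g x ≠ 0 := by
      rw [hg x hx]
      exact mul_ne_zero (by exact_mod_cast (hr x hx).ne') (h0 x hx)
    have hn' : ((‖g x‖ : ℝ) : ℂ) ≠ 0 := by exact_mod_cast norm_ne_zero_iff.2 hn
    have e3 := mul_left_cancel₀ hn' (e1.symm.trans e2)
    obtain ⟨n, hn⟩ := Complex.exp_eq_exp_iff_exists_int.1 e3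
    refine ⟨n, ?_⟩
    have := congrArg Complex.im hn
    simpa using this
  have hcont : ContinuousOn (fun x => (Θ x - Ψ x) / (2 * Real.pi)) K :=
    (h.1.sub h'.1).div_const _
  have hpi : (2 * Real.pi) ≠ 0 := by positivity
  have hmaps : MapsTo (fun x => (Θ x - Ψ x) / (2 * Real.pi)) K (range ((↑) : ℤ → ℝ)) := by
    intro x hx
    obtain ⟨n, hn⟩ := key x hx
    refine ⟨n, ?_⟩
    simp only
    rw [hn]
    field_simp
    ring
  have hdisc : IsDiscrete (range ((↑) : ℤ → ℝ)) := by
    rw [isDiscrete_iff_discreteTopology]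
    exact (Int.isClosedEmbedding_coe_real.isEmbedding.toHomeomorph).symm.isEmbedding.discreteTopology
  have := hK.constant_of_mapsTo hdisc hcont hmaps hx hy
  field_simp at this
  linarith

theorem AngleLift.sub_eq_sub_self {X : Type*} [TopologicalSpace X] {f : X → ℂ} {Θ Ψ : X → ℝ}
    {K : Set X} (hK : IsPreconnected K) (h : AngleLift f Θ K) (h' : AngleLift f Ψ K)
    (h0 : ∀ x ∈ K, f x ≠ 0) {x y : X} (hx : x ∈ K) (hy : y ∈ K) : Θ x - Θ y = Ψ x - Ψ y :=
  h.sub_eq_sub hK h' (fun _ => 1) (by simp) (by simp) h0 hx hy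

theorem angleLift_arg {X : Type*} [TopologicalSpace X] {f : X → ℂ} {K : Set X}
    (hf : ContinuousOn f K) (h : ∀ x ∈ K, f x ∈ Complex.slitPlane) :
    AngleLift f (fun x => (f x).arg) K :=
  ⟨fun x hx => (Complex.continuousAt_arg (h x hx)).comp_continuousWithinAt (hf x hx),
    fun x _ => (Complex.norm_mul_exp_arg_mul_I _).symm⟩

/-- Where `f` stays in a rotated slit plane, a lift of `f` is the principal argument up to a
constant. -/
theorem AngleLift.sub_eq_arg_sub {X : Type*} [TopologicalSpace X] {f : X → ℂ} {Θ : X → ℝ}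
    {K : Set X} (hK : IsPreconnected K) (h : AngleLift f Θ K) (hf : ContinuousOn f K) (m : ℂ)
    (hm : ∀ x ∈ K, f x * m ∈ Complex.slitPlane) {x y : X} (hx : x ∈ K) (hy : y ∈ K) :
    Θ x - Θ y = (f x * m).arg - (f y * m).arg := by
  have h1 := h.mul_const m
  have h2 := angleLift_arg (hf.mul continuousOn_const) hm
  have := h1.sub_eq_sub_self hK h2
    (fun x hx => Complex.slitPlane_ne_zero (hm x hx)) hx hy
  simpa using this

/-- Two nonzero vectors that are not opposite lie in a common open half plane. -/
theorem exists_halfPlane {z w : ℂ} (h : w / z ∈ Complex.slitPlane) :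
    ∃ m : ℂ, 0 < (z * m).re ∧ 0 < (w * m).re ∧
      (w * m).arg - (z * m).arg = (w / z).arg := by
  have hz : z ≠ 0 := by
    rintro rfl
    simp at h
  have hw : w ≠ 0 := by
    rintro rfl
    simp at h
  set α := (w / z).arg with hα
  have hα1 : -Real.pi < α := Complex.neg_pi_lt_arg _
  have hα2 : α < Real.pi := lt_of_le_of_ne (Complex.arg_le_pi _)
    (Complex.mem_slitPlane_iff_arg.1 h).1
  have hwz : w = z * (‖w / z‖ * Complex.exp (α * Complex.I)) := by
    rw [Complex.norm_mul_exp_arg_mul_I]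
    field_simp
  have hr : 0 < ‖w / z‖ := norm_pos_iff.2 (Complex.slitPlane_ne_zero h)
  -- The multiplier `m` turns the bisector of `z` and `w` into the positive real axis, so that they
  -- lie at the angles ∓α/2, both less than a right angle.
  have e1 : z * (z⁻¹ * Complex.exp ((-(α / 2) : ℝ) * Complex.I)) =
      (1 : ℝ) * Complex.exp ((-(α / 2) : ℝ) * Complex.I) := by
    field_simp
    simp
  have e2 : w * (z⁻¹ * Complex.exp ((-(α / 2) : ℝ) * Complex.I)) =
      (‖w / z‖ : ℝ) * Complex.exp ((α / 2 : ℝ) * Complex.I) := by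
    conv_lhs => rw [hwz]
    have : Complex.exp ((α / 2 : ℝ) * Complex.I) =
      Complex.exp (α * Complex.I) * Complex.exp ((-(α / 2) : ℝ) * Complex.I) := by
      rw [← Complex.exp_add]
      congr 1
      push_cast
      ring
    rw [this]
    field_simp
  have hcos : 0 < Real.cos (α / 2) :=
    Real.cos_pos_of_mem_Ioo ⟨by linarith, by linarith⟩
  refine ⟨z⁻¹ * Complex.exp ((-(α / 2) : ℝ) * Complex.I), ?_, ?_, ?_⟩
  · rw [e1, Complex.re_ofReal_mul, Complex.exp_ofReal_mul_I_re, Real.cos_neg]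
    linarith
  · rw [e2, Complex.re_ofReal_mul, Complex.exp_ofReal_mul_I_re]
    positivity
  · rw [e1, e2, Complex.arg_real_mul _ hr, Complex.arg_real_mul _ one_pos, Complex.exp_mul_I,
      Complex.exp_mul_I, Complex.arg_cos_add_sin_mul_I ⟨by linarith, by linarith⟩,
      Complex.arg_cos_add_sin_mul_I ⟨by linarith, by linarith⟩]
    ring

end SpiralIndex

namespace SpiralIndex

/-- Near a point where `f`, suitably rescaled, stays in a half plane, the limits of a lift of `f`
along any filters are determined, up to one common constant, by the limiting directions. -/
theorem AngleLift.exists_tendsto {X : Type*} [TopologicalSpace X] {f : X → ℂ} {Θ : X → ℝ}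
    {K : Set X} (hK : IsPreconnected K) (h : AngleLift f Θ K) (hf : ContinuousOn f K) (m : ℂ)
    (hm : ∀ x ∈ K, 0 < (f x * m).re) :
    ∃ C : ℝ, ∀ (l : Filter X) (T : ℂ) (ρ : X → ℝ), (∀ᶠ x in l, x ∈ K) → (∀ᶠ x in l, 0 < ρ x) →
      0 < (T * m).re → Tendsto (fun x => ρ x * f x) l (𝓝 T) →
      Tendsto Θ l (𝓝 (C + (T * m).arg)) := by
  rcases K.eq_empty_or_nonempty with rfl | ⟨x0, hx0⟩
  · refine ⟨0, fun l T ρ hl _ _ _ => ?_⟩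
    have : l = ⊥ := by simpa using hl
    simp [this]
  -- On the half plane `Θ` is the principal argument plus a constant, read off at `x0`; positive
  -- factors `ρ` do not affect the argument.
  refine ⟨Θ x0 - (f x0 * m).arg, fun l T ρ hl hρ hT ht => ?_⟩
  have h1 : Tendsto (fun x => ((ρ x * f x) * m).arg) l (𝓝 ((T * m).arg)) :=
    (Complex.continuousAt_arg (Or.inl hT)).tendsto.comp (ht.mul_const m)
  have h2 := h1.const_add (Θ x0 - (f x0 * m).arg)
  refine h2.congr' ?_
  filter_upwards [hl, hρ] with x hx hρx
  have := h.sub_eq_arg_sub hK hf m (fun x hx => Or.inl (hm x hx)) hx hx0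
  rw [mul_assoc, Complex.arg_real_mul _ hρx]
  linarith

theorem AngleLift.exp_eq {X : Type*} [TopologicalSpace X] {f : X → ℂ} {Θ : X → ℝ} {K : Set X}
    (h : AngleLift f Θ K) {x y : X} (hx : x ∈ K) (hy : y ∈ K) (hxy : f x = f y) (h0 : f x ≠ 0) :
    ∃ n : ℤ, Θ x - Θ y = n * (2 * Real.pi) := by
  have e1 := h.2 x hx
  have e2 := h.2 y hy
  rw [← hxy] at e2
  have hn' : ((‖f x‖ : ℝ) : ℂ) ≠ 0 := by exact_mod_cast norm_ne_zero_iff.2 h0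
  obtain ⟨n, hn⟩ := Complex.exp_eq_exp_iff_exists_int.1
    (mul_left_cancel₀ hn' (e1.symm.trans e2))
  refine ⟨n, ?_⟩
  have := congrArg Complex.im hn
  have h3 : Θ x = Θ y + n * (2 * Real.pi) := by simpa using this
  linarith

/-! ### Winding numbers -/

open Classical in
/-- The winding number about `p` of the restriction of `g` to `[0, L]`. -/
noncomputable def wind (g : ℝ → ℂ) (L : ℝ) (p : ℂ) : ℝ :=
  if h : ∃ Θ, AngleLift (fun t => g t - p) Θ (Icc 0 L) then
    (h.choose L - h.choose 0) / (2 * Real.pi) else 0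

theorem wind_eq {g : ℝ → ℂ} {L : ℝ} (hL : 0 ≤ L) {p : ℂ} (hp : p ∉ g '' Icc 0 L) {Θ : ℝ → ℝ}
    (h : AngleLift (fun t => g t - p) Θ (Icc 0 L)) :
    wind g L p = (Θ L - Θ 0) / (2 * Real.pi) := by
  have hex : ∃ Θ, AngleLift (fun t => g t - p) Θ (Icc 0 L) := ⟨Θ, h⟩
  rw [wind, dif_pos hex]
  rw [hex.choose_spec.sub_eq_sub_self isPreconnected_Icc h _ (right_mem_Icc.2 hL)
    (left_mem_Icc.2 hL)]
  intro t ht h0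
  exact hp ⟨t, ht, sub_eq_zero.1 h0⟩

/-- A joint angle of `g t - q` over the convex set of pairs (t, q), with `q` in a small ball, shows
that the winding number is continuous in `q`. Since the curve closes up, it is also an integer. -/
theorem wind_eq_of_isPreconnected {g : ℝ → ℂ} {L : ℝ} (hL : 0 ≤ L) (hg : ContinuousOn g (Icc 0 L))
    (hclose : g L = g 0) {A : Set ℂ} (hA : IsPreconnected A) (hAg : A ⊆ (g '' Icc 0 L)ᶜ)
    {p q : ℂ} (hp : p ∈ A) (hq : q ∈ A) : wind g L p = wind g L q := by
  have hcl : IsClosed (g '' Icc 0 L) := (isCompact_Icc.image_of_continuousOn hg).isClosed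
  have hpi : (2 * Real.pi) ≠ 0 := by positivity
  have hcont : ContinuousOn (wind g L) A := by
    intro p hp
    refine ContinuousAt.continuousWithinAt ?_
    obtain ⟨r, hr, hball⟩ := Metric.isOpen_iff.1 hcl.isOpen_compl p (hAg hp)
    have hf : ContinuousOn (fun x : ℝ × ℂ => g x.1 - x.2) (Icc 0 L ×ˢ Metric.ball p r) :=
      (hg.comp continuousOn_fst (fun x hx => hx.1)).sub continuousOn_snd
    obtain ⟨Ψ, hΨ⟩ := exists_angleLift_of_convex ((convex_Icc 0 L).prod (convex_ball p r)) hf (by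
      rintro ⟨t, q⟩ ⟨ht, hq⟩ h0
      exact hball hq ⟨t, ht, sub_eq_zero.1 h0⟩)
    have heq : ∀ q ∈ Metric.ball p r, wind g L q = (Ψ (L, q) - Ψ (0, q)) / (2 * Real.pi) := by
      intro q hq
      refine wind_eq hL (hball hq) (Θ := fun t => Ψ (t, q)) ?_
      exact hΨ.comp (φ := fun t => (t, q)) (by fun_prop) (fun t ht => ⟨ht, hq⟩)
    have hc2 : ContinuousOn (fun q => (Ψ (L, q) - Ψ (0, q)) / (2 * Real.pi)) (Metric.ball p r) := by
      refine ContinuousOn.div_const (ContinuousOn.sub ?_ ?_) _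
      · exact hΨ.1.comp (by fun_prop) (fun q hq => ⟨right_mem_Icc.2 hL, hq⟩)
      · exact hΨ.1.comp (by fun_prop) (fun q hq => ⟨left_mem_Icc.2 hL, hq⟩)
    have hmem := Metric.ball_mem_nhds p hr
    refine (hc2.continuousAt hmem).congr ?_
    filter_upwards [hmem] with q hq using (heq q hq).symm
  have hmaps : MapsTo (wind g L) A (range ((↑) : ℤ → ℝ)) := by
    intro p hp
    have hne : ∀ t ∈ Icc 0 L, g t - p ≠ 0 := fun t ht h0 => hAg hp ⟨t, ht, sub_eq_zero.1 h0⟩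
    obtain ⟨Θ, hΘ⟩ := exists_angleLift_of_convex (convex_Icc 0 L)
      (hg.sub (continuousOn_const (c := p))) hne
    obtain ⟨n, hn⟩ := hΘ.exp_eq (right_mem_Icc.2 hL) (left_mem_Icc.2 hL)
      (show g L - p = g 0 - p by rw [hclose]) (hne _ (right_mem_Icc.2 hL))
    refine ⟨n, ?_⟩
    rw [wind_eq hL (hAg hp) hΘ, hn]
    field_simp
  have hdisc : IsDiscrete (range ((↑) : ℤ → ℝ)) := by
    rw [isDiscrete_iff_discreteTopology]
    exact (Int.isClosedEmbedding_coe_real.isEmbedding.toHomeomorph).symm.isEmbedding.discreteTopology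
  exact hA.constant_of_mapsTo hdisc hcont hmaps hp hq

/-- Seen from a point outside a disc that contains the curve, the curve stays in one open half
plane; there the angle is a principal argument and returns to its initial value. -/
theorem wind_eq_zero_of_norm_lt {g : ℝ → ℂ} {L : ℝ} (hL : 0 ≤ L) (hg : ContinuousOn g (Icc 0 L))
    (hclose : g L = g 0) {R : ℝ} (hR : ∀ t ∈ Icc 0 L, ‖g t‖ ≤ R) {p : ℂ} (hp : R < ‖p‖) :
    wind g L p = 0 := by
  have hre : ∀ t ∈ Icc 0 L, 0 < ((g t - p) * (-(starRingEnd ℂ) p)).re := by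
    intro t ht
    have h1 : (g t * (starRingEnd ℂ) p).re ≤ ‖g t‖ * ‖p‖ := by
      refine (Complex.re_le_norm _).trans ?_
      rw [norm_mul, RCLike.norm_conj]
    have h2 : (p * (starRingEnd ℂ) p).re = ‖p‖ * ‖p‖ := by
      rw [Complex.mul_conj, Complex.normSq_eq_norm_sq]
      norm_cast
      ring
    have h3 : ((g t - p) * (-(starRingEnd ℂ) p)).re =
        (p * (starRingEnd ℂ) p).re - (g t * (starRingEnd ℂ) p).re := by
      rw [← Complex.sub_re]
      congr 1
      ring
    have h4 := hR t ht
    have h5 : 0 ≤ ‖g t‖ := norm_nonneg _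
    rw [h3, h2]
    nlinarith
  have hne : ∀ t ∈ Icc 0 L, g t - p ≠ 0 := by
    intro t ht h0
    have := hre t ht
    rw [h0] at this
    simp at this
  have hf : ContinuousOn (fun t => g t - p) (Icc 0 L) := hg.sub continuousOn_const
  obtain ⟨Θ, hΘ⟩ := exists_angleLift_of_convex (convex_Icc 0 L) hf hne
  rw [wind_eq hL (fun ⟨t, ht, h⟩ => hne t ht (sub_eq_zero.2 h)) hΘ,
    hΘ.sub_eq_arg_sub isPreconnected_Icc hf _ (fun t ht => Or.inl (hre t ht))
      (right_mem_Icc.2 hL) (left_mem_Icc.2 hL), hclose]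
  simp

/-- Provides the positive rescaling demanded by `AngleLift.exists_tendsto`, by which secant angles
converge to tangent angles. -/
theorem HasDerivWithinAt.tendsto_div_right {g : ℝ → ℂ} {T : ℂ} {s : Set ℝ} {x : ℝ}
    (h : HasDerivWithinAt g T s x) (hs : ∀ᶠ t in 𝓝[>] x, t ∈ s) :
    Tendsto (fun t => ((t - x)⁻¹ : ℝ) * (g t - g x)) (𝓝[>] x) (𝓝 T) := by
  have := hasDerivWithinAt_iff_tendsto_slope.1 h
  have h2 : 𝓝[>] x ≤ 𝓝[s \ {x}] x := by
    refine le_inf nhdsWithin_le_nhds ?_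
    rw [le_principal_iff]
    filter_upwards [hs, self_mem_nhdsWithin] with t h1 h2
    exact ⟨h1, ne_of_gt h2⟩
  refine (this.mono_left h2).congr (fun t => ?_)
  rw [slope_def_module, Complex.real_smul]

theorem HasDerivWithinAt.tendsto_div_left {g : ℝ → ℂ} {T : ℂ} {s : Set ℝ} {x : ℝ}
    (h : HasDerivWithinAt g T s x) (hs : ∀ᶠ t in 𝓝[<] x, t ∈ s) :
    Tendsto (fun t => ((x - t)⁻¹ : ℝ) * (g t - g x)) (𝓝[<] x) (𝓝 (-T)) := by
  have := hasDerivWithinAt_iff_tendsto_slope.1 h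
  have h2 : 𝓝[<] x ≤ 𝓝[s \ {x}] x := by
    refine le_inf nhdsWithin_le_nhds ?_
    rw [le_principal_iff]
    filter_upwards [hs, self_mem_nhdsWithin] with t h1 h2
    exact ⟨h1, ne_of_lt h2⟩
  refine (this.mono_left h2).neg.congr (fun t => ?_)
  rw [slope_def_module, Complex.real_smul, ← neg_sub t x, inv_neg]
  push_cast
  ring

/-- First-order control of the real part of a difference, paired with a vector `m`. -/
theorem HasDerivWithinAt.exists_re_pos {g : ℝ → ℂ} {T m : ℂ} {s : Set ℝ} {x : ℝ}
    (h : HasDerivWithinAt g T s x) (hT : 0 < (T * m).re) :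
    ∃ δ > 0, ∀ t ∈ s, t ≠ x → |t - x| < δ → 0 < (t - x) * ((g t - g x) * m).re := by
  rw [hasDerivWithinAt_iff_tendsto_slope] at h
  have h1 : Tendsto (fun t => (slope g x t * m).re) (𝓝[s \ {x}] x) (𝓝 (T * m).re) :=
    (Complex.continuous_re.tendsto _).comp (h.mul_const m)
  have h2 := h1.eventually (lt_mem_nhds hT)
  rw [eventually_iff, Metric.mem_nhdsWithin_iff] at h2
  obtain ⟨δ, hδ, hb⟩ := h2
  refine ⟨δ, hδ, fun t ht htx htd => ?_⟩
  have := hb ⟨by rwa [Metric.mem_ball, Real.dist_eq], ht, htx⟩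
  simp only [mem_ofPred_eq, slope_def_module, Complex.real_smul, mul_assoc,
    Complex.re_ofReal_mul] at this
  have h3 : 0 < (t - x) ^ 2 := by
    have : t - x ≠ 0 := sub_ne_zero.2 htx
    positivity
  have h4 := mul_pos h3 this
  have : t - x ≠ 0 := sub_ne_zero.2 htx
  field_simp at h4
  linarith

/-- The winding numbers of a closed curve about points on the two sides of its base point. -/
theorem wind_add_smul_eventually {g : ℝ → ℂ} {L : ℝ} (hL : 0 < L) (hg : ContinuousOn g (Icc 0 L))
    (hclose : g L = g 0) (hne : ∀ t ∈ Ioo 0 L, g t ≠ g 0) {T : ℂ} {r : ℝ} (hr : 0 < r)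
    (h0 : HasDerivWithinAt g T (Icc 0 L) 0) (h1 : HasDerivWithinAt g (r * T) (Icc 0 L) L)
    {Θ : ℝ → ℝ} (hΘ : AngleLift (fun t => g t - g 0) Θ (Ioo 0 L)) {θ0 θ1 : ℝ}
    (ht0 : Tendsto Θ (𝓝[>] 0) (𝓝 θ0)) (ht1 : Tendsto Θ (𝓝[<] L) (𝓝 θ1))
    {u : ℂ} (hu : (u / T).im ≠ 0) :
    ∀ᶠ ε : ℝ in 𝓝[>] 0, g 0 + ε * u ∉ g '' Icc 0 L ∧
      wind g L (g 0 + ε * u) = (θ1 - θ0 + (u / T).arg - (-u / T).arg) / (2 * Real.pi) := by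
  have hT : T ≠ 0 := by
    rintro rfl
    simp at hu
  have hrT : (r : ℂ) ≠ 0 := by exact_mod_cast hr.ne'
  -- Since `u` is not parallel to `T`, neither pair `T`, `-u` nor `-T`, `-u` is opposite. The half
  -- planes of `m` and `n` contain the directions from the displaced point to the curve near its
  -- start and near its end.
  obtain ⟨m, hm1, hm2, hm3⟩ := exists_halfPlane (z := T) (w := -u)
    (Or.inr (by rw [neg_div, Complex.neg_im]; exact neg_ne_zero.2 hu))
  obtain ⟨n, hn1, hn2, hn3⟩ := exists_halfPlane (z := -T) (w := -u)
    (Or.inr (by rw [neg_div_neg_eq]; exact hu))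
  rw [neg_div_neg_eq] at hn3
  obtain ⟨δ0, hδ0, hd0⟩ := HasDerivWithinAt.exists_re_pos h0 hm1
  obtain ⟨δ1, hδ1, hd1⟩ := HasDerivWithinAt.exists_re_pos h1 (m := -n)
    (by
      have : (r * T * -n).re = r * (-T * n).re := by
        rw [← Complex.re_ofReal_mul]
        congr 1
        ring
      rw [this]
      positivity)
  set δ := min (min δ0 δ1) (L / 2) with hδ
  have hδpos : 0 < δ := by positivity
  have hδL : δ ≤ L / 2 := min_le_right _ _
  have hδ0' : δ ≤ δ0 := (min_le_left _ _).trans (min_le_left _ _)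
  have hδ1' : δ ≤ δ1 := (min_le_left _ _).trans (min_le_right _ _)
  -- half plane control near the two corners
  have hA : ∀ t ε : ℝ, 0 ≤ t → t < δ → 0 ≤ ε → 0 < t + ε →
      0 < ((g t - (g 0 + ε * u)) * m).re := by
    intro t ε ht htδ hε hpos
    have e : ((g t - (g 0 + ε * u)) * m).re = ((g t - g 0) * m).re + ε * (-u * m).re := by
      rw [← Complex.re_ofReal_mul, ← Complex.add_re]
      congr 1
      ring
    rw [e]
    rcases ht.eq_or_lt with rfl | ht'
    · have : 0 < ε := by linarith
      simp only [sub_self, zero_mul, Complex.zero_re, zero_add]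
      positivity
    · have h3 := hd0 t ⟨ht, by linarith⟩ ht'.ne' (by rw [sub_zero, abs_of_pos ht']; linarith)
      rw [sub_zero] at h3
      have h4 : 0 < ((g t - g 0) * m).re := (mul_pos_iff_of_pos_left ht').1 h3
      have h5 : 0 ≤ ε * (-u * m).re := mul_nonneg hε hm2.le
      linarith
  have hB : ∀ t ε : ℝ, L - δ < t → t ≤ L → 0 ≤ ε → t < L + ε →
      0 < ((g t - (g 0 + ε * u)) * n).re := by
    intro t ε htδ ht hε hpos
    have e : ((g t - (g 0 + ε * u)) * n).re = ((g t - g L) * n).re + ε * (-u * n).re := by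
      rw [← Complex.re_ofReal_mul, ← Complex.add_re, hclose]
      congr 1
      ring
    rw [e]
    rcases ht.eq_or_lt with rfl | ht'
    · have : 0 < ε := by linarith
      simp only [sub_self, zero_mul, Complex.zero_re, zero_add]
      positivity
    · have h3 := hd1 t ⟨by linarith, ht⟩ ht'.ne
        (by rw [abs_of_neg (by linarith)]; linarith)
      have h4 : 0 < ((g t - g L) * n).re := by
        have : ((g t - g L) * -n).re = - ((g t - g L) * n).re := by
          rw [mul_neg, Complex.neg_re]
        rw [this] at h3
        have h6 : t - L < 0 := by linarith
        nlinarith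
      have h5 : 0 ≤ ε * (-u * n).re := mul_nonneg hε hn2.le
      linarith
  -- uniform distance in the middle
  obtain ⟨c0, hc0, hmid⟩ : ∃ c0 > 0, ∀ t ∈ Icc (δ / 2) (L - δ / 2), c0 ≤ ‖g t - g 0‖ := by
    have hsub : Icc (δ / 2) (L - δ / 2) ⊆ Icc 0 L := Icc_subset_Icc (by linarith) (by linarith)
    obtain ⟨t0, ht0, hmin⟩ := isCompact_Icc.exists_isMinOn (nonempty_Icc.2 (by linarith))
      (((hg.mono hsub).sub continuousOn_const).norm : ContinuousOn (fun t => ‖g t - g 0‖) _)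
    refine ⟨‖g t0 - g 0‖, norm_pos_iff.2 (sub_ne_zero.2 (hne t0 ⟨?_, ?_⟩)), fun t ht => hmin ht⟩
    · linarith [ht0.1]
    · linarith [ht0.2]
  have hunorm : 0 ≤ ‖u‖ := norm_nonneg u
  set ε0 := c0 / (2 * (‖u‖ + 1)) with hε0
  have hε0pos : 0 < ε0 := by positivity
  have hC : ∀ t ε : ℝ, t ∈ Icc (δ / 2) (L - δ / 2) → 0 ≤ ε → ε ≤ ε0 → g t - (g 0 + ε * u) ≠ 0 := by
    intro t ε ht hε hεε h
    have h3 := hmid t ht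
    have h4 : g t - g 0 = ε * u := by linear_combination h
    rw [h4, norm_mul, Complex.norm_real, Real.norm_eq_abs, abs_of_nonneg hε] at h3
    have h5 : ε * ‖u‖ ≤ ε0 * ‖u‖ := by gcongr
    have h6 : ε0 * (‖u‖ + 1) = c0 / 2 := by
      rw [hε0]
      field_simp
    nlinarith
  -- The rectangle of pairs (t, ε) without the corners (0, 0) and (L, 0), where the difference
  -- vanishes. The two strict inequalities remove just these corners and keep the set convex.
  let K : Set (ℝ × ℝ) := {q | 0 ≤ q.1 ∧ q.1 ≤ L ∧ 0 ≤ q.2 ∧ q.2 ≤ ε0 ∧ 0 < q.1 + q.2 ∧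
    q.1 < L + q.2}
  have hKc : Convex ℝ K := by
    have e : K = ((LinearMap.fst ℝ ℝ ℝ) ⁻¹' Icc 0 L ∩ (LinearMap.snd ℝ ℝ ℝ) ⁻¹' Icc 0 ε0) ∩
        ((LinearMap.fst ℝ ℝ ℝ + LinearMap.snd ℝ ℝ ℝ) ⁻¹' Ioi 0 ∩
          (LinearMap.fst ℝ ℝ ℝ - LinearMap.snd ℝ ℝ ℝ) ⁻¹' Iio L) := by
      ext q
      simp only [K, mem_ofPred_eq, mem_inter_iff, mem_preimage, mem_Icc, mem_Ioi, mem_Iio,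
        LinearMap.fst_apply, LinearMap.snd_apply, LinearMap.add_apply, LinearMap.sub_apply,
        sub_lt_iff_lt_add]
      tauto
    rw [e]
    exact (((convex_Icc _ _).linear_preimage _).inter ((convex_Icc _ _).linear_preimage _)).inter
      (((convex_Ioi _).linear_preimage _).inter ((convex_Iio _).linear_preimage _))
  let G : ℝ × ℝ → ℂ := fun q => g q.1 - (g 0 + q.2 * u)
  have hGc : ContinuousOn G K := by
    refine ContinuousOn.sub (hg.comp continuousOn_fst (fun q hq => ⟨hq.1, hq.2.1⟩)) ?_
    fun_prop
  have hGne : ∀ q ∈ K, G q ≠ 0 := by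
    rintro ⟨t, ε⟩ ⟨a1, a2, a3, a4, a5, a6⟩ h
    simp only at a1 a2 a3 a4 a5 a6
    simp only [G] at h
    by_cases b1 : t < δ
    · have := hA t ε a1 b1 a3 a5
      simp [h] at this
    by_cases b2 : L - δ < t
    · have := hB t ε b2 a2 a3 a6
      simp [h] at this
    exact hC t ε ⟨by linarith, by linarith⟩ a3 a4 h
  obtain ⟨Ψ, hΨ⟩ := exists_angleLift_of_convex hKc hGc hGne
  -- the corner at parameter 0
  have hK0 : Convex ℝ (K ∩ (LinearMap.fst ℝ ℝ ℝ) ⁻¹' Iio δ) :=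
    hKc.inter ((convex_Iio _).linear_preimage _)
  obtain ⟨C0, hC0⟩ := (hΨ.mono inter_subset_left).exists_tendsto hK0.isPreconnected
    (hGc.mono inter_subset_left) m (by
      rintro ⟨t, ε⟩ ⟨⟨a1, a2, a3, a4, a5, a6⟩, b⟩
      exact hA t ε a1 b a3 a5)
  have hK1 : Convex ℝ (K ∩ (LinearMap.fst ℝ ℝ ℝ) ⁻¹' Ioi (L - δ)) :=
    hKc.inter ((convex_Ioi _).linear_preimage _)
  obtain ⟨C1, hC1⟩ := (hΨ.mono inter_subset_left).exists_tendsto hK1.isPreconnected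
    (hGc.mono inter_subset_left) n (by
      rintro ⟨t, ε⟩ ⟨⟨a1, a2, a3, a4, a5, a6⟩, b⟩
      exact hB t ε b a2 a3 a6)
  have hev0 : ∀ᶠ t in 𝓝[>] (0 : ℝ), t ∈ Ioo 0 δ := Ioo_mem_nhdsGT hδpos
  have hev1 : ∀ᶠ t in 𝓝[<] L, t ∈ Ioo (L - δ) L := Ioo_mem_nhdsLT (by linarith)
  have l0 : Tendsto (fun t => Ψ (t, 0)) (𝓝[>] 0) (𝓝 (C0 + (T * m).arg)) := by
    have := hC0 (map (fun t => (t, (0 : ℝ))) (𝓝[>] 0)) T (fun q => q.1⁻¹) ?_ ?_ hm1 ?_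
    · exact this
    · rw [eventually_map]
      filter_upwards [hev0] with t ht
      exact ⟨⟨ht.1.le, by simp only; linarith [ht.2], le_rfl, hε0pos.le, by simpa using ht.1,
        by simp only; linarith [ht.2]⟩, ht.2⟩
    · rw [eventually_map]
      filter_upwards [hev0] with t ht
      exact inv_pos.2 ht.1
    · rw [tendsto_map'_iff]
      have := HasDerivWithinAt.tendsto_div_right h0 (by
        filter_upwards [hev0] with t ht using ⟨ht.1.le, by linarith [ht.2]⟩)
      refine this.congr (fun t => ?_)
      simp [G]
  have l1 : Tendsto (fun t => Ψ (t, 0)) (𝓝[<] L) (𝓝 (C1 + (-T * n).arg)) := by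
    have := hC1 (map (fun t => (t, (0 : ℝ))) (𝓝[<] L)) (-(r * T))
      (fun q => (L - q.1)⁻¹) ?_ ?_ ?_ ?_
    · rw [← mul_neg, mul_assoc, Complex.arg_real_mul _ hr] at this
      exact this
    · rw [eventually_map]
      filter_upwards [hev1] with t ht
      exact ⟨⟨by simp only; linarith [ht.1], ht.2.le, le_rfl, hε0pos.le,
        by simp only; linarith [ht.1], by simpa using ht.2⟩, ht.1⟩
    · rw [eventually_map]
      filter_upwards [hev1] with t ht
      exact inv_pos.2 (sub_pos.2 ht.2)
    · rw [← mul_neg, mul_assoc, Complex.re_ofReal_mul]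
      positivity
    · rw [tendsto_map'_iff]
      have := HasDerivWithinAt.tendsto_div_left h1 (by
        filter_upwards [hev1] with t ht using ⟨by linarith [ht.1], ht.2.le⟩)
      refine this.congr (fun t => ?_)
      simp [G, hclose]
  -- comparison with the given lift
  have hcmp : θ1 - θ0 = (C1 + (-T * n).arg) - (C0 + (T * m).arg) := by
    have hlift : AngleLift (fun t => g t - g 0) (fun t => Ψ (t, 0)) (Ioo 0 L) := by
      have := hΨ.comp (φ := fun t : ℝ => (t, (0 : ℝ))) (K' := Ioo 0 L) (by fun_prop) (fun t ht =>
        ⟨ht.1.le, ht.2.le, le_rfl, hε0pos.le, by simpa using ht.1, by simpa using ht.2⟩)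
      exact this.congr (fun t _ => by simp [G])
    have hx : L / 2 ∈ Ioo 0 L := ⟨by linarith, by linarith⟩
    have hconst : ∀ t ∈ Ioo 0 L, Θ t = Ψ (t, 0) + (Θ (L / 2) - Ψ (L / 2, 0)) := by
      intro t ht
      have := hΘ.sub_eq_sub_self isPreconnected_Ioo hlift
        (fun t ht => sub_ne_zero.2 (hne t ht)) ht hx
      linarith
    have e0 : θ0 = C0 + (T * m).arg + (Θ (L / 2) - Ψ (L / 2, 0)) := by
      refine tendsto_nhds_unique ht0 ((l0.add_const _).congr' ?_)
      filter_upwards [Ioo_mem_nhdsGT hL] with t ht using (hconst t ht).symm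
    have e1 : θ1 = C1 + (-T * n).arg + (Θ (L / 2) - Ψ (L / 2, 0)) := by
      refine tendsto_nhds_unique ht1 ((l1.add_const _).congr' ?_)
      filter_upwards [Ioo_mem_nhdsLT hL] with t ht using (hconst t ht).symm
    linarith
  filter_upwards [Ioo_mem_nhdsGT hε0pos] with ε hε
  have hεK : ∀ t ∈ Icc 0 L, (t, ε) ∈ K := fun t ht =>
    ⟨ht.1, ht.2, hε.1.le, hε.2.le, by simp only; linarith [ht.1, hε.1],
      by simp only; linarith [ht.2, hε.1]⟩
  have hnot : g 0 + ε * u ∉ g '' Icc 0 L := by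
    rintro ⟨t, ht, h⟩
    exact hGne (t, ε) (hεK t ht) (by simp [G, h])
  refine ⟨hnot, ?_⟩
  have hlift : AngleLift (fun t => g t - (g 0 + ε * u)) (fun t => Ψ (t, ε)) (Icc 0 L) :=
    hΨ.comp (φ := fun t : ℝ => (t, ε)) (by fun_prop) hεK
  rw [wind_eq hL.le hnot hlift]
  -- At `t = 0` and `t = L` the difference is exactly -εu. Applying the limit statements to `pure`
  -- filters evaluates `Ψ` there with the same constants `C0` and `C1` as in its limits along ε = 0.
  have hεc : ((ε⁻¹ : ℝ) : ℂ) * -(ε * u) = -u := by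
    have : (ε : ℂ) ≠ 0 := by exact_mod_cast hε.1.ne'
    push_cast
    field_simp
  have p0 : Ψ (0, ε) = C0 + (-u * m).arg := by
    have := hC0 (pure ((0 : ℝ), ε)) (-u) (fun _ => ε⁻¹) ?_ ?_ hm2 ?_
    · exact tendsto_nhds_unique (tendsto_pure_nhds _ _) this
    · rw [eventually_pure]
      exact ⟨hεK 0 (left_mem_Icc.2 hL.le), hδpos⟩
    · rw [eventually_pure]
      exact inv_pos.2 hε.1
    · convert! tendsto_pure_nhds _ _ using 2
      simp [G, -Complex.ofReal_inv, ← hεc]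
  have p1 : Ψ (L, ε) = C1 + (-u * n).arg := by
    have := hC1 (pure (L, ε)) (-u) (fun _ => ε⁻¹) ?_ ?_ hn2 ?_
    · exact tendsto_nhds_unique (tendsto_pure_nhds _ _) this
    · rw [eventually_pure]
      exact ⟨hεK L (right_mem_Icc.2 hL.le), by simp [hδpos]⟩
    · rw [eventually_pure]
      exact inv_pos.2 hε.1
    · convert! tendsto_pure_nhds _ _ using 2
      simp [G, -Complex.ofReal_inv, hclose, ← hεc]
  -- The constants cancel, and `hm3` and `hn3` turn the remaining argument differences into those of
  -- `-u / T` and `u / T`.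
  rw [p0, p1]
  congr 1
  linarith

end SpiralIndex

namespace SpiralIndex

/-! ### The theorem of turning tangents -/

/-- The triangle of ordered pairs without the diagonal and without the corner (0, n): these are the
degenerate secants of a simple closed curve. Convexity makes an angle available on all of it. -/
theorem convex_secant_domain (n : ℝ) :
    Convex ℝ {q : ℝ × ℝ | 0 ≤ q.1 ∧ q.1 < q.2 ∧ q.2 ≤ n ∧ q.2 - q.1 < n} := by
  have e : {q : ℝ × ℝ | 0 ≤ q.1 ∧ q.1 < q.2 ∧ q.2 ≤ n ∧ q.2 - q.1 < n} =
      ((LinearMap.fst ℝ ℝ ℝ) ⁻¹' Ici 0 ∩ (LinearMap.snd ℝ ℝ ℝ) ⁻¹' Iic n) ∩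
        (LinearMap.snd ℝ ℝ ℝ - LinearMap.fst ℝ ℝ ℝ) ⁻¹' Ioo 0 n := by
    ext q
    simp only [mem_ofPred_eq, mem_inter_iff, mem_preimage, mem_Ici, mem_Iic, mem_Ioo,
      LinearMap.fst_apply, LinearMap.snd_apply, LinearMap.sub_apply, sub_pos]
    tauto
  rw [e]
  exact (((convex_Ici _).linear_preimage _).inter ((convex_Iic _).linear_preimage _)).inter
    ((convex_Ioo _ _).linear_preimage _)

theorem convex_ordered_pairs (s : Set ℝ) (hs : Convex ℝ s) (t : Set ℝ) (ht : Convex ℝ t)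
    (d : Set ℝ) (hd : Convex ℝ d) :
    Convex ℝ {q : ℝ × ℝ | q.1 ∈ s ∧ q.2 ∈ t ∧ q.2 - q.1 ∈ d} := by
  have e : {q : ℝ × ℝ | q.1 ∈ s ∧ q.2 ∈ t ∧ q.2 - q.1 ∈ d} =
      (LinearMap.fst ℝ ℝ ℝ) ⁻¹' s ∩ ((LinearMap.snd ℝ ℝ ℝ) ⁻¹' t ∩
        (LinearMap.snd ℝ ℝ ℝ - LinearMap.fst ℝ ℝ ℝ) ⁻¹' d) := by
    ext q
    simp
  rw [e]
  exact (hs.linear_preimage _).inter ((ht.linear_preimage _).inter (hd.linear_preimage _))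

/-- A closed curve on `[0, N + 1]` with `N ≥ 1` that is simple and consists of `N + 1` regular
pieces `h k` of class `C¹` (with continuous difference quotients `G k`), without cusps, and
smooth at its base point. -/
structure PiecewiseLoop (N : ℕ) (g : ℝ → ℂ) (h : ℕ → ℝ → ℂ) (G : ℕ → ℝ × ℝ → ℂ) : Prop where
  pos : 1 ≤ N
  cont : ∀ k, Continuous (G k)
  diff : ∀ k u v, h k v - h k u = (v - u : ℝ) * G k (u, v)
  glue : ∀ k ≤ N, ∀ u ∈ Icc (0 : ℝ) 1, g (k + u) = h k u
  regular : ∀ k ≤ N, ∀ u ∈ Icc (0 : ℝ) 1, G k (u, u) ≠ 0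
  corner : ∀ k < N, G (k + 1) (0, 0) / G k (1, 1) ∈ Complex.slitPlane
  base : ∃ r : ℝ, 0 < r ∧ G N (1, 1) = r * G 0 (0, 0)
  closed : g (N + 1) = g 0
  inj : ∀ s t : ℝ, 0 ≤ s → s < t → t ≤ N + 1 → g s = g t → s = 0 ∧ t = N + 1

namespace PiecewiseLoop

variable {N : ℕ} {g : ℝ → ℂ} {h : ℕ → ℝ → ℂ} {G : ℕ → ℝ × ℝ → ℂ}

theorem continuous_piece (H : PiecewiseLoop N g h G) (k : ℕ) : Continuous (h k) := by
  have : h k = fun v => h k 0 + (v - 0 : ℝ) * G k (0, v) := by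
    ext v
    rw [← H.diff k 0 v]
    ring
  rw [this]
  have := H.cont k
  fun_prop

theorem continuousOn (H : PiecewiseLoop N g h G) : ContinuousOn g (Icc 0 (N + 1)) := by
  have key : ∀ j : ℕ, j ≤ N + 1 → ContinuousOn g (Icc 0 j) := by
    intro j
    induction j with
    | zero =>
      intro _
      simp
    | succ j ih =>
      intro hj
      have e : Icc (0 : ℝ) ((j + 1 : ℕ) : ℝ) = Icc 0 (j : ℝ) ∪ Icc (j : ℝ) (j + 1) := by
        rw [Icc_union_Icc_eq_Icc (by positivity) (by linarith)]
        push_cast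
        rfl
      rw [e]
      refine (ih (by omega)).union_of_isClosed ?_ isClosed_Icc isClosed_Icc
      have hc : Continuous fun t : ℝ => h j (t - j) := (H.continuous_piece j).comp (by fun_prop)
      refine hc.continuousOn.congr (fun t ht => ?_)
      have := H.glue j (by omega) (t - j) ⟨by linarith [ht.1], by linarith [ht.2]⟩
      change g t = h j (t - j)
      rw [← this]
      congr 1
      ring
  have := key (N + 1) le_rfl
  push_cast at this
  exact this

/-- The domain of the secant map. -/
abbrev dom (N : ℕ) : Set (ℝ × ℝ) :=
  {q : ℝ × ℝ | 0 ≤ q.1 ∧ q.1 < q.2 ∧ q.2 ≤ (N + 1 : ℝ) ∧ q.2 - q.1 < (N + 1 : ℝ)}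

theorem secant_continuousOn (H : PiecewiseLoop N g h G) :
    ContinuousOn (fun q : ℝ × ℝ => g q.2 - g q.1) (dom N) := by
  refine ContinuousOn.sub (H.continuousOn.comp continuousOn_snd ?_)
    (H.continuousOn.comp continuousOn_fst ?_)
  · rintro q ⟨h1, h2, h3, h4⟩
    exact ⟨by linarith, h3⟩
  · rintro q ⟨h1, h2, h3, h4⟩
    exact ⟨h1, by linarith⟩

theorem secant_ne_zero (H : PiecewiseLoop N g h G) : ∀ q ∈ dom N, g q.2 - g q.1 ≠ 0 := by
  rintro q ⟨h1, h2, h3, h4⟩ h0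
  obtain ⟨e1, e2⟩ := H.inj q.1 q.2 h1 h2 h3 (sub_eq_zero.1 h0).symm
  rw [e1, e2] at h4
  linarith

theorem cast_le {k : ℕ} (hk : k ≤ N) : (k : ℝ) ≤ N := by exact_mod_cast hk

theorem secant_piece (H : PiecewiseLoop N g h G) {k : ℕ} (hk : k ≤ N) {u v : ℝ}
    (hu : u ∈ Icc (0 : ℝ) 1) (hv : v ∈ Icc (0 : ℝ) 1) :
    g (k + v) - g (k + u) = (v - u : ℝ) * G k (u, v) := by
  rw [H.glue k hk u hu, H.glue k hk v hv, H.diff]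

theorem mem_dom (H : PiecewiseLoop N g h G) {k : ℕ} (hk : k ≤ N) {u v : ℝ}
    (hu : 0 ≤ u) (huv : u < v) (hv : v ≤ 1) : ((k + u, k + v) : ℝ × ℝ) ∈ dom N := by
  have h1 := cast_le hk
  have h2 : (0 : ℝ) ≤ k := by positivity
  have h3 : (1 : ℝ) ≤ N := by exact_mod_cast H.pos
  exact ⟨by simp only; linarith, by simp only; linarith, by simp only; linarith,
    by simp only; linarith⟩

/-- Along one piece, the secant angle turns as much as the tangent. -/
theorem exists_tendsto_piece (H : PiecewiseLoop N g h G) {Θ : ℝ × ℝ → ℝ}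
    (hΘ : AngleLift (fun q : ℝ × ℝ => g q.2 - g q.1) Θ (dom N)) {k : ℕ} (hk : k ≤ N)
    {θ : ℝ → ℝ} (hθ : AngleLift (fun u => G k (u, u)) θ (Icc 0 1)) :
    ∃ p q : ℝ, Tendsto (fun x : ℝ => Θ (k, k + x)) (𝓝[>] 0) (𝓝 p) ∧
      Tendsto (fun x : ℝ => Θ (k + 1 - x, k + 1)) (𝓝[>] 0) (𝓝 q) ∧ q - p = θ 1 - θ 0 := by
  -- On `K` the difference quotient `G k` is defined and nonzero up to the diagonal, where it is the
  -- tangent. Off the diagonal it is a positive multiple of the secant, so its angle `Λ` extends `Θ`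
  -- up to a constant.
  let K : Set (ℝ × ℝ) := {q | q.1 ∈ Icc (0 : ℝ) 1 ∧ q.2 ∈ Icc (0 : ℝ) 1 ∧ q.2 - q.1 ∈ Ici (0 : ℝ)}
  have hK : Convex ℝ K :=
    convex_ordered_pairs _ (convex_Icc 0 1) _ (convex_Icc 0 1) _ (convex_Ici 0)
  let K' : Set (ℝ × ℝ) := {q | q.1 ∈ Icc (0 : ℝ) 1 ∧ q.2 ∈ Icc (0 : ℝ) 1 ∧ q.2 - q.1 ∈ Ioi (0 : ℝ)}
  have hK' : Convex ℝ K' :=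
    convex_ordered_pairs _ (convex_Icc 0 1) _ (convex_Icc 0 1) _ (convex_Ioi 0)
  have hK'K : K' ⊆ K := fun q hq => ⟨hq.1, hq.2.1, mem_Ici.2 (mem_Ioi.1 hq.2.2).le⟩
  have hdom : ∀ q ∈ K', ((k + q.1, k + q.2) : ℝ × ℝ) ∈ dom N := fun q hq =>
    H.mem_dom hk hq.1.1 (sub_pos.1 hq.2.2) hq.2.1.2
  have hne : ∀ q ∈ K, G k q ≠ 0 := by
    rintro ⟨u, v⟩ ⟨hu, hv, huv⟩ h0
    rcases (show (0 : ℝ) ≤ v - u from huv).eq_or_lt with e | hlt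
    · have : v = u := by linarith
      subst this
      exact H.regular k hk v hu h0
    · refine H.secant_ne_zero _ (hdom (u, v) ⟨hu, hv, hlt⟩) ?_
      simp only
      rw [H.secant_piece hk hu hv, h0, mul_zero]
  obtain ⟨Λ, hΛ⟩ := exists_angleLift_of_convex hK (H.cont k).continuousOn hne
  have hΘ' : AngleLift (fun q : ℝ × ℝ => g (k + q.2) - g (k + q.1))
      (fun q => Θ (k + q.1, k + q.2)) K' :=
    hΘ.comp (φ := fun q : ℝ × ℝ => (k + q.1, k + q.2)) (by fun_prop) hdom
  have hmem : ((0, 1) : ℝ × ℝ) ∈ K' := by simp [K']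
  obtain ⟨d, hd⟩ : ∃ d, ∀ q ∈ K', Θ (k + q.1, k + q.2) = Λ q + d := by
    refine ⟨Θ (k + 0, k + 1) - Λ (0, 1), fun q hq => ?_⟩
    have := (hΛ.mono hK'K).sub_eq_sub hK'.isPreconnected hΘ' (fun q => q.2 - q.1)
      (fun q hq => hq.2.2) (fun q hq => H.secant_piece hk hq.1 hq.2.1)
      (fun q hq => hne q (hK'K hq)) hq hmem
    linarith
  have hev : ∀ᶠ x in 𝓝[>] (0 : ℝ), x ∈ Ioo (0 : ℝ) 1 := Ioo_mem_nhdsGT one_pos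
  refine ⟨Λ (0, 0) + d, Λ (1, 1) + d, ?_, ?_, ?_⟩
  · have h1 : Tendsto (fun x : ℝ => ((0, x) : ℝ × ℝ)) (𝓝[>] 0) (𝓝[K] (0, 0)) := by
      refine tendsto_nhdsWithin_iff.2 ⟨?_, ?_⟩
      · exact ((by fun_prop : Continuous fun x : ℝ => ((0, x) : ℝ × ℝ)).tendsto 0).mono_left
          nhdsWithin_le_nhds
      · filter_upwards [hev] with x hx
        exact ⟨by simp, ⟨hx.1.le, hx.2.le⟩, by simpa using hx.1.le⟩
    have h2 := ((hΛ.1 (0, 0) (by simp [K])).tendsto.comp h1).add_const d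
    refine h2.congr' ?_
    filter_upwards [hev] with x hx
    have := hd (0, x) ⟨by simp, ⟨hx.1.le, hx.2.le⟩, by simpa using hx.1⟩
    simp only [add_zero] at this
    simp [this]
  · have h1 : Tendsto (fun x : ℝ => ((1 - x, 1) : ℝ × ℝ)) (𝓝[>] 0) (𝓝[K] (1, 1)) := by
      refine tendsto_nhdsWithin_iff.2 ⟨?_, ?_⟩
      · have := ((by fun_prop : Continuous fun x : ℝ => ((1 - x, 1) : ℝ × ℝ)).tendsto 0).mono_left
          (nhdsWithin_le_nhds (s := Ioi 0))
        simpa using this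
      · filter_upwards [hev] with x hx
        exact ⟨⟨by simp only; linarith [hx.2], by simp only; linarith [hx.1]⟩, by simp,
          by simpa using hx.1.le⟩
    have h2 := ((hΛ.1 (1, 1) (by simp [K])).tendsto.comp h1).add_const d
    refine h2.congr' ?_
    filter_upwards [hev] with x hx
    have := hd (1 - x, 1) ⟨⟨by simp only; linarith [hx.2], by simp only; linarith [hx.1]⟩,
      by simp, by simpa using hx.1⟩
    simp only at this
    rw [add_sub_assoc, this]
    rfl
  · have hdiag : AngleLift (fun u => G k (u, u)) (fun u => Λ (u, u)) (Icc 0 1) :=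
      hΛ.comp (φ := fun u : ℝ => (u, u)) (by fun_prop) (fun u hu => ⟨hu, hu, by simp⟩)
    have := hdiag.sub_eq_sub_self isPreconnected_Icc hθ (H.regular k hk)
      (right_mem_Icc.2 zero_le_one) (left_mem_Icc.2 zero_le_one)
    linarith

theorem exists_forall_re_pos {f : ℝ × ℝ → ℂ} (hf : Continuous f) {u v : ℝ} {m : ℂ}
    (h : 0 < (f (u, v) * m).re) :
    ∃ δ > 0, ∀ x y, |x - u| < δ → |y - v| < δ → 0 < (f (x, y) * m).re := by
  have hc : Continuous fun q => (f q * m).re := by fun_prop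
  have := (hc.tendsto (u, v)).eventually (lt_mem_nhds h)
  obtain ⟨δ, hδ, hb⟩ := Metric.eventually_nhds_iff_ball.1 this
  refine ⟨δ, hδ, fun x y hx hy => hb (x, y) ?_⟩
  rw [Metric.mem_ball, Prod.dist_eq, Real.dist_eq, Real.dist_eq]
  exact max_lt hx hy

theorem tendsto_corner {f : ℝ × ℝ → ℂ} (hf : Continuous f) {φ : ℝ → ℝ × ℝ} (hφ : Continuous φ) :
    Tendsto (fun x => f (φ x)) (𝓝[>] 0) (𝓝 (f (φ 0))) :=
  ((hf.comp hφ).tendsto 0).mono_left nhdsWithin_le_nhds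

/-- At a corner, the secant angle turns by the exterior angle. -/
theorem sub_eq_arg_corner (H : PiecewiseLoop N g h G) {Θ : ℝ × ℝ → ℝ}
    (hΘ : AngleLift (fun q : ℝ × ℝ => g q.2 - g q.1) Θ (dom N)) {k : ℕ} (hk : k < N) {p q : ℝ}
    (hq : Tendsto (fun x : ℝ => Θ (k + 1 - x, k + 1)) (𝓝[>] 0) (𝓝 q))
    (hp : Tendsto (fun x : ℝ => Θ ((k + 1 : ℕ), (k + 1 : ℕ) + x)) (𝓝[>] 0) (𝓝 p)) :
    p - q = (G (k + 1) (0, 0) / G k (1, 1)).arg := by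
  -- Without a cusp, both one-sided tangents at the corner lie in one open half plane; nearby
  -- secants then lie there too, and no multiple of 2π can enter.
  obtain ⟨m, hm1, hm2, hm3⟩ := exists_halfPlane (H.corner k hk)
  obtain ⟨δ1, hδ1, hd1⟩ := exists_forall_re_pos (H.cont k) hm1
  obtain ⟨δ2, hδ2, hd2⟩ := exists_forall_re_pos (H.cont (k + 1)) hm2
  set δ := min (min δ1 δ2) 1 with hδ
  have hδpos : 0 < δ := by positivity
  have hle1 : δ ≤ δ1 := (min_le_left _ _).trans (min_le_left _ _)
  have hle2 : δ ≤ δ2 := (min_le_left _ _).trans (min_le_right _ _)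
  have hle3 : δ ≤ 1 := min_le_right _ _
  let A : Set (ℝ × ℝ) := dom N ∩ {q | q.1 ∈ Ioi (k + 1 - δ) ∧ q.2 ∈ Iio (k + 1 + δ) ∧
    q.2 - q.1 ∈ univ}
  have hA : Convex ℝ A := (convex_secant_domain _).inter
    (convex_ordered_pairs _ (convex_Ioi _) _ (convex_Iio _) _ convex_univ)
  have hpiece1 : ∀ s t : ℝ, k + 1 - δ < s → s ≤ t → t ≤ k + 1 →
      g t - g s = (t - s : ℝ) * G k (s - k, t - k) := by
    intro s t h1 h2 h3
    have := H.secant_piece hk.le (u := s - k) (v := t - k) ⟨by linarith, by linarith⟩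
      ⟨by linarith, by linarith⟩
    simpa using this
  have hpiece2 : ∀ s t : ℝ, k + 1 ≤ s → s ≤ t → t < k + 1 + δ →
      g t - g s = (t - s : ℝ) * G (k + 1) (s - (k + 1), t - (k + 1)) := by
    intro s t h1 h2 h3
    have := H.secant_piece (k := k + 1) hk (u := s - (k + 1)) (v := t - (k + 1))
      ⟨by linarith, by linarith⟩ ⟨by linarith, by linarith⟩
    simpa using this
  have hre1 : ∀ s t : ℝ, k + 1 - δ < s → s < t → t ≤ k + 1 → 0 < ((g t - g s) * m).re := by
    intro s t h1 h2 h3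
    rw [hpiece1 s t h1 h2.le h3, mul_assoc, Complex.re_ofReal_mul]
    refine mul_pos (by linarith) (hd1 _ _ ?_ ?_)
    · rw [abs_lt]
      constructor <;> linarith
    · rw [abs_lt]
      constructor <;> linarith
  have hre2 : ∀ s t : ℝ, k + 1 ≤ s → s < t → t < k + 1 + δ → 0 < ((g t - g s) * m).re := by
    intro s t h1 h2 h3
    rw [hpiece2 s t h1 h2.le h3, mul_assoc, Complex.re_ofReal_mul]
    refine mul_pos (by linarith) (hd2 _ _ ?_ ?_)
    · rw [abs_lt]
      constructor <;> linarith
    · rw [abs_lt]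
      constructor <;> linarith
  obtain ⟨C, hC⟩ := (hΘ.mono inter_subset_left).exists_tendsto (K := A) hA.isPreconnected
    (H.secant_continuousOn.mono inter_subset_left) m (by
      rintro ⟨s, t⟩ ⟨⟨h1, h2, h3, h4⟩, h5, h6, -⟩
      simp only [mem_Ioi, mem_Iio] at h1 h2 h3 h4 h5 h6 ⊢
      rcases le_or_gt t (k + 1) with ht | ht
      · exact hre1 s t h5 h2 ht
      rcases le_or_gt (k + 1 : ℝ) s with hs | hs
      · exact hre2 s t hs h2 h6
      -- A secant across the corner is the sum of a secant of each piece.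
      have e : ((g t - g s) * m).re = ((g t - g (k + 1)) * m).re + ((g (k + 1) - g s) * m).re := by
        rw [← Complex.add_re]
        congr 1
        ring
      rw [e]
      exact add_pos (hre2 _ _ le_rfl ht h6) (hre1 _ _ h5 hs le_rfl))
  have hkN : (k : ℝ) + 1 ≤ N := by exact_mod_cast hk
  have hk0 : (0 : ℝ) ≤ k := by positivity
  have hev : ∀ᶠ x in 𝓝[>] (0 : ℝ), x ∈ Ioo (0 : ℝ) δ := Ioo_mem_nhdsGT hδpos
  have l1 := hC (map (fun x : ℝ => ((k + 1 - x, k + 1) : ℝ × ℝ)) (𝓝[>] 0)) (G k (1, 1))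
    (fun q => (q.2 - q.1)⁻¹) (by
      rw [eventually_map]
      filter_upwards [hev] with x hx
      refine ⟨⟨?_, ?_, ?_, ?_⟩, ?_, ?_, trivial⟩ <;>
        simp only [mem_Ioi, mem_Iio]
      all_goals linarith [hx.1, hx.2]) (by
      rw [eventually_map]
      filter_upwards [hev] with x hx
      simpa using hx.1) hm1 (by
      rw [tendsto_map'_iff]
      have := tendsto_corner (H.cont k) (φ := fun x => (1 - x, 1)) (by fun_prop)
      simp only [sub_zero] at this
      refine this.congr' ?_
      filter_upwards [hev] with x hx
      have hx0 : (x : ℂ) ≠ 0 := by exact_mod_cast hx.1.ne'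
      simp only [Function.comp]
      rw [hpiece1 (k + 1 - x) (k + 1) (by linarith [hx.2]) (by linarith [hx.1]) le_rfl]
      rw [show (k + 1 - x - k : ℝ) = 1 - x by ring, show (k + 1 - k : ℝ) = 1 by ring,
        show (k + 1 - (k + 1 - x) : ℝ) = x by ring]
      push_cast
      field_simp)
  have l2 := hC (map (fun x : ℝ => (((k + 1 : ℕ), (k + 1 : ℕ) + x) : ℝ × ℝ)) (𝓝[>] 0))
    (G (k + 1) (0, 0)) (fun q => (q.2 - q.1)⁻¹) (by
      rw [eventually_map]
      filter_upwards [hev] with x hx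
      have := hx.1
      have := hx.2
      refine ⟨⟨?_, ?_, ?_, ?_⟩, ?_, ?_, trivial⟩ <;> push_cast <;>
        first | simp only [mem_Ioi, mem_Iio] | skip
      all_goals linarith) (by
      rw [eventually_map]
      filter_upwards [hev] with x hx
      simpa using hx.1) hm2 (by
      rw [tendsto_map'_iff]
      have := tendsto_corner (H.cont (k + 1)) (φ := fun x => (0, x)) (by fun_prop)
      refine this.congr' ?_
      filter_upwards [hev] with x hx
      have hx0 : (x : ℂ) ≠ 0 := by exact_mod_cast hx.1.ne'
      simp only [Function.comp]
      push_cast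
      rw [hpiece2 (k + 1) (k + 1 + x) le_rfl (by linarith [hx.1]) (by linarith [hx.2])]
      rw [show (k + 1 - (k + 1) : ℝ) = 0 by ring, show (k + 1 + x - (k + 1) : ℝ) = x by ring,
        show ((k : ℂ) + 1 + x - (k + 1)) = x by ring]
      field_simp)
  have e1 := tendsto_nhds_unique hq l1
  have e2 := tendsto_nhds_unique hp l2
  rw [e1, e2, ← hm3]
  ring

/-- The secants through the base point: both legs of the secant domain end in the same angle. -/
theorem exists_tendsto_base (H : PiecewiseLoop N g h G) {Θ : ℝ × ℝ → ℝ}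
    (hΘ : AngleLift (fun q : ℝ × ℝ => g q.2 - g q.1) Θ (dom N)) :
    ∃ Q : ℝ, Tendsto (fun t : ℝ => Θ (0, t)) (𝓝[<] (N + 1)) (𝓝 Q) ∧
      Tendsto (fun s : ℝ => Θ (s, N + 1)) (𝓝[>] 0) (𝓝 Q) := by
  obtain ⟨r, hr, hrT⟩ := H.base
  set T := G 0 (0, 0) with hT
  have hT0 : T ≠ 0 := H.regular 0 (Nat.zero_le _) 0 (by simp)
  -- Near the missing corner (0, N + 1) the secant goes back across the base point, hence nearly in
  -- the direction `-T`. Smoothness at the base point keeps all these secants in one half plane.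
  obtain ⟨m, hm1, -, -⟩ := exists_halfPlane (z := -T) (w := -T)
    (by rw [div_self (neg_ne_zero.2 hT0)]; exact Complex.one_mem_slitPlane)
  have hm1' : 0 < (G 0 (0, 0) * -m).re := by
    rw [← hT]
    convert! hm1 using 2
    ring
  have hm2' : 0 < (G N (1, 1) * -m).re := by
    rw [hrT, mul_assoc, Complex.re_ofReal_mul]
    exact mul_pos hr hm1'
  obtain ⟨δ1, hδ1, hd1⟩ := exists_forall_re_pos (H.cont 0) hm1'
  obtain ⟨δ2, hδ2, hd2⟩ := exists_forall_re_pos (H.cont N) hm2'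
  set δ := min (min δ1 δ2) 1 with hδ
  have hδpos : 0 < δ := by positivity
  have hle1 : δ ≤ δ1 := (min_le_left _ _).trans (min_le_left _ _)
  have hle2 : δ ≤ δ2 := (min_le_left _ _).trans (min_le_right _ _)
  have hle3 : δ ≤ 1 := min_le_right _ _
  have hN1 : (1 : ℝ) ≤ N := by exact_mod_cast H.pos
  let A : Set (ℝ × ℝ) := dom N ∩ {q | q.1 ∈ Iio δ ∧ q.2 ∈ Ioi (N + 1 - δ) ∧ q.2 - q.1 ∈ univ}
  have hA : Convex ℝ A := (convex_secant_domain _).inter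
    (convex_ordered_pairs _ (convex_Iio _) _ (convex_Ioi _) _ convex_univ)
  have hp0 : ∀ s : ℝ, 0 ≤ s → s < δ → g s - g 0 = (s : ℝ) * G 0 (0, s) := by
    intro s h1 h2
    have := H.secant_piece (Nat.zero_le N) (u := 0) (v := s) (by simp) ⟨h1, by linarith⟩
    simpa using this
  have hp1 : ∀ t : ℝ, N + 1 - δ < t → t ≤ N + 1 →
      g (N + 1) - g t = (N + 1 - t : ℝ) * G N (t - N, 1) := by
    intro t h1 h2
    have := H.secant_piece le_rfl (u := t - N) (v := 1) ⟨by linarith, by linarith⟩ (by simp)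
    rw [show (N + (t - N) : ℝ) = t by ring, show (1 - (t - N) : ℝ) = N + 1 - t by ring] at this
    exact this
  have hre0 : ∀ s : ℝ, 0 < s → s < δ → 0 < ((g s - g 0) * -m).re := by
    intro s h1 h2
    rw [hp0 s h1.le h2, mul_assoc, Complex.re_ofReal_mul]
    refine mul_pos h1 (hd1 _ _ (by simpa using hδ1) ?_)
    rw [abs_lt]
    constructor <;> linarith
  have hre1 : ∀ t : ℝ, N + 1 - δ < t → t < N + 1 → 0 < ((g (N + 1) - g t) * -m).re := by
    intro t h1 h2
    rw [hp1 t h1 h2.le, mul_assoc, Complex.re_ofReal_mul]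
    refine mul_pos (by linarith) (hd2 _ _ ?_ (by simpa using hδ2))
    rw [abs_lt]
    constructor <;> linarith
  obtain ⟨C, hC⟩ := (hΘ.mono inter_subset_left).exists_tendsto (K := A) hA.isPreconnected
    (H.secant_continuousOn.mono inter_subset_left) m (by
      rintro ⟨s, t⟩ ⟨⟨h1, h2, h3, h4⟩, h5, h6, -⟩
      simp only [mem_Ioi, mem_Iio] at h1 h2 h3 h4 h5 h6 ⊢
      have e : ((g t - g s) * m).re = ((g (N + 1) - g t) * -m).re + ((g s - g 0) * -m).re := by
        rw [← Complex.add_re, H.closed]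
        congr 1
        ring
      rw [e]
      rcases h1.eq_or_lt with rfl | h1
      · have := hre1 t h6 (by linarith)
        simpa using this
      rcases h3.eq_or_lt with rfl | h3
      · have := hre0 s h1 h5
        simpa using this
      exact add_pos (hre1 t h6 h3) (hre0 s h1 h5))
  refine ⟨C + (-T * m).arg, ?_, ?_⟩
  · have hev : ∀ᶠ t in 𝓝[<] (N + 1 : ℝ), t ∈ Ioo (N + 1 - δ : ℝ) (N + 1) :=
      Ioo_mem_nhdsLT (by linarith)
    have := hC (map (fun t : ℝ => ((0, t) : ℝ × ℝ)) (𝓝[<] (N + 1))) (-(r * T))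
      (fun q => (N + 1 - q.2)⁻¹) (by
        rw [eventually_map]
        filter_upwards [hev] with t ht
        have := ht.1
        have := ht.2
        refine ⟨⟨le_rfl, ?_, ?_, ?_⟩, hδpos, ht.1, trivial⟩ <;> simp only <;> linarith) (by
        rw [eventually_map]
        filter_upwards [hev] with t ht
        exact inv_pos.2 (sub_pos.2 ht.2)) (by
        rw [← mul_neg, mul_assoc, Complex.re_ofReal_mul]
        exact mul_pos hr hm1) (by
        rw [tendsto_map'_iff]
        have hc : Continuous fun t : ℝ => -G N (t - N, 1) := by
          have := H.cont N
          fun_prop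
        have h2 := (hc.tendsto (N + 1 : ℝ)).mono_left (nhdsWithin_le_nhds (s := Iio (N + 1 : ℝ)))
        rw [show (N + 1 - N : ℝ) = 1 by ring, hrT] at h2
        refine h2.congr' ?_
        filter_upwards [hev] with t ht
        have hx0 : ((N + 1 - t : ℝ) : ℂ) ≠ 0 := by exact_mod_cast (sub_pos.2 ht.2).ne'
        simp only [Function.comp]
        rw [← H.closed, show g t - g (N + 1) = -(g (N + 1) - g t) by ring, hp1 t ht.1 ht.2.le,
          Complex.ofReal_inv]
        field_simp)
    rw [← mul_neg, mul_assoc, Complex.arg_real_mul _ hr] at this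
    exact this
  · have hev : ∀ᶠ s in 𝓝[>] (0 : ℝ), s ∈ Ioo (0 : ℝ) δ := Ioo_mem_nhdsGT hδpos
    exact hC (map (fun s : ℝ => ((s, N + 1) : ℝ × ℝ)) (𝓝[>] 0)) (-T)
      (fun q => (q.1)⁻¹) (by
        rw [eventually_map]
        filter_upwards [hev] with t ht
        have := ht.1
        have := ht.2
        refine ⟨⟨?_, ?_, le_rfl, ?_⟩, ht.2, ?_, trivial⟩ <;>
          simp only [mem_Ioi]
        all_goals linarith) (by
        rw [eventually_map]
        filter_upwards [hev] with t ht
        exact inv_pos.2 ht.1) hm1 (by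
        rw [tendsto_map'_iff]
        have hc : Continuous fun t : ℝ => -G 0 (0, t) := by
          have := H.cont 0
          fun_prop
        have h2 := (hc.tendsto (0 : ℝ)).mono_left (nhdsWithin_le_nhds (s := Ioi (0 : ℝ)))
        refine h2.congr' ?_
        filter_upwards [hev] with t ht
        have hx0 : (t : ℂ) ≠ 0 := by exact_mod_cast ht.1.ne'
        simp only [Function.comp]
        rw [← neg_sub, H.closed, hp0 t ht.1.le ht.2, Complex.ofReal_inv]
        field_simp)

/-- The theorem of turning tangents: the total turning of a simple closed curve is twice the
angle through which the secants from its base point turn. -/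
theorem turning (H : PiecewiseLoop N g h G) {θ : ℕ → ℝ → ℝ}
    (hθ : ∀ k ≤ N, AngleLift (fun u => G k (u, u)) (θ k) (Icc 0 1)) :
    ∃ (Θ : ℝ → ℝ) (θ0 θ1 : ℝ), AngleLift (fun t => g t - g 0) Θ (Ioo 0 (N + 1)) ∧
      Tendsto Θ (𝓝[>] 0) (𝓝 θ0) ∧ Tendsto Θ (𝓝[<] (N + 1)) (𝓝 θ1) ∧
      ∑ k ∈ Finset.range (N + 1), (θ k 1 - θ k 0) +
        ∑ k ∈ Finset.range N, (G (k + 1) (0, 0) / G k (1, 1)).arg = 2 * (θ1 - θ0) := by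
  obtain ⟨Θ, hΘ⟩ := exists_angleLift_of_convex (convex_secant_domain (N + 1))
    H.secant_continuousOn H.secant_ne_zero
  -- `p k` and `q k` are the limiting secant angles at the two ends of the piece `k` on the
  -- diagonal; the values for `k > N` are dummies.
  have hpq : ∀ k, ∃ p q : ℝ, k ≤ N → Tendsto (fun x : ℝ => Θ (k, k + x)) (𝓝[>] 0) (𝓝 p) ∧
      Tendsto (fun x : ℝ => Θ (k + 1 - x, k + 1)) (𝓝[>] 0) (𝓝 q) ∧ q - p = θ k 1 - θ k 0 := by
    intro k
    by_cases hk : k ≤ N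
    · obtain ⟨p, q, h⟩ := H.exists_tendsto_piece hΘ hk (hθ k hk)
      exact ⟨p, q, fun _ => h⟩
    · exact ⟨0, 0, fun h => absurd h hk⟩
  choose p q hpq using hpq
  obtain ⟨Q, hQ1, hQ2⟩ := H.exists_tendsto_base hΘ
  have hN0 : (0 : ℝ) ≤ N := by positivity
  have hp0 : Tendsto (fun t : ℝ => Θ (0, t)) (𝓝[>] 0) (𝓝 (p 0)) := by
    simpa using (hpq 0 (Nat.zero_le _)).1
  have hqN : Tendsto (fun s : ℝ => Θ (s, N + 1)) (𝓝[<] (N + 1)) (𝓝 (q N)) := by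
    have h1 := (hpq N le_rfl).2.1
    have h2 : Tendsto (fun s : ℝ => (N + 1 : ℝ) - s) (𝓝[<] (N + 1)) (𝓝[>] 0) := by
      refine tendsto_nhdsWithin_iff.2 ⟨?_, ?_⟩
      · have := ((by fun_prop : Continuous fun s : ℝ => (N + 1 : ℝ) - s).tendsto (N + 1)).mono_left
          (nhdsWithin_le_nhds (s := Iio (N + 1 : ℝ)))
        simpa using this
      · filter_upwards [self_mem_nhdsWithin] with s hs
        exact sub_pos.2 (mem_Iio.1 hs)
    refine (h1.comp h2).congr (fun s => ?_)
    simp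
  have hleg : AngleLift (fun t => g t - g 0) (fun t => Θ (0, t)) (Ioo 0 (N + 1)) :=
    hΘ.comp (φ := fun t : ℝ => (0, t)) (by fun_prop)
      (fun t ht => ⟨le_rfl, ht.1, ht.2.le, by simpa using ht.2⟩)
  have hleg2 : AngleLift (fun s => g (N + 1) - g s) (fun s => Θ (s, N + 1)) (Ioo 0 (N + 1)) :=
    hΘ.comp (φ := fun s : ℝ => (s, (N + 1 : ℝ))) (by fun_prop)
      (fun t ht => ⟨ht.1.le, ht.2, le_rfl, by simpa using ht.1⟩)
  -- The secants on the two legs of the triangle, from the base point and to it, are negatives of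
  -- each other, so their angles differ by a constant `e`.
  have hleg3 := (hleg.mul_const (-1)).congr (g := fun s => g (N + 1) - g s) (fun s _ => by
    rw [H.closed]
    ring)
  have hne : ∀ s ∈ Ioo (0 : ℝ) (N + 1), g (N + 1) - g s ≠ 0 := fun s hs =>
    H.secant_ne_zero (s, N + 1) ⟨hs.1.le, hs.2, le_rfl, by simpa using hs.1⟩
  have hpos : (0 : ℝ) < N + 1 := by positivity
  have hmid : ((N + 1) / 2 : ℝ) ∈ Ioo (0 : ℝ) (N + 1) := ⟨by linarith, by linarith⟩
  set e := Θ ((N + 1) / 2, N + 1) - Θ (0, (N + 1) / 2) with he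
  have hconst : ∀ s ∈ Ioo (0 : ℝ) (N + 1), Θ (0, s) + e = Θ (s, N + 1) := by
    intro s hs
    have := hleg2.sub_eq_sub_self isPreconnected_Ioo hleg3 hne hs hmid
    linarith
  -- Each leg contributes `e = Q - p 0`, so going from one end of the diagonal to the other along
  -- the legs turns the angle by twice this amount.
  have e1 : p 0 + e = Q := by
    refine tendsto_nhds_unique ((hp0.add_const e).congr' ?_) hQ2
    filter_upwards [Ioo_mem_nhdsGT hpos] with s hs using hconst s hs
  have e2 : Q + e = q N := by
    refine tendsto_nhds_unique ((hQ1.add_const e).congr' ?_) hqN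
    filter_upwards [Ioo_mem_nhdsLT hpos] with s hs using hconst s hs
  refine ⟨_, p 0, Q, hleg, hp0, hQ1, ?_⟩
  have hs1 : ∑ k ∈ Finset.range (N + 1), (θ k 1 - θ k 0) =
      ∑ k ∈ Finset.range (N + 1), (q k - p k) :=
    Finset.sum_congr rfl fun k hk => ((hpq k (by simpa [Nat.lt_succ_iff] using hk)).2.2).symm
  have hs2 : ∑ k ∈ Finset.range N, (G (k + 1) (0, 0) / G k (1, 1)).arg =
      ∑ k ∈ Finset.range N, (p (k + 1) - q k) := by
    refine Finset.sum_congr rfl fun k hk => ?_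
    have hk' : k < N := by simpa using hk
    exact (H.sub_eq_arg_corner hΘ hk' (hpq k hk'.le).2.1 (hpq (k + 1) hk').1).symm
  -- Turnings along pieces and jumps at corners telescope along the diagonal.
  have hs3 : ∀ M : ℕ, ∑ k ∈ Finset.range (M + 1), (q k - p k) +
      ∑ k ∈ Finset.range M, (p (k + 1) - q k) = q M - p 0 := by
    intro M
    induction M with
    | zero => simp
    | succ M ih =>
      rw [Finset.sum_range_succ, Finset.sum_range_succ (fun k => p (k + 1) - q k) M]
      linarith
  rw [hs1, hs2, hs3]
  linarith

end PiecewiseLoop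

end SpiralIndex

/-! ### Total turning and winding numbers on the two sides of the base point. -/

namespace SpiralIndex

/-- The determinant of two complex numbers, as plane vectors. -/
def cross (z w : ℂ) : ℝ := z.re * w.im - z.im * w.re

theorem div_im_eq_cross (z w : ℂ) : (w / z).im = cross z w / Complex.normSq z := by
  rw [Complex.div_im, cross]
  ring

theorem arg_sub_arg_neg_of_cross_pos {z w : ℂ} (h : 0 < cross z w) :
    (w / z).arg - (-w / z).arg = Real.pi := by
  have hz : z ≠ 0 := by
    rintro rfl
    simp [cross] at h
  have him : 0 < (w / z).im := by
    rw [div_im_eq_cross]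
    exact div_pos h (Complex.normSq_pos.2 hz)
  rw [neg_div, Complex.arg_neg_eq_arg_sub_pi_of_im_pos him]
  ring

theorem arg_sub_arg_neg_of_cross_neg {z w : ℂ} (h : cross z w < 0) :
    (w / z).arg - (-w / z).arg = -Real.pi := by
  have h' : 0 < cross z (-w) := by
    simp only [cross, Complex.neg_im, Complex.neg_re] at h ⊢
    linarith
  have := arg_sub_arg_neg_of_cross_pos h'
  rw [neg_neg] at this
  linarith

theorem div_im_ne_zero_of_cross_ne_zero {z w : ℂ} (h : cross z w ≠ 0) : (w / z).im ≠ 0 := by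
  have hz : z ≠ 0 := by
    rintro rfl
    simp [cross] at h
  rw [div_im_eq_cross]
  exact div_ne_zero h (Complex.normSq_pos.2 hz).ne'

theorem hasDerivWithinAt_of_quotient {g : ℝ → ℂ} {a : ℝ} {s : Set ℝ} {Q : ℝ → ℂ}
    (hQ : ContinuousWithinAt Q s a)
    (h : ∀ᶠ t in 𝓝[s] a, g t - g a = (t - a : ℝ) * Q t) : HasDerivWithinAt g (Q a) s a := by
  rw [hasDerivWithinAt_iff_tendsto_slope]
  have h1 : Tendsto Q (𝓝[s \ {a}] a) (𝓝 (Q a)) := hQ.mono sdiff_subset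
  refine h1.congr' ?_
  have h2 : ∀ᶠ t in 𝓝[s \ {a}] a, g t - g a = (t - a : ℝ) * Q t :=
    h.filter_mono (nhdsWithin_mono _ sdiff_subset)
  filter_upwards [h2, self_mem_nhdsWithin] with t ht hta
  have : ((t - a : ℝ) : ℂ) ≠ 0 := by
    exact_mod_cast sub_ne_zero.2 hta.2
  rw [slope_def_module, ht, Complex.real_smul, Complex.ofReal_inv]
  field_simp

theorem PiecewiseLoop.hasDerivWithinAt_zero {N : ℕ} {g : ℝ → ℂ} {h : ℕ → ℝ → ℂ}
    {G : ℕ → ℝ × ℝ → ℂ} (H : PiecewiseLoop N g h G) :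
    HasDerivWithinAt g (G 0 (0, 0)) (Icc 0 (N + 1)) 0 := by
  have hc : Continuous fun t : ℝ => G 0 (0, t) := by
    have := H.cont 0
    fun_prop
  refine hasDerivWithinAt_of_quotient (Q := fun t => G 0 (0, t)) hc.continuousWithinAt ?_
  have : ∀ᶠ t in 𝓝[Icc 0 (N + 1 : ℝ)] (0 : ℝ), t < 1 :=
    nhdsWithin_le_nhds (Iio_mem_nhds one_pos)
  filter_upwards [this, self_mem_nhdsWithin] with t ht ht'
  have := H.secant_piece (Nat.zero_le N) (u := 0) (v := t) (by simp) ⟨ht'.1, ht.le⟩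
  simpa using this

theorem PiecewiseLoop.hasDerivWithinAt_last {N : ℕ} {g : ℝ → ℂ} {h : ℕ → ℝ → ℂ}
    {G : ℕ → ℝ × ℝ → ℂ} (H : PiecewiseLoop N g h G) :
    HasDerivWithinAt g (G N (1, 1)) (Icc 0 (N + 1)) (N + 1) := by
  have hc : Continuous fun t : ℝ => G N (t - N, 1) := by
    have := H.cont N
    fun_prop
  have e : G N (1, 1) = (fun t : ℝ => G N (t - N, 1)) (N + 1) := by
    simp
  rw [e]
  refine hasDerivWithinAt_of_quotient hc.continuousWithinAt ?_
  have : ∀ᶠ t in 𝓝[Icc 0 (N + 1 : ℝ)] (N + 1 : ℝ), (N : ℝ) < t :=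
    nhdsWithin_le_nhds (Ioi_mem_nhds (by linarith))
  filter_upwards [this, self_mem_nhdsWithin] with t ht ht'
  have := H.secant_piece le_rfl (u := t - N) (v := 1) ⟨by linarith, by linarith [ht'.2]⟩ (by simp)
  rw [show (N + (t - N) : ℝ) = t by ring, show (1 - (t - N) : ℝ) = N + 1 - t by ring] at this
  rw [← neg_sub, this]
  push_cast
  ring

/-- The total turning of a simple closed curve in terms of the winding numbers about the points on
the two sides of its base point. -/
theorem PiecewiseLoop.turning_eq_wind {N : ℕ} {g : ℝ → ℂ} {h : ℕ → ℝ → ℂ}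
    {G : ℕ → ℝ × ℝ → ℂ} (H : PiecewiseLoop N g h G) {θ : ℕ → ℝ → ℝ}
    (hθ : ∀ k ≤ N, AngleLift (fun u => G k (u, u)) (θ k) (Icc 0 1)) (u : ℂ) :
    (0 < cross (G 0 (0, 0)) u → ∀ᶠ ε : ℝ in 𝓝[>] 0, g 0 + ε * u ∉ g '' Icc 0 (N + 1) ∧
      ∑ k ∈ Finset.range (N + 1), (θ k 1 - θ k 0) +
        ∑ k ∈ Finset.range N, (G (k + 1) (0, 0) / G k (1, 1)).arg =
        (2 * wind g (N + 1) (g 0 + ε * u) - 1) * (2 * Real.pi)) ∧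
    (cross (G 0 (0, 0)) u < 0 → ∀ᶠ ε : ℝ in 𝓝[>] 0, g 0 + ε * u ∉ g '' Icc 0 (N + 1) ∧
      ∑ k ∈ Finset.range (N + 1), (θ k 1 - θ k 0) +
        ∑ k ∈ Finset.range N, (G (k + 1) (0, 0) / G k (1, 1)).arg =
        (2 * wind g (N + 1) (g 0 + ε * u) + 1) * (2 * Real.pi)) := by
  obtain ⟨Θ, θ0, θ1, hΘ, ht0, ht1, hsum⟩ := H.turning hθ
  obtain ⟨r, hr, hrT⟩ := H.base
  have hd1 := H.hasDerivWithinAt_last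
  rw [hrT] at hd1
  have hpos : (0 : ℝ) < N + 1 := by positivity
  have hpi : Real.pi ≠ 0 := Real.pi_ne_zero
  have hne : ∀ t ∈ Ioo (0 : ℝ) (N + 1), g t ≠ g 0 := by
    intro t ht h0
    have := (H.inj 0 t le_rfl ht.1 ht.2.le h0.symm).2
    linarith [ht.2]
  rw [hsum]
  constructor
  · intro hu
    filter_upwards [wind_add_smul_eventually hpos H.continuousOn H.closed hne hr
      H.hasDerivWithinAt_zero hd1 hΘ ht0 ht1 (div_im_ne_zero_of_cross_ne_zero hu.ne')] with ε hε
    refine ⟨hε.1, ?_⟩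
    rw [hε.2, add_sub_assoc, arg_sub_arg_neg_of_cross_pos hu]
    field_simp
    ring
  · intro hu
    filter_upwards [wind_add_smul_eventually hpos H.continuousOn H.closed hne hr
      H.hasDerivWithinAt_zero hd1 hΘ ht0 ht1 (div_im_ne_zero_of_cross_ne_zero hu.ne)] with ε hε
    refine ⟨hε.1, ?_⟩
    rw [hε.2, add_sub_assoc, arg_sub_arg_neg_of_cross_neg hu]
    field_simp
    ring

/-- The secants from the base point of a closed curve have limiting angles at both ends. -/
theorem exists_secant_lift {g : ℝ → ℂ} {L : ℝ} (hL : 0 < L) (hg : ContinuousOn g (Icc 0 L))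
    (hclose : g L = g 0) (hne : ∀ t ∈ Ioo 0 L, g t ≠ g 0) {T T' : ℂ} (hT : T ≠ 0) (hT' : T' ≠ 0)
    (h0 : HasDerivWithinAt g T (Icc 0 L) 0) (h1 : HasDerivWithinAt g T' (Icc 0 L) L) :
    ∃ (Θ : ℝ → ℝ) (θ0 θ1 : ℝ), AngleLift (fun t => g t - g 0) Θ (Ioo 0 L) ∧
      Tendsto Θ (𝓝[>] 0) (𝓝 θ0) ∧ Tendsto Θ (𝓝[<] L) (𝓝 θ1) := by
  have hf : ContinuousOn (fun t => g t - g 0) (Ioo 0 L) :=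
    (hg.mono Ioo_subset_Icc_self).sub continuousOn_const
  obtain ⟨Θ, hΘ⟩ := exists_angleLift_of_convex (convex_Ioo 0 L) hf
    (fun t ht => sub_ne_zero.2 (hne t ht))
  obtain ⟨m, hm, -, -⟩ := exists_halfPlane (z := T) (w := T)
    (by rw [div_self hT]; exact Complex.one_mem_slitPlane)
  obtain ⟨n, hn, -, -⟩ := exists_halfPlane (z := T') (w := T')
    (by rw [div_self hT']; exact Complex.one_mem_slitPlane)
  obtain ⟨δ0, hδ0, hd0⟩ := HasDerivWithinAt.exists_re_pos h0 hm
  obtain ⟨δ1, hδ1, hd1⟩ := HasDerivWithinAt.exists_re_pos h1 hn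
  obtain ⟨C0, hC0⟩ := (hΘ.mono inter_subset_left).exists_tendsto (K := Ioo 0 L ∩ Iio δ0)
    ((convex_Ioo 0 L).inter (convex_Iio δ0)).isPreconnected (hf.mono inter_subset_left) m (by
      rintro t ⟨ht, ht'⟩
      have := hd0 t ⟨ht.1.le, ht.2.le⟩ ht.1.ne' (by rw [sub_zero, abs_of_pos ht.1]; exact ht')
      rw [sub_zero] at this
      exact (mul_pos_iff_of_pos_left ht.1).1 this)
  obtain ⟨C1, hC1⟩ := (hΘ.mono inter_subset_left).exists_tendsto (K := Ioo 0 L ∩ Ioi (L - δ1))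
    ((convex_Ioo 0 L).inter (convex_Ioi _)).isPreconnected (hf.mono inter_subset_left) (-n) (by
      rintro t ⟨ht, ht'⟩
      have h3 := hd1 t ⟨ht.1.le, ht.2.le⟩ ht.2.ne
        (by rw [abs_of_neg (sub_neg.2 ht.2)]; linarith [mem_Ioi.1 ht'])
      rw [hclose] at h3
      have h4 : t - L < 0 := sub_neg.2 ht.2
      rw [mul_neg, Complex.neg_re]
      nlinarith)
  have hev0 : ∀ᶠ t in 𝓝[>] (0 : ℝ), t ∈ Ioo 0 L ∩ Iio δ0 := by
    filter_upwards [Ioo_mem_nhdsGT hL, Ioo_mem_nhdsGT hδ0] with t ht ht' using ⟨ht, ht'.2⟩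
  have hev1 : ∀ᶠ t in 𝓝[<] L, t ∈ Ioo 0 L ∩ Ioi (L - δ1) := by
    filter_upwards [Ioo_mem_nhdsLT hL, Ioo_mem_nhdsLT (show L - δ1 < L by linarith)] with t ht ht'
      using ⟨ht, ht'.1⟩
  refine ⟨Θ, _, _, hΘ, hC0 (𝓝[>] 0) T (fun t => (t - 0)⁻¹) hev0 ?_ hm ?_,
    hC1 (𝓝[<] L) (-T') (fun t => (L - t)⁻¹) hev1 ?_ (by rwa [neg_mul_neg]) ?_⟩
  · filter_upwards [hev0] with t ht
    rw [sub_zero]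
    exact inv_pos.2 ht.1.1
  · exact HasDerivWithinAt.tendsto_div_right h0 (by
      filter_upwards [hev0] with t ht using ⟨ht.1.1.le, ht.1.2.le⟩)
  · filter_upwards [hev1] with t ht
    exact inv_pos.2 (sub_pos.2 ht.1.2)
  · have := HasDerivWithinAt.tendsto_div_left h1 (by
      filter_upwards [hev1] with t ht using ⟨ht.1.1.le, ht.1.2.le⟩)
    rw [hclose] at this
    exact this

/-- Independence of the base point: shifting a global angle by one period gives another angle of the
same function, so its increment over a period is constant. -/
theorem wind_comp_add {c : ℝ → ℂ} (hc : Continuous c) (hper : Function.Periodic c 1) (t : ℝ)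
    {p : ℂ} (hp : p ∉ range c) : wind (fun s => c (t + s)) 1 p = wind c 1 p := by
  have hne : ∀ s ∈ (univ : Set ℝ), c s - p ≠ 0 := fun s _ h => hp ⟨s, sub_eq_zero.1 h⟩
  obtain ⟨Ψ, hΨ⟩ := exists_angleLift_of_convex (convex_univ (E := ℝ) (𝕜 := ℝ))
    (f := fun s => c s - p) (by fun_prop) hne
  have h1 : AngleLift (fun s => c s - p) (fun s => Ψ (s + 1)) univ :=
    (hΨ.comp (φ := fun s : ℝ => s + 1) (by fun_prop) (fun s _ => trivial)).congr
      (fun s _ => by rw [hper s])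
  have h2 := h1.sub_eq_sub_self isPreconnected_univ hΨ hne (mem_univ t) (mem_univ 0)
  rw [wind_eq zero_le_one (fun ⟨s, _, h⟩ => hp ⟨s, h⟩) (hΨ.mono (subset_univ _)),
    wind_eq (Θ := fun s => Ψ (t + s)) zero_le_one (fun ⟨s, _, h⟩ => hp ⟨t + s, h⟩)
      (hΨ.comp (φ := fun s : ℝ => t + s) (by fun_prop) (fun s _ => trivial))]
  rw [zero_add] at h2
  rw [add_zero]
  congr 1
  linarith

/-- The winding number of a closed curve jumps by one from its right side to its left side. -/
theorem wind_left_right {c c' : ℝ → ℂ} (hc : ∀ t, HasDerivAt c (c' t) t)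
    (hper : Function.Periodic c 1) {t : ℝ} (h0 : c' t ≠ 0) (hper' : c' (t + 1) = c' t)
    (hne : ∀ s ∈ Ioo (0 : ℝ) 1, c (t + s) ≠ c t) :
    ∃ w : ℝ, ∀ u : ℂ,
      (0 < cross (c' t) u → ∀ᶠ ε : ℝ in 𝓝[>] 0, c t + ε * u ∉ range c →
        wind c 1 (c t + ε * u) = w) ∧
      (cross (c' t) u < 0 → ∀ᶠ ε : ℝ in 𝓝[>] 0, c t + ε * u ∉ range c →
        wind c 1 (c t + ε * u) = w - 1) := by
  have hcont : Continuous c := continuous_iff_continuousAt.2 fun t => (hc t).continuousAt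
  let g : ℝ → ℂ := fun s => c (t + s)
  have hg : Continuous g := by fun_prop
  have hd : ∀ s, HasDerivAt g (c' (t + s)) s := fun s => (hc (t + s)).comp_const_add t s
  have hg0 : g 0 = c t := by simp [g]
  have hg1 : g 1 = g 0 := by
    simp only [g, add_zero]
    exact hper t
  have hd0 : HasDerivWithinAt g (c' t) (Icc 0 1) 0 := by
    have := (hd 0).hasDerivWithinAt (s := Icc 0 1)
    rwa [add_zero] at this
  have hd1 : HasDerivWithinAt g ((1 : ℝ) * c' t) (Icc 0 1) 1 := by
    have := (hd 1).hasDerivWithinAt (s := Icc 0 1)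
    rw [hper'] at this
    simpa using this
  have hne' : ∀ s ∈ Ioo (0 : ℝ) 1, g s ≠ g 0 := fun s hs => by
    rw [hg0]
    exact hne s hs
  obtain ⟨Θ, θ0, θ1, hΘ, ht0, ht1⟩ := exists_secant_lift one_pos hg.continuousOn hg1 hne' h0
    (by simpa using h0) hd0 hd1
  -- The arguments of `u` and `-u` relative to the tangent differ by π on the left and by -π on the
  -- right; divided by 2π, this is a jump by one.
  refine ⟨(θ1 - θ0 + Real.pi) / (2 * Real.pi), fun u => ⟨fun hu => ?_, fun hu => ?_⟩⟩
  · filter_upwards [wind_add_smul_eventually one_pos hg.continuousOn hg1 hne' one_pos hd0 hd1 hΘ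
      ht0 ht1 (div_im_ne_zero_of_cross_ne_zero hu.ne')] with ε hε hr
    rw [← wind_comp_add hcont hper t hr]
    have := hε.2
    rw [add_sub_assoc, arg_sub_arg_neg_of_cross_pos hu, hg0] at this
    exact this
  · filter_upwards [wind_add_smul_eventually one_pos hg.continuousOn hg1 hne' one_pos hd0 hd1 hΘ
      ht0 ht1 (div_im_ne_zero_of_cross_ne_zero hu.ne)] with ε hε hr
    rw [← wind_comp_add hcont hper t hr]
    have := hε.2
    rw [add_sub_assoc, arg_sub_arg_neg_of_cross_neg hu, hg0] at this
    refine this.trans ?_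
    have := Real.pi_ne_zero
    field_simp
    ring

end SpiralIndex

namespace SpiralIndex

/-! ### Closed plane curves with transverse double points -/

theorem coe_unitAddCircle_eq_iff {s t : ℝ} :
    (s : UnitAddCircle) = (t : UnitAddCircle) ↔ ∃ n : ℤ, s = t + n := by
  rw [← sub_eq_zero, ← AddCircle.coe_sub, AddCircle.coe_eq_zero_iff]
  constructor
  · rintro ⟨n, hn⟩
    exact ⟨n, by simp at hn; linarith⟩
  · rintro ⟨n, hn⟩
    exact ⟨n, by simp; linarith⟩

theorem coe_add_intCast (s : ℝ) (n : ℤ) :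
    ((s + n : ℝ) : UnitAddCircle) = (s : UnitAddCircle) :=
  coe_unitAddCircle_eq_iff.2 ⟨n, rfl⟩

/-- `c` is a model in the complex plane, with derivative `c'`, of the closed curve `γ`. -/
structure PlaneLoop (γ : ℝ → Plane) (c c' : ℝ → ℂ) : Prop where
  eq_iff : ∀ s t, c s = c t ↔ γ s = γ t
  deriv : ∀ t, HasDerivAt c (c' t) t
  cont_deriv : Continuous c'
  periodic : Function.Periodic c 1
  regular : ∀ t, c' t ≠ 0
  transverse : ∀ s t, IsCrossing γ s t → cross (c' s) (c' t) ≠ 0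
  double : ∀ s t u, IsCrossing γ s t → IsCrossing γ s u → (t : UnitAddCircle) = (u : UnitAddCircle)
  finite : ((fun t : ℝ => (t : UnitAddCircle)) '' crossingParams γ).Finite

namespace PlaneLoop

variable {γ : ℝ → Plane} {c c' : ℝ → ℂ}

theorem continuous (P : PlaneLoop γ c c') : Continuous c :=
  continuous_iff_continuousAt.2 fun t => (P.deriv t).continuousAt

theorem periodic_deriv (P : PlaneLoop γ c c') : Function.Periodic c' 1 := by
  intro t
  have h1 : HasDerivAt (fun s => c (s + 1)) (c' (t + 1)) t := (P.deriv (t + 1)).comp_add_const t 1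
  have h2 : (fun s => c (s + 1)) = c := funext P.periodic
  rw [h2] at h1
  exact h1.unique (P.deriv t)

theorem add_intCast (P : PlaneLoop γ c c') (t : ℝ) (n : ℤ) : c (t + n) = c t := by
  simpa using P.periodic.int_mul n t

theorem deriv_add_intCast (P : PlaneLoop γ c c') (t : ℝ) (n : ℤ) : c' (t + n) = c' t := by
  simpa using P.periodic_deriv.int_mul n t

theorem eq_of_coe_eq (P : PlaneLoop γ c c') {s t : ℝ}
    (h : (s : UnitAddCircle) = (t : UnitAddCircle)) : c s = c t := by
  obtain ⟨n, rfl⟩ := coe_unitAddCircle_eq_iff.1 h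
  exact P.add_intCast t n

theorem deriv_eq_of_coe_eq (P : PlaneLoop γ c c') {s t : ℝ}
    (h : (s : UnitAddCircle) = (t : UnitAddCircle)) : c' s = c' t := by
  obtain ⟨n, rfl⟩ := coe_unitAddCircle_eq_iff.1 h
  exact P.deriv_add_intCast t n

theorem isCrossing_iff (P : PlaneLoop γ c c') {s t : ℝ} :
    IsCrossing γ s t ↔ (s : UnitAddCircle) ≠ (t : UnitAddCircle) ∧ c s = c t := by
  rw [IsCrossing, P.eq_iff]

theorem isCrossing_symm {s t : ℝ} (h : IsCrossing γ s t) : IsCrossing γ t s :=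
  ⟨h.1.symm, h.2.symm⟩

theorem isCrossing_congr (P : PlaneLoop γ c c') {s t s' t' : ℝ}
    (hs : (s : UnitAddCircle) = (s' : UnitAddCircle))
    (ht : (t : UnitAddCircle) = (t' : UnitAddCircle)) :
    IsCrossing γ s t ↔ IsCrossing γ s' t' := by
  rw [P.isCrossing_iff, P.isCrossing_iff, hs, ht, P.eq_of_coe_eq hs, P.eq_of_coe_eq ht]

theorem mem_crossingParams_congr (P : PlaneLoop γ c c') {s s' : ℝ}
    (hs : (s : UnitAddCircle) = (s' : UnitAddCircle)) :
    s ∈ crossingParams γ ↔ s' ∈ crossingParams γ :=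
  exists_congr fun _ => P.isCrossing_congr hs rfl

theorem mem_crossingParams_add_intCast (P : PlaneLoop γ c c') (s : ℝ) (n : ℤ) :
    s + n ∈ crossingParams γ ↔ s ∈ crossingParams γ :=
  P.mem_crossingParams_congr (coe_add_intCast s n)

theorem coe_eq_of_eq (P : PlaneLoop γ c c') {s t : ℝ} (hs : s ∉ crossingParams γ)
    (h : c s = c t) : (s : UnitAddCircle) = (t : UnitAddCircle) := by
  by_contra hne
  exact hs ⟨t, P.isCrossing_iff.2 ⟨hne, h⟩⟩

theorem finite_crossingParams_inter (P : PlaneLoop γ c c') (a : ℝ) :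
    (crossingParams γ ∩ Ico a (a + 1)).Finite := by
  refine Set.Finite.of_finite_image (P.finite.subset (image_mono inter_subset_left)) ?_
  intro x hx y hy hxy
  exact (AddCircle.coe_eq_coe_iff_of_mem_Ico hx.2 hy.2).1 hxy

theorem eventually_notMem (P : PlaneLoop γ c c') (t : ℝ) :
    ∀ᶠ s in 𝓝[≠] t, s ∉ crossingParams γ := by
  have hfin := P.finite_crossingParams_inter (t - 1 / 2)
  have h1 : ((crossingParams γ ∩ Ico (t - 1 / 2) (t - 1 / 2 + 1)) \ {t})ᶜ ∈ 𝓝 t :=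
    (hfin.subset sdiff_subset).isClosed.isOpen_compl.mem_nhds (by simp)
  have h2 : Ico (t - 1 / 2) (t - 1 / 2 + 1) ∈ 𝓝 t := Ico_mem_nhds (by linarith) (by linarith)
  filter_upwards [nhdsWithin_le_nhds h1, nhdsWithin_le_nhds h2, self_mem_nhdsWithin] with s a b d hs
  exact a ⟨⟨hs, b⟩, d⟩

theorem eventually_notMem_nhds (P : PlaneLoop γ c c') {t : ℝ} (ht : t ∉ crossingParams γ) :
    ∀ᶠ s in 𝓝 t, s ∉ crossingParams γ := by
  have := P.eventually_notMem t
  rw [eventually_nhdsWithin_iff] at this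
  filter_upwards [this] with s hs
  by_cases h : s = t
  · rwa [h]
  · exact hs h

/-- Parameters of points near `p` are near parameters of `p`. -/
theorem exists_near (P : PlaneLoop γ c c') (p : ℂ) {r : ℝ} (hr : 0 < r) :
    ∃ η > 0, ∀ s, ‖c s - p‖ < η → ∃ s₀, c s₀ = p ∧ |s - s₀| < r := by
  -- `F` collects the parameters of one period that stay away from every parameter of `p`. By
  -- compactness the curve keeps a positive distance from `p` on it.
  let F : Set ℝ := Icc 0 1 ∩ ⋂ s₀ ∈ {s₀ | c s₀ = p}, {s | r ≤ |s - s₀|}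
  have hF : IsCompact F := by
    refine isCompact_Icc.inter_right (isClosed_biInter fun s₀ _ => ?_)
    exact isClosed_le continuous_const (by fun_prop)
  have key : ∃ η > 0, ∀ s ∈ F, η ≤ ‖c s - p‖ := by
    rcases F.eq_empty_or_nonempty with h | h
    · exact ⟨1, one_pos, by simp [h]⟩
    · have hcont := P.continuous
      obtain ⟨s1, hs1, hmin⟩ := hF.exists_isMinOn h
        (f := fun s => ‖c s - p‖) (by fun_prop)
      refine ⟨‖c s1 - p‖, norm_pos_iff.2 (sub_ne_zero.2 fun h => ?_), fun s hs => hmin hs⟩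
      have := mem_iInter₂.1 hs1.2 s1 h
      simp only [mem_ofPred_eq, sub_self, abs_zero] at this
      linarith
  obtain ⟨η, hη, hF2⟩ := key
  refine ⟨η, hη, fun s hs => ?_⟩
  by_contra hcon
  push Not at hcon
  have hfr : Int.fract s ∈ F := by
    refine ⟨⟨Int.fract_nonneg s, (Int.fract_lt_one s).le⟩, mem_iInter₂.2 fun s₀ hs₀ => ?_⟩
    have := hcon (s₀ + ⌊s⌋) (by rw [P.add_intCast]; exact hs₀)
    simp only [mem_ofPred_eq]
    rwa [← Int.self_sub_floor, sub_sub, add_comm (⌊s⌋ : ℝ)]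
  have h1 := hF2 _ hfr
  have h2 : c (Int.fract s) = c s := P.eq_of_coe_eq (by simp)
  rw [h2] at h1
  linarith

end PlaneLoop

/-! ### Local charts -/

/-- The open square of half-width `ρ`. -/
def square (ρ : ℝ) : Set (ℝ × ℝ) := Ioo (-ρ) ρ ×ˢ Ioo (-ρ) ρ

theorem square_mem_nhds {ρ : ℝ} (hρ : 0 < ρ) : square ρ ∈ 𝓝 ((0, 0) : ℝ × ℝ) :=
  prod_mem_nhds (Ioo_mem_nhds (by linarith) hρ) (Ioo_mem_nhds (by linarith) hρ)

theorem square_mono {ρ ρ' : ℝ} (h : ρ ≤ ρ') : square ρ ⊆ square ρ' :=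
  prod_mono (Ioo_subset_Ioo (by linarith) h) (Ioo_subset_Ioo (by linarith) h)

theorem exists_square_subset {U : Set (ℝ × ℝ)} (hU : U ∈ 𝓝 ((0, 0) : ℝ × ℝ)) :
    ∃ ρ > 0, square ρ ⊆ U := by
  obtain ⟨ρ, hρ, hb⟩ := Metric.mem_nhds_iff.1 hU
  refine ⟨ρ, hρ, fun q hq => hb ?_⟩
  rw [Metric.mem_ball, Prod.dist_eq, Real.dist_eq, Real.dist_eq]
  refine max_lt ?_ ?_ <;> rw [sub_zero, abs_lt]
  · exact hq.1
  · exact hq.2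

/-- The linear coordinates with respect to two independent vectors of the plane. -/
noncomputable def basisEquiv {A B : ℂ} (h : cross A B ≠ 0) : (ℝ × ℝ) ≃L[ℝ] ℂ :=
  LinearEquiv.toContinuousLinearEquiv
    { toFun := fun q => q.1 • A + q.2 • B
      map_add' := fun p q => by
        simp only [Prod.fst_add, Prod.snd_add, add_smul]
        abel
      map_smul' := fun r q => by simp [mul_assoc]
      invFun := fun z => (cross z B / cross A B, cross A z / cross A B)
      left_inv := fun q => by
        ext
        · simp only [cross, Complex.add_re, Complex.add_im, Complex.real_smul, Complex.re_ofReal_mul,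
            Complex.im_ofReal_mul]
          rw [div_eq_iff (by simpa only [cross] using h)]
          ring
        · simp only [cross, Complex.add_re, Complex.add_im, Complex.real_smul, Complex.re_ofReal_mul,
            Complex.im_ofReal_mul]
          rw [div_eq_iff (by simpa only [cross] using h)]
          ring
      right_inv := fun z => by
        apply Complex.ext
        · simp only [Complex.add_re, Complex.real_smul, Complex.re_ofReal_mul]
          field_simp
          simp only [cross]
          ring
        · simp only [Complex.add_im, Complex.real_smul, Complex.im_ofReal_mul]
          field_simp
          simp only [cross]
          ring }

theorem basisEquiv_apply {A B : ℂ} (h : cross A B ≠ 0) (q : ℝ × ℝ) :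
    basisEquiv h q = q.1 • A + q.2 • B := rfl

theorem basisEquiv_symm_apply {A B : ℂ} (h : cross A B ≠ 0) (z : ℂ) :
    (basisEquiv h).symm z = (cross z B / cross A B, cross A z / cross A B) := rfl

/-- The inverse function theorem for the sum of two curves with independent tangents. At an ordinary
point `β` will be a straight transversal, at a crossing the other strand, so that the curve becomes
one or both coordinate axes. -/
theorem exists_chart {α β : ℝ → ℂ} {A B : ℂ} (hα : HasStrictDerivAt α A 0)
    (hβ : HasStrictDerivAt β B 0) (hAB : cross A B ≠ 0) :
    ∃ ρ > 0, InjOn (fun q : ℝ × ℝ => α q.1 + β q.2) (square ρ) ∧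
      ∃ ψ : ℂ → ℝ × ℝ, (∀ᶠ p in 𝓝 (α 0 + β 0), α (ψ p).1 + β (ψ p).2 = p) ∧
        ψ (α 0 + β 0) = (0, 0) ∧
        HasFDerivAt ψ ((basisEquiv hAB).symm : ℂ →L[ℝ] ℝ × ℝ) (α 0 + β 0) := by
  have hΦ : HasStrictFDerivAt (fun q : ℝ × ℝ => α q.1 + β q.2)
      ((basisEquiv hAB : (ℝ × ℝ) ≃L[ℝ] ℂ) : (ℝ × ℝ) →L[ℝ] ℂ) (0, 0) := by
    have h1 : HasStrictFDerivAt (fun q : ℝ × ℝ => α q.1) _ ((0, 0) : ℝ × ℝ) :=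
      HasStrictFDerivAt.comp ((0, 0) : ℝ × ℝ) (g := α) hα.hasStrictFDerivAt hasStrictFDerivAt_fst
    have h2 : HasStrictFDerivAt (fun q : ℝ × ℝ => β q.2) _ ((0, 0) : ℝ × ℝ) :=
      HasStrictFDerivAt.comp ((0, 0) : ℝ × ℝ) (g := β) hβ.hasStrictFDerivAt hasStrictFDerivAt_snd
    refine (h1.add h2).congr_fderiv ?_
    ext <;> simp [basisEquiv_apply]
  obtain ⟨ρ, hρ, hsub⟩ := exists_square_subset hΦ.eventually_left_inverse
  refine ⟨ρ, hρ, fun x hx y hy hxy => ?_, hΦ.localInverse _ _ _, hΦ.eventually_right_inverse,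
    hΦ.localInverse_apply_image, hΦ.to_localInverse.hasFDerivAt⟩
  have h1 := hsub hx
  have h2 := hsub hy
  simp only [mem_ofPred_eq] at h1 h2
  rw [← h1, ← h2]
  exact congrArg _ hxy

theorem eventually_pos_of_hasDerivWithinAt {f : ℝ → ℝ} {d : ℝ}
    (h : HasDerivWithinAt f d (Ioi 0) 0) (h0 : f 0 = 0) (hd : 0 < d) :
    ∀ᶠ ε in 𝓝[>] (0 : ℝ), 0 < f ε := by
  rw [hasDerivWithinAt_iff_tendsto_slope' (by simp)] at h
  filter_upwards [h.eventually (lt_mem_nhds hd), self_mem_nhdsWithin] with ε h1 h2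
  rw [slope_def_field, h0, sub_zero, sub_zero] at h1
  exact (div_pos_iff_of_pos_right h2).1 h1

end SpiralIndex

/-! ### The regions to the left and right of the curve at a point that is not a crossing. -/

namespace SpiralIndex

theorem connectedComponentIn_eq_of_isPreconnected {S A : Set ℂ} (hA : IsPreconnected A)
    (hAS : A ⊆ Sᶜ) {p q : ℂ} (hp : p ∈ A) (hq : q ∈ A) :
    connectedComponentIn Sᶜ p = connectedComponentIn Sᶜ q :=
  connectedComponentIn_eq (hA.subset_connectedComponentIn hp hAS hq)

theorem cross_self_I_mul {z : ℂ} (hz : z ≠ 0) : 0 < cross z (Complex.I * z) := by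
  have : cross z (Complex.I * z) = Complex.normSq z := by
    simp [cross, Complex.normSq_apply]
  rw [this]
  exact Complex.normSq_pos.2 hz

theorem cross_neg_right (z w : ℂ) : cross z (-w) = -cross z w := by
  simp [cross]
  ring

theorem cross_swap (z w : ℂ) : cross z w = -cross w z := by
  simp only [cross]
  ring

theorem continuous_cross_left (w : ℂ) : Continuous fun z => cross z w := by
  unfold cross
  fun_prop

theorem continuous_cross_right (z : ℂ) : Continuous fun w => cross z w := by
  unfold cross
  fun_prop

namespace PlaneLoop

variable {γ : ℝ → Plane} {c c' : ℝ → ℂ}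

theorem strictDeriv_add (P : PlaneLoop γ c c') (t : ℝ) :
    HasStrictDerivAt (fun x => c (t + x)) (c' t) 0 := by
  have h := hasStrictDerivAt_of_hasDerivAt_of_continuousAt (f := fun x => c (t + x))
    (f' := fun x => c' (t + x)) (x := 0) (.of_forall fun x => (P.deriv (t + x)).comp_const_add t x)
    (P.cont_deriv.comp (continuous_const_add t)).continuousAt
  rwa [add_zero] at h

/-- The two sides of the curve near a point that is not a crossing. -/
theorem exists_sides (P : PlaneLoop γ c c') {t : ℝ} (ht : t ∉ crossingParams γ) {r : ℝ}
    (hr : 0 < r) :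
    ∃ Hl Hr : Set ℂ, IsPreconnected Hl ∧ IsPreconnected Hr ∧ Hl ⊆ (range c)ᶜ ∧ Hr ⊆ (range c)ᶜ ∧
      (∀ (q : ℝ → ℂ) (u : ℂ), q 0 = c t → HasDerivWithinAt q u (Ioi 0) 0 →
        0 < cross (c' t) u → ∀ᶠ ε in 𝓝[>] (0 : ℝ), q ε ∈ Hl) ∧
      (∀ (q : ℝ → ℂ) (u : ℂ), q 0 = c t → HasDerivWithinAt q u (Ioi 0) 0 →
        cross (c' t) u < 0 → ∀ᶠ ε in 𝓝[>] (0 : ℝ), q ε ∈ Hr) ∧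
      (∀ᶠ p in 𝓝 (c t), p ∈ Hl ∨ p ∈ Hr ∨ p ∈ c '' Ioo (t - r) (t + r)) ∧
      (∀ᶠ t' in 𝓝 t, ∀ᶠ ε : ℝ in 𝓝[>] 0, c t' + ε * (Complex.I * c' t) ∈ Hl ∧
        c t' + ε * -(Complex.I * c' t) ∈ Hr) := by
  set A := c' t with hA
  set B := Complex.I * A with hB
  have hAB : 0 < cross A B := cross_self_I_mul (P.regular t)
  let α : ℝ → ℂ := fun x => c (t + x)
  let β : ℝ → ℂ := fun y => y * B
  have hα : HasStrictDerivAt α A 0 := P.strictDeriv_add t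
  have hβ : HasStrictDerivAt β B 0 := by
    have := (Complex.ofRealCLM.hasStrictDerivAt (x := 0)).mul_const B
    simpa using this
  obtain ⟨ρ1, hρ1, hinj, ψ, hψ, hψ0, hψd⟩ := exists_chart hα hβ hAB.ne'
  have hp0 : α 0 + β 0 = c t := by simp [α, β]
  rw [hp0] at hψ hψ0 hψd
  let Φ : ℝ × ℝ → ℂ := fun q => α q.1 + β q.2
  have hcc := P.continuous
  have hΦ : Continuous Φ := by
    simp only [Φ, α, β]
    fun_prop
  obtain ⟨η, hη, hnear⟩ := P.exists_near (c t) (r := min r ρ1) (by positivity)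
  obtain ⟨ρ2, hρ2, hsq⟩ := exists_square_subset (U := {q | ‖Φ q - c t‖ < η}) (by
    have hc : Continuous fun q => ‖Φ q - c t‖ := by fun_prop
    refine (isOpen_lt hc continuous_const).mem_nhds ?_
    simpa [Φ, hp0] using hη)
  set ρ := min (min ρ1 ρ2) r with hρdef
  have hρ : 0 < ρ := by positivity
  have hρ1' : ρ ≤ ρ1 := (min_le_left _ _).trans (min_le_left _ _)
  have hρ2' : ρ ≤ ρ2 := (min_le_left _ _).trans (min_le_right _ _)
  have hρr : ρ ≤ r := min_le_right _ _
  -- By `exists_near` a point of the curve in the square has a parameter close to `t` modulo 1,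
  -- hence lies on the first axis by injectivity of the chart. No remote arc interferes.
  have haxis : ∀ q ∈ square ρ, Φ q ∈ range c → q.2 = 0 := by
    rintro q hq ⟨s, hs⟩
    have h1 : ‖c s - c t‖ < η := by
      rw [hs]
      exact hsq (square_mono hρ2' hq)
    obtain ⟨s₀, hs₀, hd⟩ := hnear s h1
    obtain ⟨n, rfl⟩ := coe_unitAddCircle_eq_iff.1 (P.coe_eq_of_eq ht hs₀.symm).symm
    have h2 : ((s - (t + n), 0) : ℝ × ℝ) ∈ square ρ1 := by
      refine ⟨abs_lt.1 (hd.trans_le (min_le_right _ _)), ?_⟩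
      simp [hρ1]
    have h3 := hinj (square_mono hρ1' hq) h2 (by
      change Φ q = _
      rw [← hs]
      simp only [α, β, Complex.ofReal_zero, zero_mul, add_zero]
      rw [show t + (s - (t + n)) = s + (-n : ℤ) by push_cast; ring, P.add_intCast])
    rw [h3]
  have hsub : ∀ J : Set ℝ, J ⊆ Ioo (-ρ) ρ → (0 : ℝ) ∉ J →
      Φ '' (Ioo (-ρ) ρ ×ˢ J) ⊆ (range c)ᶜ := by
    rintro J hJ h0 _ ⟨q, hq, rfl⟩ hr
    have := haxis q ⟨hq.1, hJ hq.2⟩ hr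
    exact h0 (this ▸ hq.2)
  have hψev : ∀ᶠ p in 𝓝 (c t), ψ p ∈ square ρ ∧ Φ (ψ p) = p := by
    have h1 : Tendsto ψ (𝓝 (c t)) (𝓝 (0, 0)) := by
      rw [← hψ0]
      exact hψd.continuousAt.tendsto
    exact (h1.eventually (square_mem_nhds hρ)).and hψ
  -- The second coordinate of a curve leaving `c t` with velocity `u` has the derivative `cross A u
  -- / cross A B`; its sign decides which half of the square is entered.
  have hcurve : ∀ (q : ℝ → ℂ) (u : ℂ), q 0 = c t → HasDerivWithinAt q u (Ioi 0) 0 →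
      HasDerivWithinAt (fun ε => (ψ (q ε)).2) (cross A u / cross A B) (Ioi 0) 0 ∧
      (ψ (q 0)).2 = 0 ∧ ∀ᶠ ε in 𝓝[>] (0 : ℝ), ψ (q ε) ∈ square ρ ∧ Φ (ψ (q ε)) = q ε := by
    intro q u hq0 hq
    refine ⟨?_, by rw [hq0, hψ0], ?_⟩
    · rw [← hq0] at hψd
      have h1 := hψd.comp_hasDerivWithinAt (0 : ℝ) hq
      have h2 := (hasFDerivAt_snd (𝕜 := ℝ) (p := ψ (q 0))).comp_hasDerivWithinAt (0 : ℝ) h1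
      simpa [basisEquiv_symm_apply, Function.comp_def] using h2
    · have : Tendsto q (𝓝[>] 0) (𝓝 (c t)) := by
        rw [← hq0]
        exact hq.continuousWithinAt
      exact this.eventually hψev
  refine ⟨Φ '' (Ioo (-ρ) ρ ×ˢ Ioo 0 ρ), Φ '' (Ioo (-ρ) ρ ×ˢ Ioo (-ρ) 0),
    (((convex_Ioo _ _).prod (convex_Ioo _ _)).isPreconnected).image _ hΦ.continuousOn,
    (((convex_Ioo _ _).prod (convex_Ioo _ _)).isPreconnected).image _ hΦ.continuousOn,
    hsub _ (Ioo_subset_Ioo (by linarith) le_rfl) (by simp),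
    hsub _ (Ioo_subset_Ioo le_rfl hρ.le) (by simp), ?_, ?_, ?_, ?_⟩
  · intro q u hq0 hq hu
    obtain ⟨h1, h2, h3⟩ := hcurve q u hq0 hq
    filter_upwards [eventually_pos_of_hasDerivWithinAt h1 h2 (div_pos hu hAB), h3] with ε a b
    exact ⟨ψ (q ε), ⟨b.1.1, a, b.1.2.2⟩, b.2⟩
  · intro q u hq0 hq hu
    obtain ⟨h1, h2, h3⟩ := hcurve q u hq0 hq
    filter_upwards [eventually_pos_of_hasDerivWithinAt h1.neg (by simp [h2])
      (neg_pos.2 (div_neg_of_neg_of_pos hu hAB)), h3] with ε a b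
    exact ⟨ψ (q ε), ⟨b.1.1, b.1.2.1, by simpa using a⟩, b.2⟩
  · filter_upwards [hψev] with p hp
    rcases lt_trichotomy (ψ p).2 0 with h | h | h
    · exact Or.inr (Or.inl ⟨ψ p, ⟨hp.1.1, hp.1.2.1, h⟩, hp.2⟩)
    · refine Or.inr (Or.inr ⟨t + (ψ p).1, ?_, ?_⟩)
      · have := hp.1.1
        constructor <;> linarith [this.1, this.2]
      · have h2 := hp.2
        simpa [Φ, α, β, h] using h2
    · exact Or.inl ⟨ψ p, ⟨hp.1.1, h, hp.1.2.2⟩, hp.2⟩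
  · have : ∀ᶠ t' in 𝓝 t, t' ∈ Ioo (t - ρ) (t + ρ) := Ioo_mem_nhds (by linarith) (by linarith)
    filter_upwards [this] with t' ht'
    filter_upwards [Ioo_mem_nhdsGT hρ] with ε hε
    have hx : t' - t ∈ Ioo (-ρ) ρ := ⟨by linarith [ht'.1], by linarith [ht'.2]⟩
    refine ⟨⟨(t' - t, ε), ⟨hx, hε⟩, by simp [Φ, α, β]⟩,
      ⟨(t' - t, -ε), ⟨hx, by simp only; linarith [hε.2], by simp only; linarith [hε.1]⟩,
        by simp [Φ, α, β]⟩⟩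

end PlaneLoop

/-- The component of the complement of `S` to the left of the curve at `t`. -/
def leftComp (c c' : ℝ → ℂ) (S : Set ℂ) (t : ℝ) : Set ℂ :=
  {p | ∀ᶠ ε : ℝ in 𝓝[>] 0, p ∈ connectedComponentIn Sᶜ (c t + ε * (Complex.I * c' t))}

/-- The component of the complement of `S` to the right of the curve at `t`. -/
def rightComp (c c' : ℝ → ℂ) (S : Set ℂ) (t : ℝ) : Set ℂ :=
  {p | ∀ᶠ ε : ℝ in 𝓝[>] 0, p ∈ connectedComponentIn Sᶜ (c t + ε * -(Complex.I * c' t))}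

theorem hasDerivWithinAt_add_mul (z u : ℂ) (s : Set ℝ) (x : ℝ) :
    HasDerivWithinAt (fun ε : ℝ => z + ε * u) u s x := by
  have := ((Complex.ofRealCLM.hasDerivAt (x := x)).mul_const u).const_add z
  simpa using this.hasDerivWithinAt

namespace PlaneLoop

variable {γ : ℝ → Plane} {c c' : ℝ → ℂ}

/-- Every curve that leaves `c t` towards the left enters the same connected half chart as the
normal displacements defining `leftComp`, so it sees the same component. -/
theorem eventually_comp_eq_leftComp (P : PlaneLoop γ c c') {S : Set ℂ} (hS : S ⊆ range c) {t : ℝ}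
    (ht : t ∉ crossingParams γ) {q : ℝ → ℂ} {u : ℂ} (hq0 : q 0 = c t)
    (hq : HasDerivWithinAt q u (Ioi 0) 0) (hu : 0 < cross (c' t) u) :
    ∀ᶠ ε in 𝓝[>] (0 : ℝ), q ε ∉ range c ∧ connectedComponentIn Sᶜ (q ε) = leftComp c c' S t := by
  obtain ⟨Hl, -, hpre, -, hsub, -, hl, -⟩ := P.exists_sides ht one_pos
  have hsubS : Hl ⊆ Sᶜ := hsub.trans (compl_subset_compl.2 hS)
  have h1 := hl q u hq0 hq hu
  have h2 := hl (fun ε => c t + ε * (Complex.I * c' t)) _ (by simp)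
    (hasDerivWithinAt_add_mul _ _ _ _) (cross_self_I_mul (P.regular t))
  filter_upwards [h1] with ε hε
  refine ⟨hsub hε, ?_⟩
  ext p
  have : ∀ᶠ ε' : ℝ in 𝓝[>] 0,
      (p ∈ connectedComponentIn Sᶜ (c t + ε' * (Complex.I * c' t)) ↔
        p ∈ connectedComponentIn Sᶜ (q ε)) := by
    filter_upwards [h2] with ε' hε'
    rw [connectedComponentIn_eq_of_isPreconnected hpre hsubS hε' hε]
  rw [leftComp, mem_ofPred_eq, eventually_congr this]
  simp

theorem eventually_comp_eq_rightComp (P : PlaneLoop γ c c') {S : Set ℂ} (hS : S ⊆ range c) {t : ℝ}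
    (ht : t ∉ crossingParams γ) {q : ℝ → ℂ} {u : ℂ} (hq0 : q 0 = c t)
    (hq : HasDerivWithinAt q u (Ioi 0) 0) (hu : cross (c' t) u < 0) :
    ∀ᶠ ε in 𝓝[>] (0 : ℝ), q ε ∉ range c ∧ connectedComponentIn Sᶜ (q ε) = rightComp c c' S t := by
  obtain ⟨-, Hr, -, hpre, -, hsub, -, hl, -⟩ := P.exists_sides ht one_pos
  have hsubS : Hr ⊆ Sᶜ := hsub.trans (compl_subset_compl.2 hS)
  have h1 := hl q u hq0 hq hu
  have h2 := hl (fun ε => c t + ε * -(Complex.I * c' t)) _ (by simp)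
    (hasDerivWithinAt_add_mul _ _ _ _)
    (by rw [cross_neg_right]; exact neg_neg_of_pos (cross_self_I_mul (P.regular t)))
  filter_upwards [h1] with ε hε
  refine ⟨hsub hε, ?_⟩
  ext p
  have : ∀ᶠ ε' : ℝ in 𝓝[>] 0,
      (p ∈ connectedComponentIn Sᶜ (c t + ε' * -(Complex.I * c' t)) ↔
        p ∈ connectedComponentIn Sᶜ (q ε)) := by
    filter_upwards [h2] with ε' hε'
    rw [connectedComponentIn_eq_of_isPreconnected hpre hsubS hε' hε]
  rw [rightComp, mem_ofPred_eq, eventually_congr this]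
  simp

/-- Every point near `c t` lies on the curve near `t`, or in one of the components at its two
sides. -/
theorem eventually_mem_sides (P : PlaneLoop γ c c') {S : Set ℂ} (hS : S ⊆ range c) {t : ℝ}
    (ht : t ∉ crossingParams γ) {r : ℝ} (hr : 0 < r) :
    ∀ᶠ p in 𝓝 (c t), p ∈ c '' Ioo (t - r) (t + r) ∨
      connectedComponentIn Sᶜ p = leftComp c c' S t ∨
      connectedComponentIn Sᶜ p = rightComp c c' S t := by
  obtain ⟨Hl, Hr, hprel, hprer, hsubl, hsubr, hl, hr', hcov, -⟩ := P.exists_sides ht hr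
  have hAB := cross_self_I_mul (P.regular t)
  have hneg : cross (c' t) (-(Complex.I * c' t)) < 0 := by
    rw [cross_neg_right]
    exact neg_neg_of_pos hAB
  obtain ⟨ε1, h11, -, h12⟩ := ((hl (fun ε => c t + ε * (Complex.I * c' t)) _ (by simp) (hasDerivWithinAt_add_mul _ _ _ _) hAB).and
    (P.eventually_comp_eq_leftComp hS ht (q := fun ε => c t + ε * (Complex.I * c' t)) (by simp)
      (hasDerivWithinAt_add_mul _ _ _ _) hAB)).exists
  obtain ⟨ε2, h21, -, h22⟩ := ((hr' (fun ε => c t + ε * -(Complex.I * c' t)) _ (by simp) (hasDerivWithinAt_add_mul _ _ _ _) hneg).and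
    (P.eventually_comp_eq_rightComp hS ht (q := fun ε => c t + ε * -(Complex.I * c' t)) (by simp)
      (hasDerivWithinAt_add_mul _ _ _ _) hneg)).exists
  filter_upwards [hcov] with p hp
  rcases hp with hp | hp | hp
  · refine Or.inr (Or.inl ?_)
    rw [← h12]
    exact connectedComponentIn_eq_of_isPreconnected hprel
      (hsubl.trans (compl_subset_compl.2 hS)) hp h11
  · refine Or.inr (Or.inr ?_)
    rw [← h22]
    exact connectedComponentIn_eq_of_isPreconnected hprer
      (hsubr.trans (compl_subset_compl.2 hS)) hp h21
  · exact Or.inl hp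

/-- From `c t'` the fixed normal at `t` still points to the left of the tangent at `t'`, and the
displaced points still lie in the half chart built at `t`. -/
theorem eventually_sides_eq (P : PlaneLoop γ c c') {S : Set ℂ} (hS : S ⊆ range c) {t : ℝ}
    (ht : t ∉ crossingParams γ) :
    ∀ᶠ t' in 𝓝 t, leftComp c c' S t' = leftComp c c' S t ∧
      rightComp c c' S t' = rightComp c c' S t := by
  obtain ⟨Hl, Hr, hprel, hprer, hsubl, hsubr, hl, hr', -, hev⟩ := P.exists_sides ht one_pos
  have hAB := cross_self_I_mul (P.regular t)
  have hneg : cross (c' t) (-(Complex.I * c' t)) < 0 := by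
    rw [cross_neg_right]
    exact neg_neg_of_pos hAB
  have hcr : ∀ᶠ t' in 𝓝 t, 0 < cross (c' t') (Complex.I * c' t) :=
    (((continuous_cross_left (Complex.I * c' t)).comp P.cont_deriv).tendsto t).eventually
      (lt_mem_nhds hAB)
  filter_upwards [hev, hcr, P.eventually_notMem_nhds ht] with t' h1 h2 h3
  constructor
  · obtain ⟨ε1, h11, -, h12⟩ := ((hl (fun ε => c t + ε * (Complex.I * c' t)) _ (by simp) (hasDerivWithinAt_add_mul _ _ _ _) hAB).and
      (P.eventually_comp_eq_leftComp hS ht (q := fun ε => c t + ε * (Complex.I * c' t)) (by simp)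
        (hasDerivWithinAt_add_mul _ _ _ _) hAB)).exists
    obtain ⟨ε2, h21, -, h22⟩ := (h1.and
      (P.eventually_comp_eq_leftComp hS h3 (q := fun ε => c t' + ε * (Complex.I * c' t)) (by simp)
        (hasDerivWithinAt_add_mul _ _ _ _) h2)).exists
    rw [← h12, ← h22]
    exact connectedComponentIn_eq_of_isPreconnected hprel
      (hsubl.trans (compl_subset_compl.2 hS)) h21.1 h11
  · obtain ⟨ε1, h11, -, h12⟩ := ((hr' (fun ε => c t + ε * -(Complex.I * c' t)) _ (by simp) (hasDerivWithinAt_add_mul _ _ _ _) hneg).and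
      (P.eventually_comp_eq_rightComp hS ht (q := fun ε => c t + ε * -(Complex.I * c' t)) (by simp)
        (hasDerivWithinAt_add_mul _ _ _ _) hneg)).exists
    obtain ⟨ε2, h21, -, h22⟩ := (h1.and
      (P.eventually_comp_eq_rightComp hS h3 (q := fun ε => c t' + ε * -(Complex.I * c' t)) (by simp)
        (hasDerivWithinAt_add_mul _ _ _ _)
        (by rw [cross_neg_right]; exact neg_neg_of_pos h2))).exists
    rw [← h12, ← h22]
    exact connectedComponentIn_eq_of_isPreconnected hprer
      (hsubr.trans (compl_subset_compl.2 hS)) h21.2 h11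

/-- A function that is locally constant along a preconnected set is constant on it. -/
theorem eq_of_eventually_eq {α : Type*} {f : ℝ → α} {s : Set ℝ} (hs : IsPreconnected s)
    (h : ∀ t ∈ s, ∀ᶠ t' in 𝓝 t, f t' = f t) {x y : ℝ} (hx : x ∈ s) (hy : y ∈ s) : f x = f y := by
  let _ : TopologicalSpace α := ⊥
  have _ : DiscreteTopology α := ⟨rfl⟩
  refine hs.constant (f := f) (fun t ht => ?_) hx hy
  refine ContinuousAt.continuousWithinAt ?_
  rw [ContinuousAt, nhds_discrete α, tendsto_pure]
  exact h t ht

theorem sides_eq_of_disjoint (P : PlaneLoop γ c c') {S : Set ℂ} (hS : S ⊆ range c) {J : Set ℝ}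
    (hJ : IsPreconnected J) (hd : Disjoint J (crossingParams γ)) {s t : ℝ} (hs : s ∈ J)
    (ht : t ∈ J) :
    leftComp c c' S s = leftComp c c' S t ∧ rightComp c c' S s = rightComp c c' S t :=
  ⟨eq_of_eventually_eq hJ (fun _ hx =>
      (P.eventually_sides_eq hS (disjoint_left.1 hd hx)).mono fun _ h => h.1) hs ht,
    eq_of_eventually_eq hJ (fun _ hx =>
      (P.eventually_sides_eq hS (disjoint_left.1 hd hx)).mono fun _ h => h.2) hs ht⟩

theorem sides_congr (P : PlaneLoop γ c c') (S : Set ℂ) {s t : ℝ}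
    (h : (s : UnitAddCircle) = (t : UnitAddCircle)) :
    leftComp c c' S s = leftComp c c' S t ∧ rightComp c c' S s = rightComp c c' S t := by
  simp only [leftComp, rightComp, P.eq_of_coe_eq h, P.deriv_eq_of_coe_eq h, and_self]

end PlaneLoop

end SpiralIndex

/-! ### The sectors at a crossing, Alexander numbering and smoothing. -/

namespace SpiralIndex
namespace PlaneLoop

variable {γ : ℝ → Plane} {c c' : ℝ → ℂ}

/-- The sectors at a crossing of positive sign, in terms of the sides of the four arms. -/
theorem exists_sectors (P : PlaneLoop γ c c') {a b : ℝ} (hab : IsCrossing γ a b)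
    (hpos : 0 < cross (c' a) (c' b)) :
    ∃ ρ > 0, (∀ x ∈ Ioo 0 ρ, a - x ∉ crossingParams γ ∧ a + x ∉ crossingParams γ ∧
        b - x ∉ crossingParams γ ∧ b + x ∉ crossingParams γ) ∧
      ∀ S ⊆ range c, ∀ x ∈ Ioo 0 ρ, ∀ y ∈ Ioo 0 ρ,
        leftComp c c' S (a - x) = leftComp c c' S (b + y) ∧
        rightComp c c' S (a - x) = leftComp c c' S (b - y) ∧
        leftComp c c' S (a + x) = rightComp c c' S (b + y) ∧
        rightComp c c' S (a + x) = rightComp c c' S (b - y) ∧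
        ((∀ z ∈ Ioo 0 ρ, c (a + z) ∉ S ∧ c (b - z) ∉ S) →
          rightComp c c' S (a - x) = rightComp c c' S (b + y)) ∧
        ((∀ z ∈ Ioo 0 ρ, c (a - z) ∉ S ∧ c (b + z) ∉ S) →
          leftComp c c' S (b - y) = leftComp c c' S (a + x)) := by
  obtain ⟨hne, hcab⟩ := P.isCrossing_iff.1 hab
  -- In the chart the strand through `a` is the horizontal axis and the strand through `b` the
  -- vertical one; subtracting `c a` in `β` makes both pass through the origin.
  let α : ℝ → ℂ := fun x => c (a + x)
  let β : ℝ → ℂ := fun y => c (b + y) - c a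
  have hα : HasStrictDerivAt α (c' a) 0 := P.strictDeriv_add a
  have hβ : HasStrictDerivAt β (c' b) 0 := (P.strictDeriv_add b).sub_const _
  obtain ⟨ρ1, hρ1, hinj, -⟩ := exists_chart hα hβ hpos.ne'
  let Φ : ℝ × ℝ → ℂ := fun q => α q.1 + β q.2
  have hcc := P.continuous
  have hΦ : Continuous Φ := by
    simp only [Φ, α, β]
    fun_prop
  obtain ⟨η, hη, hnear⟩ := P.exists_near (c a) hρ1
  obtain ⟨ρ2, hρ2, hsq⟩ := exists_square_subset (U := {q | ‖Φ q - c a‖ < η}) (by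
    have hc : Continuous fun q => ‖Φ q - c a‖ := by fun_prop
    refine (isOpen_lt hc continuous_const).mem_nhds ?_
    simpa [Φ, α, β, hcab] using hη)
  have hball : ∀ {t : ℝ} {p : ℝ → Prop}, (∀ᶠ s in 𝓝 t, p s) →
      ∃ δ > 0, ∀ x, |x| < δ → p (t + x) := by
    intro t p h
    obtain ⟨δ, hδ, hb⟩ := Metric.eventually_nhds_iff_ball.1 h
    exact ⟨δ, hδ, fun x hx => hb _ (by simpa [Metric.mem_ball, Real.dist_eq] using hx)⟩
  obtain ⟨δ1, hδ1, hX1⟩ := hball (eventually_nhdsWithin_iff.1 (P.eventually_notMem a))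
  obtain ⟨δ2, hδ2, hX2⟩ := hball (eventually_nhdsWithin_iff.1 (P.eventually_notMem b))
  obtain ⟨δ3, hδ3, hc3⟩ := hball ((((continuous_cross_left (c' b)).comp P.cont_deriv).tendsto
    a).eventually (lt_mem_nhds hpos))
  obtain ⟨δ4, hδ4, hc4⟩ := hball ((((continuous_cross_right (c' a)).comp P.cont_deriv).tendsto
    b).eventually (lt_mem_nhds hpos))
  set ρ := min (min ρ1 ρ2) (min (min δ1 δ2) (min δ3 δ4)) with hρdef
  have hρ : 0 < ρ := by positivity
  have i1 : ρ ≤ ρ1 := (min_le_left _ _).trans (min_le_left _ _)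
  have i2 : ρ ≤ ρ2 := (min_le_left _ _).trans (min_le_right _ _)
  have i3 : ρ ≤ δ1 := (min_le_right _ _).trans ((min_le_left _ _).trans (min_le_left _ _))
  have i4 : ρ ≤ δ2 := (min_le_right _ _).trans ((min_le_left _ _).trans (min_le_right _ _))
  have i5 : ρ ≤ δ3 := (min_le_right _ _).trans ((min_le_right _ _).trans (min_le_left _ _))
  have i6 : ρ ≤ δ4 := (min_le_right _ _).trans ((min_le_right _ _).trans (min_le_right _ _))
  clear_value ρ
  -- the curve near the crossing consists of the two axes
  have haxis : ∀ q ∈ square ρ, Φ q ∈ range c → q.2 = 0 ∨ q.1 = 0 := by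
    rintro q hq ⟨s, hs⟩
    have h1 : ‖c s - c a‖ < η := by
      rw [hs]
      exact hsq (square_mono i2 hq)
    obtain ⟨s₀, hs₀, hd⟩ := hnear s h1
    by_cases hsa : (a : UnitAddCircle) = s₀
    · left
      obtain ⟨n, rfl⟩ := coe_unitAddCircle_eq_iff.1 hsa.symm
      have h2 : ((s - (a + n), 0) : ℝ × ℝ) ∈ square ρ1 := ⟨abs_lt.1 hd, by simp [hρ1]⟩
      have h3 := hinj (square_mono i1 hq) h2 (by
        change Φ q = _
        rw [← hs]
        simp only [α, β, add_zero, hcab, sub_self]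
        rw [show a + (s - (a + n)) = s + (-n : ℤ) by push_cast; ring, P.add_intCast])
      rw [h3]
    · right
      have hcr : IsCrossing γ a s₀ := P.isCrossing_iff.2 ⟨hsa, hs₀.symm⟩
      obtain ⟨n, rfl⟩ := coe_unitAddCircle_eq_iff.1 (P.double _ _ _ hcr hab)
      have h2 : ((0, s - (b + n)) : ℝ × ℝ) ∈ square ρ1 := ⟨by simp [hρ1], abs_lt.1 hd⟩
      have h3 := hinj (square_mono i1 hq) h2 (by
        change Φ q = _
        rw [← hs]
        simp only [α, β, add_zero, add_sub_cancel]
        rw [show b + (s - (b + n)) = s + (-n : ℤ) by push_cast; ring, P.add_intCast])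
      rw [h3]
  have habs : ∀ {x : ℝ}, x ∈ Ioo (-ρ) ρ → |x| < ρ := fun hx => abs_lt.2 hx
  have hXa : ∀ x ∈ Ioo (-ρ) ρ, x ≠ 0 → a + x ∉ crossingParams γ := fun x hx h0 =>
    hX1 x ((habs hx).trans_le i3) (by simpa using h0)
  have hXb : ∀ x ∈ Ioo (-ρ) ρ, x ≠ 0 → b + x ∉ crossingParams γ := fun x hx h0 =>
    hX2 x ((habs hx).trans_le i4) (by simpa using h0)
  have hpm : ∀ x ∈ Ioo 0 ρ, x ∈ Ioo (-ρ) ρ ∧ -x ∈ Ioo (-ρ) ρ := fun x hx =>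
    ⟨⟨by linarith [hx.1], hx.2⟩, ⟨by linarith [hx.2], by linarith [hx.1]⟩⟩
  refine ⟨ρ, hρ, fun x hx => ⟨?_, ?_, ?_, ?_⟩, fun S hS => ?_⟩
  · rw [sub_eq_add_neg]
    exact hXa _ (hpm x hx).2 (neg_ne_zero.2 hx.1.ne')
  · exact hXa _ (hpm x hx).1 hx.1.ne'
  · rw [sub_eq_add_neg]
    exact hXb _ (hpm x hx).2 (neg_ne_zero.2 hx.1.ne')
  · exact hXb _ (hpm x hx).1 hx.1.ne'
  -- The image of a rectangle that misses `S` is connected, hence lies in one component of the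
  -- complement.
  have hcomp : ∀ I J : Set ℝ, Convex ℝ I → Convex ℝ J → I ⊆ Ioo (-ρ) ρ → J ⊆ Ioo (-ρ) ρ →
      (∀ x ∈ I, ∀ y ∈ J, Φ (x, y) ∉ S) → ∀ x ∈ I, ∀ y ∈ J, ∀ x' ∈ I, ∀ y' ∈ J,
      connectedComponentIn Sᶜ (Φ (x, y)) = connectedComponentIn Sᶜ (Φ (x', y')) := by
    intro I J hI hJ _ _ hIJ x hx y hy x' hx' y' hy'
    refine connectedComponentIn_eq_of_isPreconnected (A := Φ '' (I ×ˢ J))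
      ((hI.prod hJ).isPreconnected.image _ hΦ.continuousOn) ?_ ⟨_, ⟨hx, hy⟩, rfl⟩
      ⟨_, ⟨hx', hy'⟩, rfl⟩
    rintro _ ⟨q, hq, rfl⟩
    exact hIJ q.1 hq.1 q.2 hq.2
  have hoff : ∀ x ∈ Ioo (-ρ) ρ, ∀ y ∈ Ioo (-ρ) ρ, x ≠ 0 → y ≠ 0 → Φ (x, y) ∉ S := by
    intro x hx y hy hx0 hy0 h
    rcases haxis (x, y) ⟨hx, hy⟩ (hS h) with h | h
    · exact hy0 h
    · exact hx0 h
  have sp : Ioo 0 ρ ⊆ Ioo (-ρ) ρ := Ioo_subset_Ioo (by linarith) le_rfl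
  have sn : Ioo (-ρ) 0 ⊆ Ioo (-ρ) ρ := Ioo_subset_Ioo le_rfl hρ.le
  -- sides of the arms
  have hΦd1 : ∀ x : ℝ, HasDerivAt (fun ε => Φ (x, ε)) (c' b) 0 := fun x => by
    have := (P.strictDeriv_add b).hasDerivAt
    exact ((this.sub_const (c a)).const_add (α x))
  have hΦd2 : ∀ y : ℝ, HasDerivAt (fun ε => Φ (ε, y)) (c' a) 0 := fun y =>
    (P.strictDeriv_add a).hasDerivAt.add_const (β y)
  have hneg : ∀ {f : ℝ → ℂ} {d : ℂ}, HasDerivAt f d 0 → HasDerivAt (fun ε => f (-ε)) (-d) 0 := by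
    intro f d h
    have h' : HasDerivAt f d (-0) := by rwa [neg_zero]
    have := h'.scomp (0 : ℝ) (hasDerivAt_neg (0 : ℝ))
    simpa [Function.comp_def] using this
  -- At a positive crossing the left of the strand through `a` is the upper half plane, and the left
  -- of the strand through `b` is the half plane of negative first coordinate.
  have hla : ∀ x ∈ Ioo (-ρ) ρ, x ≠ 0 → ∃ y ∈ Ioo 0 ρ,
      connectedComponentIn Sᶜ (Φ (x, y)) = leftComp c c' S (a + x) := by
    intro x hx hx0
    obtain ⟨y, hy1, hy2⟩ := ((P.eventually_comp_eq_leftComp hS (hXa x hx hx0)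
      (q := fun ε => Φ (x, ε)) (by simp [Φ, α, β, hcab]) (hΦd1 x).hasDerivWithinAt
      (hc3 x ((habs hx).trans_le i5))).and (Ioo_mem_nhdsGT hρ)).exists
    exact ⟨y, hy2, hy1.2⟩
  have hra : ∀ x ∈ Ioo (-ρ) ρ, x ≠ 0 → ∃ y ∈ Ioo (-ρ) 0,
      connectedComponentIn Sᶜ (Φ (x, y)) = rightComp c c' S (a + x) := by
    intro x hx hx0
    obtain ⟨y, hy1, hy2⟩ := ((P.eventually_comp_eq_rightComp hS (hXa x hx hx0)
      (q := fun ε => Φ (x, -ε)) (by simp [Φ, α, β, hcab]) (hneg (hΦd1 x)).hasDerivWithinAt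
      (by rw [cross_neg_right]; exact neg_neg_of_pos (hc3 x ((habs hx).trans_le i5)))).and
      (Ioo_mem_nhdsGT hρ)).exists
    exact ⟨-y, ⟨by linarith [hy2.2], by linarith [hy2.1]⟩, hy1.2⟩
  have hlb : ∀ y ∈ Ioo (-ρ) ρ, y ≠ 0 → ∃ x ∈ Ioo (-ρ) 0,
      connectedComponentIn Sᶜ (Φ (x, y)) = leftComp c c' S (b + y) := by
    intro y hy hy0
    obtain ⟨x, hx1, hx2⟩ := ((P.eventually_comp_eq_leftComp hS (hXb y hy hy0)
      (q := fun ε => Φ (-ε, y)) (by simp [Φ, α, β]) (hneg (hΦd2 y)).hasDerivWithinAt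
      (by
        rw [cross_neg_right, ← cross_swap]
        exact hc4 y ((habs hy).trans_le i6))).and (Ioo_mem_nhdsGT hρ)).exists
    exact ⟨-x, ⟨by linarith [hx2.2], by linarith [hx2.1]⟩, hx1.2⟩
  have hrb : ∀ y ∈ Ioo (-ρ) ρ, y ≠ 0 → ∃ x ∈ Ioo 0 ρ,
      connectedComponentIn Sᶜ (Φ (x, y)) = rightComp c c' S (b + y) := by
    intro y hy hy0
    obtain ⟨x, hx1, hx2⟩ := ((P.eventually_comp_eq_rightComp hS (hXb y hy hy0)
      (q := fun ε => Φ (ε, y)) (by simp [Φ, α, β]) (hΦd2 y).hasDerivWithinAt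
      (by
        rw [cross_swap]
        exact neg_neg_of_pos (hc4 y ((habs hy).trans_le i6)))).and (Ioo_mem_nhdsGT hρ)).exists
    exact ⟨x, hx2, hx1.2⟩
  have cp : Convex ℝ (Ioo 0 ρ) := convex_Ioo _ _
  have cn : Convex ℝ (Ioo (-ρ) 0) := convex_Ioo _ _
  have ca : Convex ℝ (Ioo (-ρ) ρ) := convex_Ioo _ _
  have qpp := hcomp _ _ cp cp sp sp
    (fun x hx y hy => hoff x (sp hx) y (sp hy) hx.1.ne' hy.1.ne')
  have qpn := hcomp _ _ cp cn sp sn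
    (fun x hx y hy => hoff x (sp hx) y (sn hy) hx.1.ne' hy.2.ne)
  have qnp := hcomp _ _ cn cp sn sp
    (fun x hx y hy => hoff x (sn hx) y (sp hy) hx.2.ne hy.1.ne')
  have qnn := hcomp _ _ cn cn sn sn
    (fun x hx y hy => hoff x (sn hx) y (sn hy) hx.2.ne hy.2.ne)
  intro x hx y hy
  have hnx : -x ∈ Ioo (-ρ) 0 := ⟨by linarith [hx.2], by linarith [hx.1]⟩
  have hny : -y ∈ Ioo (-ρ) 0 := ⟨by linarith [hy.2], by linarith [hy.1]⟩
  obtain ⟨y1, hy1, la1⟩ := hla (-x) (sn hnx) hnx.2.ne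
  obtain ⟨y2, hy2, la2⟩ := hla x (sp hx) hx.1.ne'
  obtain ⟨y3, hy3, ra1⟩ := hra (-x) (sn hnx) hnx.2.ne
  obtain ⟨y4, hy4, ra2⟩ := hra x (sp hx) hx.1.ne'
  obtain ⟨x1, hx1, lb1⟩ := hlb (-y) (sn hny) hny.2.ne
  obtain ⟨x2, hx2, lb2⟩ := hlb y (sp hy) hy.1.ne'
  obtain ⟨x3, hx3, rb1⟩ := hrb (-y) (sn hny) hny.2.ne
  obtain ⟨x4, hx4, rb2⟩ := hrb y (sp hy) hy.1.ne'
  rw [sub_eq_add_neg a x, sub_eq_add_neg b y, ← la1, ← la2, ← ra1, ← ra2, ← lb1, ← lb2, ← rb1,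
    ← rb2]
  refine ⟨qnp _ hnx _ hy1 _ hx2 _ hy, qnn _ hnx _ hy3 _ hx1 _ hny, qpp _ hx _ hy2 _ hx4 _ hy,
    qpn _ hx _ hy4 _ hx3 _ hny, fun hz => ?_, fun hz => ?_⟩
  -- When the outgoing arm of `a` and the incoming arm of `b` are not in `S`, the right and the
  -- lower half squares miss `S`. Together they join the three quadrants to the right of the
  -- smoothed strand.
  · have u1 := hcomp _ _ cp ca sp subset_rfl (fun x hx y hy h => by
      rcases haxis (x, y) ⟨sp hx, hy⟩ (hS h) with h0 | h0
      · simp only at h0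
        subst h0
        refine (hz x hx).1 ?_
        simpa [Φ, α, β, hcab] using h
      · exact hx.1.ne' h0)
    have u2 := hcomp _ _ ca cn subset_rfl sn (fun x hx y hy h => by
      rcases haxis (x, y) ⟨hx, sn hy⟩ (hS h) with h0 | h0
      · exact hy.2.ne h0
      · simp only at h0
        subst h0
        refine (hz (-y) ⟨by linarith [hy.2], by linarith [hy.1]⟩).2 ?_
        simpa [Φ, α, β, hcab] using h)
    rw [u2 _ (sn hnx) _ hy3 _ (sp hx) _ hny, u1 _ hx _ (sn hny) _ hx4 _ (sp hy)]
  · have u1 := hcomp _ _ cn ca sn subset_rfl (fun x hx y hy h => by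
      rcases haxis (x, y) ⟨sn hx, hy⟩ (hS h) with h0 | h0
      · simp only at h0
        subst h0
        refine (hz (-x) ⟨by linarith [hx.2], by linarith [hx.1]⟩).1 ?_
        simpa [Φ, α, β, hcab] using h
      · exact hx.2.ne h0)
    have u2 := hcomp _ _ ca cp subset_rfl sp (fun x hx y hy h => by
      rcases haxis (x, y) ⟨hx, sp hy⟩ (hS h) with h0 | h0
      · exact hy.1.ne' h0
      · simp only at h0
        subst h0
        refine (hz y hy).2 ?_
        simpa [Φ, α, β, hcab] using h)
    rw [u1 _ hx1 _ (sn hny) _ hnx _ (sp hy), u2 _ (sn hnx) _ hy _ (sp hx) _ hy2]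

/-! ### The index of the regions of the whole curve -/

open Classical in
/-- The common winding number of the points of a region. -/
noncomputable def index (c : ℝ → ℂ) (K : Set ℂ) : ℝ :=
  if h : K.Nonempty then wind c 1 h.some else 0

theorem index_connectedComponentIn (P : PlaneLoop γ c c') {p : ℂ} (hp : p ∉ range c) :
    index c (connectedComponentIn (range c)ᶜ p) = wind c 1 p := by
  have hmem : p ∈ connectedComponentIn (range c)ᶜ p := mem_connectedComponentIn hp
  have hne : (connectedComponentIn (range c)ᶜ p).Nonempty := ⟨p, hmem⟩
  rw [index, dif_pos hne]
  refine wind_eq_of_isPreconnected zero_le_one P.continuous.continuousOn (by simpa using P.periodic 0)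
    isPreconnected_connectedComponentIn ?_ hne.some_mem hmem
  exact (connectedComponentIn_subset _ _).trans (compl_subset_compl.2 (image_subset_range _ _))

/-- This is the jump of the winding number: off the crossings the point is passed only once per
period, as `wind_left_right` demands. -/
theorem index_left_sub_right (P : PlaneLoop γ c c') {t : ℝ} (ht : t ∉ crossingParams γ) :
    index c (rightComp c c' (range c) t) = index c (leftComp c c' (range c) t) - 1 := by
  obtain ⟨w, hw⟩ := wind_left_right P.deriv P.periodic (P.regular t) (P.periodic_deriv t)
    (fun s hs h => by
      obtain ⟨n, hn⟩ := coe_unitAddCircle_eq_iff.1 (P.coe_eq_of_eq ht h.symm)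
      have h1 : (n : ℝ) = -s := by linarith
      have h2 : (-1 : ℝ) < n := by rw [h1]; linarith [hs.2]
      have h3 : (n : ℝ) < 0 := by rw [h1]; linarith [hs.1]
      norm_cast at h2 h3
      omega)
  have hAB := cross_self_I_mul (P.regular t)
  have hneg : cross (c' t) (-(Complex.I * c' t)) < 0 := by
    rw [cross_neg_right]
    exact neg_neg_of_pos hAB
  obtain ⟨ε1, h1, h2, h3⟩ := (((hw _).1 hAB).and (P.eventually_comp_eq_leftComp subset_rfl ht
    (q := fun ε => c t + ε * (Complex.I * c' t)) (by simp)
    (hasDerivWithinAt_add_mul _ _ _ _) hAB)).exists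
  obtain ⟨ε2, h4, h5, h6⟩ := (((hw _).2 hneg).and (P.eventually_comp_eq_rightComp subset_rfl ht
    (q := fun ε => c t + ε * -(Complex.I * c' t)) (by simp)
    (hasDerivWithinAt_add_mul _ _ _ _) hneg)).exists
  rw [← h3, ← h6, P.index_connectedComponentIn h2, P.index_connectedComponentIn h5, h1 h2, h4 h5]

/-- The winding number of the curve about the points to the left of the parameter `t`. -/
noncomputable def leftIndex (c c' : ℝ → ℂ) (t : ℝ) : ℝ := index c (leftComp c c' (range c) t)

/-- At a crossing, the left index is preserved by smoothing and distinguishes the two strands;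
the sides of a strand are connected off sets that do not contain the other strand. -/
theorem exists_smoothing (P : PlaneLoop γ c c') {a b : ℝ} (hab : IsCrossing γ a b) :
    ∃ ρ > 0, (∀ x ∈ Ioo 0 ρ, a - x ∉ crossingParams γ ∧ a + x ∉ crossingParams γ ∧
        b - x ∉ crossingParams γ ∧ b + x ∉ crossingParams γ) ∧
      (∀ x ∈ Ioo 0 ρ, ∀ y ∈ Ioo 0 ρ, leftIndex c c' (a - x) = leftIndex c c' (b + y) ∧
        leftIndex c c' (b - x) = leftIndex c c' (a + y) ∧
        leftIndex c c' (a - x) ≠ leftIndex c c' (b - y)) ∧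
      ∀ S ⊆ range c, (∀ z ∈ Ioo 0 ρ, c (a + z) ∉ S ∧ c (b - z) ∉ S) →
        ∀ x ∈ Ioo 0 ρ, ∀ y ∈ Ioo 0 ρ, leftComp c c' S (a - x) = leftComp c c' S (b + y) ∧
          rightComp c c' S (a - x) = rightComp c c' S (b + y) := by
  -- A negative crossing becomes positive when the two strands exchange their names.
  rcases (P.transverse a b hab).lt_or_gt with h | h
  · rw [cross_swap, neg_lt_zero] at h
    obtain ⟨ρ, hρ, hX, hS⟩ := P.exists_sectors (isCrossing_symm hab) h
    refine ⟨ρ, hρ, fun x hx => ?_, fun x hx y hy => ?_, fun S hSc hz x hx y hy => ?_⟩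
    · obtain ⟨h1, h2, h3, h4⟩ := hX x hx
      exact ⟨h3, h4, h1, h2⟩
    · obtain ⟨-, -, e3, -⟩ := hS _ subset_rfl y hy x hx
      obtain ⟨f1, -, -⟩ := hS _ subset_rfl x hx y hy
      obtain ⟨-, e2, -⟩ := hS _ subset_rfl y hy x hx
      obtain ⟨-, -, g3, -⟩ := hS _ subset_rfl y hy x hx
      have r1 := P.index_left_sub_right (hX y hy).1
      have r2 := P.index_left_sub_right (hX x hx).2.2.2
      obtain ⟨k1, -, k3, -⟩ := hS _ subset_rfl y hy y hy
      have r3 := P.index_left_sub_right (hX y hy).2.2.2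
      unfold leftIndex
      rw [e2] at r1
      rw [k1] at r1
      rw [← k3] at r3
      refine ⟨?_, ?_, ?_⟩
      · linarith
      · rw [f1]
      · rw [k1]
        intro h0
        linarith
    · obtain ⟨-, -, -, e4, -, e6⟩ := hS S hSc y hy x hx
      exact ⟨e6 fun z hz' => ⟨(hz z hz').2, (hz z hz').1⟩, e4.symm⟩
  · obtain ⟨ρ, hρ, hX, hS⟩ := P.exists_sectors hab h
    refine ⟨ρ, hρ, hX, fun x hx y hy => ?_, fun S hSc hz x hx y hy => ?_⟩
    -- Let i be the index of the sector to the left of both `a - x` and `b + y`. Crossing either of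
    -- these arms to the right lowers it by one, and this reaches the sectors left of `b - y` and
    -- left of `a + x`; there the index is i - 1.
    · obtain ⟨e1, e2, -⟩ := hS _ subset_rfl x hx y hy
      obtain ⟨f1, f2, -⟩ := hS _ subset_rfl x hx x hx
      obtain ⟨-, -, g3, -⟩ := hS _ subset_rfl y hy x hx
      have r1 := P.index_left_sub_right (hX x hx).1
      have r2 := P.index_left_sub_right (hX x hx).2.2.2
      unfold leftIndex
      rw [f2] at r1
      rw [← g3, ← f1] at r2
      have r3 := P.index_left_sub_right (hX x hx).1
      rw [e2] at r3
      refine ⟨by rw [e1], by linarith, fun h0 => by linarith⟩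
    · obtain ⟨e1, -, -, -, e5, -⟩ := hS S hSc x hx y hy
      exact ⟨e1, e5 hz⟩

end PlaneLoop
end SpiralIndex

/-! ### Moves along a Seifert circle and the two regions beside it. -/

namespace SpiralIndex

/-- The exterior of a disc is the image of a half plane under the exponential map. -/
theorem isPreconnected_norm_gt {R : ℝ} (hR : 0 < R) : IsPreconnected {p : ℂ | R < ‖p‖} := by
  have e : {p : ℂ | R < ‖p‖} = Complex.exp '' {w | Real.log R < w.re} := by
    ext p
    constructor
    · intro hp
      have hp' : R < ‖p‖ := hp
      refine ⟨Complex.log p, ?_, Complex.exp_log (norm_pos_iff.1 (hR.trans hp'))⟩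
      simp only [mem_ofPred_eq, Complex.log_re]
      exact Real.log_lt_log hR hp'
    · rintro ⟨w, hw, rfl⟩
      simp only [mem_ofPred_eq, Complex.norm_exp] at hw ⊢
      exact (Real.log_lt_iff_lt_exp hR).1 hw
  rw [e]
  exact (convex_halfSpace_re_gt _).isPreconnected.image _ Complex.continuous_exp.continuousOn

namespace PlaneLoop

variable {γ : ℝ → Plane} {c c' : ℝ → ℂ}

theorem notMem_of_seifertStep (P : PlaneLoop γ c c') {s t : ℝ} (h : SeifertStep γ s t) :
    s ∉ crossingParams γ ∧ t ∉ crossingParams γ := by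
  cases h with
  | period ht =>
    refine ⟨ht, ?_⟩
    have := (P.mem_crossingParams_add_intCast s 1).not.2 ht
    rwa [Int.cast_one] at this
  | along _ hst h =>
    exact ⟨disjoint_left.1 h ⟨le_rfl, hst⟩, disjoint_left.1 h ⟨hst, le_rfl⟩⟩
  | switch a b _ hs hsa hab ht hbt =>
    exact ⟨disjoint_left.1 hsa ⟨le_rfl, hs⟩, disjoint_left.1 hbt ⟨ht, le_rfl⟩⟩

/-- This is the invariant that labels a Seifert circle: regions are unchanged along an arc, and
smoothing respects their Alexander numbering. -/
theorem leftIndex_eq_of_step (P : PlaneLoop γ c c') {s t : ℝ} (h : SeifertStep γ s t) :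
    leftIndex c c' s = leftIndex c c' t := by
  cases h with
  | period ht =>
    rw [leftIndex, leftIndex, (P.sides_congr (range c) (s := s + 1) (t := s)
      (by simp)).1]
  | along _ hst h =>
    rw [leftIndex, leftIndex, (P.sides_eq_of_disjoint subset_rfl isPreconnected_Icc h
      (left_mem_Icc.2 hst) (right_mem_Icc.2 hst)).1]
  | switch a b _ hs hsa hab ht hbt =>
    obtain ⟨ρ, hρ, -, h2, -⟩ := P.exists_smoothing hab
    -- Small enough for `a - x` and `b + x` to lie both on the given arcs and in the neighbourhood
    -- where smoothing is understood.
    set x := min (ρ / 2) (min (a - s) (t - b)) with hx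
    have hx0 : 0 < x := lt_min (by linarith) (lt_min (by linarith) (by linarith))
    have hxρ : x < ρ := (min_le_left _ _).trans_lt (by linarith)
    have hxs : x ≤ a - s := (min_le_right _ _).trans (min_le_left _ _)
    have hxt : x ≤ t - b := (min_le_right _ _).trans (min_le_right _ _)
    have e1 := (P.sides_eq_of_disjoint (S := range c) subset_rfl isPreconnected_Ico hsa
      (show s ∈ Ico s a from ⟨le_rfl, hs⟩)
      (show a - x ∈ Ico s a from ⟨by linarith, by linarith⟩)).1
    have e2 := (P.sides_eq_of_disjoint (S := range c) subset_rfl isPreconnected_Ioc hbt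
      (show t ∈ Ioc b t from ⟨ht, le_rfl⟩)
      (show b + x ∈ Ioc b t from ⟨by linarith, by linarith⟩)).1
    have e3 := (h2 x ⟨hx0, hxρ⟩ x ⟨hx0, hxρ⟩).1
    rw [leftIndex, leftIndex, e1, e2]
    exact e3

theorem leftIndex_eq_of_eqvGen (P : PlaneLoop γ c c') {s t : ℝ}
    (h : Relation.EqvGen (SeifertStep γ) s t) : leftIndex c c' s = leftIndex c c' t := by
  induction h with
  | rel _ _ h => exact P.leftIndex_eq_of_step h
  | refl => rfl
  | symm _ _ _ ih => exact ih.symm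
  | trans _ _ _ _ _ ih1 ih2 => exact ih1.trans ih2

theorem eqvGen_add_intCast (P : PlaneLoop γ c c') {t : ℝ} (ht : t ∉ crossingParams γ) (n : ℤ) :
    Relation.EqvGen (SeifertStep γ) t (t + n) := by
  induction n using Int.induction_on with
  | zero =>
    rw [Int.cast_zero, add_zero]
    exact .refl _
  | succ n ih =>
    refine ih.trans _ _ _ (.rel _ _ ?_)
    have := SeifertStep.period (γ := γ) (t + n)
      ((P.mem_crossingParams_add_intCast t n).not.2 ht)
    convert! this using 1
    push_cast
    ring
  | pred n ih =>
    refine ih.trans _ _ _ (.symm _ _ (.rel _ _ ?_))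
    have := SeifertStep.period (γ := γ) (t + (-n - 1 : ℤ))
      ((P.mem_crossingParams_add_intCast t _).not.2 ht)
    convert! this using 1
    push_cast
    ring

theorem eqvGen_of_coe_eq (P : PlaneLoop γ c c') {s t : ℝ} (hs : s ∉ crossingParams γ)
    (h : (s : UnitAddCircle) = (t : UnitAddCircle)) : Relation.EqvGen (SeifertStep γ) s t := by
  obtain ⟨n, rfl⟩ := coe_unitAddCircle_eq_iff.1 h.symm
  exact P.eqvGen_add_intCast hs n

theorem eqvGen_of_disjoint {J : Set ℝ} (hJ : J.OrdConnected)
    (hd : Disjoint J (crossingParams γ)) {s t : ℝ} (hs : s ∈ J) (ht : t ∈ J) :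
    Relation.EqvGen (SeifertStep γ) s t := by
  rcases le_total s t with h | h
  · exact .rel _ _ (.along s t h (hd.mono_left (hJ.out hs ht)))
  · exact .symm _ _ (.rel _ _ (.along t s h (hd.mono_left (hJ.out ht hs))))

/-! ### One Seifert circle -/

theorem mem_iff_of_eqvGen {C : Set ℝ} (hC : C ∈ seifertCircles γ) {s t : ℝ}
    (hs : s ∈ C) (ht : t ∉ crossingParams γ) : t ∈ C ↔ Relation.EqvGen (SeifertStep γ) s t := by
  obtain ⟨t0, ht0, rfl⟩ := hC
  exact ⟨fun h => (hs.2.symm _ _).trans _ _ _ h.2, fun h => ⟨ht, hs.2.trans _ _ _ h⟩⟩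

theorem notMem_of_mem_circle {C : Set ℝ} (hC : C ∈ seifertCircles γ) {s : ℝ} (hs : s ∈ C) :
    s ∉ crossingParams γ := by
  obtain ⟨t0, ht0, rfl⟩ := hC
  exact hs.1

theorem circle_nonempty {C : Set ℝ} (hC : C ∈ seifertCircles γ) : C.Nonempty := by
  obtain ⟨t0, ht0, rfl⟩ := hC
  exact ⟨t0, ht0, .refl _⟩

theorem mem_circle_congr (P : PlaneLoop γ c c') {C : Set ℝ} (hC : C ∈ seifertCircles γ) {s t : ℝ}
    (h : (s : UnitAddCircle) = (t : UnitAddCircle)) (hs : s ∈ C) : t ∈ C := by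
  have hsX := notMem_of_mem_circle hC hs
  exact (mem_iff_of_eqvGen hC hs ((P.mem_crossingParams_congr h).not.1 hsX)).2
    (P.eqvGen_of_coe_eq hsX h)

theorem subset_circle_of_disjoint {C : Set ℝ} (hC : C ∈ seifertCircles γ) {J : Set ℝ}
    (hJ : J.OrdConnected) (hd : Disjoint J (crossingParams γ)) {s : ℝ} (hs : s ∈ J)
    (hsC : s ∈ C) : J ⊆ C := fun _ ht =>
  (mem_iff_of_eqvGen hC hsC (disjoint_left.1 hd ht)).2 (eqvGen_of_disjoint hJ hd hs ht)

theorem exists_ball_disjoint (P : PlaneLoop γ c c') {t : ℝ} (ht : t ∉ crossingParams γ) :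
    ∃ r > 0, r < 1 / 2 ∧ Disjoint (Ioo (t - r) (t + r)) (crossingParams γ) := by
  obtain ⟨r, hr, hb⟩ := Metric.eventually_nhds_iff_ball.1 (P.eventually_notMem_nhds ht)
  refine ⟨min r (1 / 4), by positivity, (min_le_right _ _).trans_lt (by norm_num),
    disjoint_left.2 fun x hx => hb x ?_⟩
  have := min_le_left r (1 / 4)
  rw [Metric.mem_ball, Real.dist_eq, abs_lt]
  constructor <;> linarith [hx.1, hx.2]

/-- A parameter off the crossings has a neighbourhood inside one side, so taking the closure of a
circle adds crossing parameters only. -/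
theorem mem_of_mem_closure (P : PlaneLoop γ c c') {C : Set ℝ} (hC : C ∈ seifertCircles γ) {t : ℝ}
    (ht : t ∈ closure C) (htX : t ∉ crossingParams γ) : t ∈ C := by
  obtain ⟨r, hr, -, hd⟩ := P.exists_ball_disjoint htX
  obtain ⟨s, hs1, hs2⟩ := mem_closure_iff_nhds.1 ht _
    (Ioo_mem_nhds (show t - r < t by linarith) (show t < t + r by linarith))
  exact subset_circle_of_disjoint hC ordConnected_Ioo hd hs1 hs2 ⟨by linarith, by linarith⟩

/-- A point of the trace of a Seifert circle away from the crossings has its parameters on the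
circle. -/
theorem mem_of_mem_trace (P : PlaneLoop γ c c') {C : Set ℝ} (hC : C ∈ seifertCircles γ) {t : ℝ}
    (htX : t ∉ crossingParams γ) (ht : c t ∈ c '' closure C) : t ∈ C := by
  obtain ⟨s, hs, hst⟩ := ht
  have h := P.coe_eq_of_eq htX hst.symm
  have hsX := (P.mem_crossingParams_congr h).not.1 htX
  exact P.mem_circle_congr hC h.symm (P.mem_of_mem_closure hC hs hsX)

theorem closure_circle_periodic (P : PlaneLoop γ c c') {C : Set ℝ} (hC : C ∈ seifertCircles γ)
    (n : ℤ) {s : ℝ} (hs : s ∈ closure C) : s + n ∈ closure C := by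
  refine map_mem_closure (f := fun s : ℝ => s + (n : ℝ)) (by fun_prop) hs fun t ht => ?_
  exact P.mem_circle_congr hC (coe_add_intCast t n).symm ht

theorem isCompact_trace (P : PlaneLoop γ c c') {C : Set ℝ} (hC : C ∈ seifertCircles γ) :
    IsCompact (c '' closure C) := by
  have e : c '' closure C = c '' (closure C ∩ Icc 0 1) := by
    refine subset_antisymm ?_ (image_mono inter_subset_left)
    rintro _ ⟨s, hs, rfl⟩
    refine ⟨Int.fract s, ⟨?_, Int.fract_nonneg s, (Int.fract_lt_one s).le⟩,
      P.eq_of_coe_eq (by simp)⟩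
    have := P.closure_circle_periodic hC (-⌊s⌋) hs
    rwa [Int.cast_neg, ← sub_eq_add_neg, Int.self_sub_floor] at this
  rw [e]
  exact (isCompact_Icc.inter_left isClosed_closure).image P.continuous

/-- At a switch the circle does not use the other two arms of the crossing, since their left index
is different. Off its trace the regions on both sides therefore continue around the smoothed corner.
-/
theorem sides_eq_of_step (P : PlaneLoop γ c c') {C : Set ℝ} (hC : C ∈ seifertCircles γ) {s t : ℝ}
    (h : SeifertStep γ s t) (hs : s ∈ C) :
    leftComp c c' (c '' closure C) s = leftComp c c' (c '' closure C) t ∧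
      rightComp c c' (c '' closure C) s = rightComp c c' (c '' closure C) t := by
  have hS : c '' closure C ⊆ range c := image_subset_range _ _
  cases h with
  | period ht =>
    exact P.sides_congr _ (by simp)
  | along _ hst h =>
    exact P.sides_eq_of_disjoint hS isPreconnected_Icc h
      (left_mem_Icc.2 hst) (right_mem_Icc.2 hst)
  | switch a b _ hs' hsa hab ht hbt =>
    obtain ⟨ρ, hρ, h1, h2, h3⟩ := P.exists_smoothing hab
    set x := min (ρ / 2) (min (a - s) (t - b)) with hx
    have hx0 : 0 < x := lt_min (by linarith) (lt_min (by linarith) (by linarith))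
    have hxρ : x < ρ := (min_le_left _ _).trans_lt (by linarith)
    have hxs : x ≤ a - s := (min_le_right _ _).trans (min_le_left _ _)
    have hxt : x ≤ t - b := (min_le_right _ _).trans (min_le_right _ _)
    have m1 : a - x ∈ Ico s a := ⟨by linarith, by linarith⟩
    have e1 := P.sides_eq_of_disjoint hS isPreconnected_Ico hsa
      (show s ∈ Ico s a from ⟨le_rfl, hs'⟩) m1
    have e2 := P.sides_eq_of_disjoint hS isPreconnected_Ioc hbt
      (show t ∈ Ioc b t from ⟨ht, le_rfl⟩)
      (show b + x ∈ Ioc b t from ⟨by linarith, by linarith⟩)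
    have hax : a - x ∈ C :=
      subset_circle_of_disjoint hC ordConnected_Ico hsa ⟨le_rfl, hs'⟩ hs m1
    -- If one of the unused arms met the trace, it would lie on `C` and have the left index of `a -
    -- x`, against the inequality between the two incoming strands.
    have e3 := h3 _ hS (fun z hz => by
      obtain ⟨-, z2, z3, -⟩ := h1 z hz
      obtain ⟨-, k2, k3⟩ := h2 x ⟨hx0, hxρ⟩ z hz
      constructor
      · intro hcon
        have hmem := P.mem_of_mem_trace hC z2 hcon
        have := P.leftIndex_eq_of_eqvGen ((mem_iff_of_eqvGen hC hax z2).1 hmem)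
        obtain ⟨-, k2', -⟩ := h2 z hz z hz
        rw [← k2'] at this
        exact k3 this
      · intro hcon
        have hmem := P.mem_of_mem_trace hC z3 hcon
        exact k3 (P.leftIndex_eq_of_eqvGen ((mem_iff_of_eqvGen hC hax z3).1 hmem)))
      x ⟨hx0, hxρ⟩ x ⟨hx0, hxρ⟩
    rw [e1.1, e1.2, e2.1, e2.2]
    exact e3

/-- The sides of a Seifert circle are the same all along the circle. -/
theorem sides_eq (P : PlaneLoop γ c c') {C : Set ℝ} (hC : C ∈ seifertCircles γ) {s t : ℝ}
    (hs : s ∈ C) (ht : t ∈ C) :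
    leftComp c c' (c '' closure C) s = leftComp c c' (c '' closure C) t ∧
      rightComp c c' (c '' closure C) s = rightComp c c' (c '' closure C) t := by
  -- Membership in `C` is carried through the induction, because the sides are compared only on `C`
  -- and the symmetric case needs it at the other end.
  have key : ∀ x y : ℝ, Relation.EqvGen (SeifertStep γ) x y → (x ∈ C ↔ y ∈ C) ∧ (x ∈ C →
      leftComp c c' (c '' closure C) x = leftComp c c' (c '' closure C) y ∧
      rightComp c c' (c '' closure C) x = rightComp c c' (c '' closure C) y) := by
    intro x y h
    induction h with
    | rel x y h =>
      have hX := P.notMem_of_seifertStep h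
      refine ⟨⟨fun hx => (mem_iff_of_eqvGen hC hx hX.2).2 (.rel _ _ h),
        fun hy => (mem_iff_of_eqvGen hC hy hX.1).2 (.symm _ _ (.rel _ _ h))⟩,
        fun hx => P.sides_eq_of_step hC h hx⟩
    | refl => exact ⟨Iff.rfl, fun _ => ⟨rfl, rfl⟩⟩
    | symm x y _ ih =>
      exact ⟨ih.1.symm, fun hy => ⟨(ih.2 (ih.1.2 hy)).1.symm, (ih.2 (ih.1.2 hy)).2.symm⟩⟩
    | trans x y z _ _ ih1 ih2 =>
      refine ⟨ih1.1.trans ih2.1, fun hx => ?_⟩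
      have a := ih1.2 hx
      have b := ih2.2 (ih1.1.1 hx)
      exact ⟨a.1.trans b.1, a.2.trans b.2⟩
  exact (key s t ((mem_iff_of_eqvGen hC hs (notMem_of_mem_circle hC ht)).1 ht)).2 hs

theorem exists_norm_le (P : PlaneLoop γ c c') : ∃ R > 0, ∀ t, ‖c t‖ ≤ R := by
  obtain ⟨R, hR⟩ := (isCompact_Icc (a := (0 : ℝ)) (b := 1)).exists_bound_of_continuousOn
    P.continuous.continuousOn
  refine ⟨max R 1, by positivity, fun t => ?_⟩
  have h1 := hR (Int.fract t) ⟨Int.fract_nonneg t, (Int.fract_lt_one t).le⟩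
  rw [P.eq_of_coe_eq (show ((Int.fract t : ℝ) : UnitAddCircle) = t by simp)] at h1
  exact h1.trans (le_max_left _ _)

/-- The unbounded region outside of a Seifert circle adjoins the circle at one of its sides. -/
theorem exists_unbounded_side (P : PlaneLoop γ c c') {C : Set ℝ} (hC : C ∈ seifertCircles γ)
    {R : ℝ} (hcR : ∀ t, ‖c t‖ ≤ R) {q : ℂ} (hq : R < ‖q‖) :
    ∃ t ∈ C, leftComp c c' (c '' closure C) t = connectedComponentIn (c '' closure C)ᶜ q ∨
      rightComp c c' (c '' closure C) t = connectedComponentIn (c '' closure C)ᶜ q := by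
  set S := c '' closure C with hSdef
  have hS : S ⊆ range c := image_subset_range _ _
  have hScl : IsClosed S := (P.isCompact_trace hC).isClosed
  set U := connectedComponentIn Sᶜ q with hU
  have hqS : q ∉ S := by
    intro h
    obtain ⟨t, ht⟩ := hS h
    have := hcR t
    rw [ht] at this
    linarith
  have hqU : q ∈ U := mem_connectedComponentIn hqS
  have hUo : IsOpen U := hScl.isOpen_compl.connectedComponentIn
  have hUS : U ⊆ Sᶜ := connectedComponentIn_subset _ _
  -- Components of an open set are open, so a frontier point off `S` would have a component of its
  -- own that meets `U`, hence equals it.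
  have hfrS : frontier U ⊆ S := by
    intro y hy
    by_contra hyS
    have hyo : IsOpen (connectedComponentIn Sᶜ y) := hScl.isOpen_compl.connectedComponentIn
    obtain ⟨z, hz1, hz2⟩ := mem_closure_iff_nhds.1 hy.1 _
      (hyo.mem_nhds (mem_connectedComponentIn hyS))
    have e : U = connectedComponentIn Sᶜ y := by
      rw [hU, connectedComponentIn_eq hz2, connectedComponentIn_eq hz1]
    refine hy.2 ?_
    rw [hUo.interior_eq, e]
    exact mem_connectedComponentIn hyS
  have hXfin : (c '' crossingParams γ).Finite := by
    refine ((P.finite_crossingParams_inter 0).image c).subset ?_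
    rintro _ ⟨s, hs, rfl⟩
    have e : ((Int.fract s : ℝ) : UnitAddCircle) = s := by simp
    exact ⟨Int.fract s, ⟨(P.mem_crossingParams_congr e).2 hs, Int.fract_nonneg s,
      by simpa using Int.fract_lt_one s⟩, P.eq_of_coe_eq e⟩
  obtain ⟨t0, ht0⟩ := circle_nonempty hC
  -- Otherwise the frontier is finite and its complement connected, so `U` is dense and `S` is
  -- contained in the frontier. But `S` contains a whole arc and is infinite.
  obtain ⟨y, hy, hyX⟩ : ∃ y ∈ frontier U, y ∉ c '' crossingParams γ := by
    by_contra! hcon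
    have hfin : (frontier U).Finite := hXfin.subset hcon
    have hconn := (hfin.countable.isConnected_compl_of_one_lt_rank
      (by simp : 1 < Module.rank ℝ ℂ)).isPreconnected
    have hcover : (frontier U)ᶜ ⊆ U ∪ (closure U)ᶜ := by
      intro z hz
      by_cases h : z ∈ closure U
      · left
        by_contra hzU
        exact hz ⟨h, by rwa [hUo.interior_eq]⟩
      · exact Or.inr h
    have hqfr : q ∈ (frontier U)ᶜ := fun h => hqS (hfrS h)
    have hcl : ∀ z, z ∈ closure U := by
      intro z
      by_contra hz
      obtain ⟨w, -, hw1, hw2⟩ := hconn U (closure U)ᶜ hUo isClosed_closure.isOpen_compl hcover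
        ⟨q, hqfr, hqU⟩ ⟨z, fun h => hz h.1, hz⟩
      exact hw2 (subset_closure hw1)
    have hSfin : S.Finite := hfin.subset fun z hz =>
      ⟨hcl z, fun h => hUS (interior_subset h) hz⟩
    obtain ⟨r, hr, hr2, hd⟩ := P.exists_ball_disjoint (notMem_of_mem_circle hC ht0)
    refine (Set.infinite_of_injOn_mapsTo (f := c) (s := Ioo (t0 - r) (t0 + r)) (t := S) ?_ ?_
      (Ioo_infinite (by linarith))) hSfin
    · intro x hx z hz hxz
      have := P.coe_eq_of_eq (disjoint_left.1 hd hx) hxz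
      exact (AddCircle.coe_eq_coe_iff_of_mem_Ico (a := t0 - r) ⟨hx.1.le, by linarith [hx.2]⟩
        ⟨hz.1.le, by linarith [hz.2]⟩).1 this
    · intro x hx
      exact ⟨x, subset_closure (subset_circle_of_disjoint hC ordConnected_Ioo hd
        ⟨by linarith, by linarith⟩ ht0 hx), rfl⟩
  obtain ⟨t1, ht1, rfl⟩ := hfrS hy
  have ht1X : t1 ∉ crossingParams γ := fun h => hyX ⟨t1, h, rfl⟩
  have ht1C := P.mem_of_mem_closure hC ht1 ht1X
  obtain ⟨r, hr, -, hd⟩ := P.exists_ball_disjoint ht1X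
  -- Points of `U` arbitrarily near `c t1` are not on the arc, so they lie in one of the two regions
  -- beside it.
  obtain ⟨p, hp1, hp2⟩ := mem_closure_iff_nhds.1 hy.1 _ (P.eventually_mem_sides hS ht1X hr)
  have hpU : connectedComponentIn Sᶜ p = U := (connectedComponentIn_eq hp2).symm
  refine ⟨t1, ht1C, ?_⟩
  rcases hp1 with h | h | h
  · obtain ⟨s, hs, rfl⟩ := h
    exact absurd ⟨s, subset_closure (subset_circle_of_disjoint hC ordConnected_Ioo hd
      ⟨by linarith, by linarith⟩ ht1C hs), rfl⟩ (hUS hp2)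
  · exact Or.inl (by rw [← h, hpU])
  · exact Or.inr (by rw [← h, hpU])

/-- The dichotomy for a Seifert circle: one side is unbounded and the other one is bounded, and
the total turning tells which is which. -/
theorem circle_dichotomy (P : PlaneLoop γ c c') {C : Set ℝ} (hC : C ∈ seifertCircles γ)
    {N : ℕ} {g : ℝ → ℂ} {h : ℕ → ℝ → ℂ} {G : ℕ → ℝ × ℝ → ℂ} (H : PiecewiseLoop N g h G)
    {θ : ℕ → ℝ → ℝ} (hθ : ∀ k ≤ N, AngleLift (fun u => G k (u, u)) (θ k) (Icc 0 1))
    (hgS : g '' Icc 0 (N + 1) ⊆ c '' closure C) {t₀ : ℝ} (ht₀ : t₀ ∈ C) (hg0 : g 0 = c t₀)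
    {r : ℝ} (hr : 0 < r) (hG0 : G 0 (0, 0) = r * c' t₀) {τ : ℝ}
    (hτ : ∑ k ∈ Finset.range (N + 1), (θ k 1 - θ k 0) +
      ∑ k ∈ Finset.range N, (G (k + 1) (0, 0) / G k (1, 1)).arg = τ * (2 * Real.pi)) :
    (τ = 1 ∧ ∀ t ∈ C, Bornology.IsBounded (leftComp c c' (c '' closure C) t) ∧
      ¬ Bornology.IsBounded (rightComp c c' (c '' closure C) t)) ∨
    (τ = -1 ∧ ∀ t ∈ C, ¬ Bornology.IsBounded (leftComp c c' (c '' closure C) t) ∧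
      Bornology.IsBounded (rightComp c c' (c '' closure C) t)) := by
  set S := c '' closure C with hSdef
  have hS : S ⊆ range c := image_subset_range _ _
  obtain ⟨R, hR, hcR⟩ := P.exists_norm_le
  have hSR : ∀ p : ℂ, R < ‖p‖ → p ∈ Sᶜ := by
    intro p hp h
    obtain ⟨t, rfl⟩ := hS h
    exact absurd (hcR t) (not_le.2 hp)
  set q : ℂ := ((R + 1 : ℝ) : ℂ) with hqdef
  have hq : R < ‖q‖ := by
    rw [hqdef, Complex.norm_real, Real.norm_eq_abs, abs_of_pos (by linarith)]
    linarith
  set U := connectedComponentIn Sᶜ q with hU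
  have hfar : ∀ p : ℂ, R < ‖p‖ → p ∈ U := fun p hp =>
    (isPreconnected_norm_gt hR).subset_connectedComponentIn (show q ∈ _ from hq)
      (fun z hz => hSR z hz) hp
  have hUunb : ¬ Bornology.IsBounded U := by
    intro hb
    obtain ⟨M, hM⟩ := hb.exists_norm_le
    have hpos : 0 ≤ M := (norm_nonneg _).trans (hM q (hfar q hq))
    have h1 : ‖((R + M + 1 : ℝ) : ℂ)‖ = R + M + 1 := by
      rw [Complex.norm_real, Real.norm_eq_abs, abs_of_pos (by linarith)]
    have := hM _ (hfar ((R + M + 1 : ℝ) : ℂ) (by rw [h1]; linarith))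
    rw [h1] at this
    linarith
  have hbdd : ∀ p : ℂ, connectedComponentIn Sᶜ p ≠ U →
      Bornology.IsBounded (connectedComponentIn Sᶜ p) := by
    intro p hp
    rw [isBounded_iff_forall_norm_le]
    refine ⟨R, fun z hz => ?_⟩
    by_contra hcon
    exact hp ((connectedComponentIn_eq hz).trans
      (connectedComponentIn_eq (hfar z (not_le.1 hcon))).symm)
  have hwind : ∀ p ∈ U, wind g (N + 1) p = 0 := by
    intro p hp
    have hN : (0 : ℝ) ≤ N + 1 := by positivity
    have h1 : wind g (N + 1) p = wind g (N + 1) q :=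
      wind_eq_of_isPreconnected hN H.continuousOn H.closed
        isPreconnected_connectedComponentIn
        ((connectedComponentIn_subset _ _).trans (compl_subset_compl.2 hgS)) hp (hfar q hq)
    rw [h1]
    refine wind_eq_zero_of_norm_lt hN H.continuousOn H.closed (fun t ht => ?_) hq
    obtain ⟨s, hs⟩ := hS (hgS ⟨t, ht, rfl⟩)
    rw [← hs]
    exact hcR s
  have ht₀X := notMem_of_mem_circle hC ht₀
  have hAB := cross_self_I_mul (P.regular t₀)
  have hneg : cross (c' t₀) (-(Complex.I * c' t₀)) < 0 := by
    rw [cross_neg_right]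
    exact neg_neg_of_pos hAB
  have hGpos : ∀ u, cross (G 0 (0, 0)) u = r * cross (c' t₀) u := by
    intro u
    rw [hG0]
    simp only [cross, Complex.re_ofReal_mul, Complex.im_ofReal_mul]
    ring
  have hpi : (2 * Real.pi) ≠ 0 := by positivity
  obtain ⟨ε1, ⟨h11, h12⟩, h13⟩ := (((H.turning_eq_wind hθ _).1
    (by rw [hGpos]; exact mul_pos hr hAB)).and (P.eventually_comp_eq_leftComp hS ht₀X
    (q := fun ε => c t₀ + ε * (Complex.I * c' t₀)) (by simp)
    (hasDerivWithinAt_add_mul _ _ _ _) hAB)).exists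
  obtain ⟨ε2, ⟨h21, h22⟩, h23⟩ := (((H.turning_eq_wind hθ _).2
    (by rw [hGpos]; exact mul_neg_of_pos_of_neg hr hneg)).and (P.eventually_comp_eq_rightComp hS
    ht₀X (q := fun ε => c t₀ + ε * -(Complex.I * c' t₀)) (by simp)
    (hasDerivWithinAt_add_mul _ _ _ _) hneg)).exists
  rw [hτ] at h12 h22
  -- The turning is 2l - 1 and 2r + 1 in terms of the winding numbers on the left and right. The
  -- unbounded side has winding number 0; if the other side were unbounded too, the two values would
  -- be -1 and 1.
  have k1 := mul_right_cancel₀ hpi h12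
  have k2 := mul_right_cancel₀ hpi h22
  rw [hg0] at k1 k2
  have hpS : ∀ z, z ∉ range c → z ∈ Sᶜ := fun z hz h => hz (hS h)
  have hmem1 := mem_connectedComponentIn (hpS _ h13.1)
  have hmem2 := mem_connectedComponentIn (hpS _ h23.1)
  obtain ⟨t1, ht1, hside⟩ := P.exists_unbounded_side hC hcR hq
  rcases hside with hside | hside
  · right
    have hl : leftComp c c' S t₀ = U := (P.sides_eq hC ht₀ ht1).1.trans hside
    have hw := hwind _ (by rw [← hl, ← h13.2]; exact hmem1)
    rw [hw] at k1
    have hτ1 : τ = -1 := by linarith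
    refine ⟨hτ1, fun t ht => ?_⟩
    rw [(P.sides_eq hC ht ht₀).1, (P.sides_eq hC ht ht₀).2, hl]
    refine ⟨hUunb, ?_⟩
    rw [← h23.2]
    refine hbdd _ fun hcon => ?_
    rw [hwind _ (by rw [← hcon]; exact hmem2)] at k2
    linarith
  · left
    have hl : rightComp c c' S t₀ = U := (P.sides_eq hC ht₀ ht1).2.trans hside
    have hw := hwind _ (by rw [← hl, ← h23.2]; exact hmem2)
    rw [hw] at k2
    have hτ1 : τ = 1 := by linarith
    refine ⟨hτ1, fun t ht => ?_⟩
    rw [(P.sides_eq hC ht ht₀).1, (P.sides_eq hC ht ht₀).2, hl]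
    refine ⟨?_, hUunb⟩
    rw [← h13.2]
    refine hbdd _ fun hcon => ?_
    rw [hwind _ (by rw [← hcon]; exact hmem1)] at k1
    linarith

end PlaneLoop
end SpiralIndex

/-! ### Sides as a finite set with permutations: Seifert circles are the cycles of `τ * σ`. -/

namespace SpiralIndex

/-- The sides of a closed curve between its vertices: the side `j` runs from the parameter `a j`
to the parameter `b j`, the side `σ j` follows it along the curve, and `τ j` is the side that
starts on the other strand through the initial point of the side `j`. -/
structure IsSides {ι : Type} [Fintype ι] (γ : ℝ → Plane) (a b : ι → ℝ) (σ τ : Equiv.Perm ι) :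
    Prop where
  lt : ∀ j, a j < b j
  disjoint : ∀ j, Disjoint (Ioo (a j) (b j)) (crossingParams γ)
  coe_next : ∀ j, (b j : UnitAddCircle) = (a (σ j) : UnitAddCircle)
  crossing : ∀ j, τ j ≠ j → IsCrossing γ (a j) (a (τ j))
  notMem : ∀ j, τ j = j → a j ∉ crossingParams γ
  invol : ∀ j, τ (τ j) = j
  exists_mem : ∀ t : ℝ, ∃ j, ∃ n : ℤ, t + n ∈ Ico (a j) (b j)
  unique : ∀ j k, ∀ s ∈ Ico (a j) (b j), ∀ t ∈ Ico (a k) (b k),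
    (s : UnitAddCircle) = (t : UnitAddCircle) → s = t ∧ j = k
  telescope : ∀ θ : ℝ → ℝ, ∑ j, (θ (b j) - θ (a j)) = θ 1 - θ 0

/-- The points of `V` in increasing order, with the value 1 appended as the end of the last
interval. -/
theorem exists_partition {V : Set ℝ} (hV : V.Finite) (h0 : (0 : ℝ) ∈ V) (h1 : V ⊆ Ico 0 1) :
    ∃ (m : ℕ) (X : ℕ → ℝ), StrictMonoOn X (Iic (m + 1)) ∧ X 0 = 0 ∧ X (m + 1) = 1 ∧
      X '' Iic m = V := by
  classical
  set F := hV.toFinset with hF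
  have hFm : ∀ t, t ∈ F ↔ t ∈ V := fun t => hV.mem_toFinset
  obtain ⟨m, hm⟩ : ∃ m, F.card = m + 1 := Nat.exists_eq_succ_of_ne_zero
    (Finset.card_ne_zero_of_mem ((hFm 0).2 h0))
  set e := F.orderEmbOfFin hm with he
  have hmem : ∀ i, e i ∈ V := fun i => (hFm _).1 (F.orderEmbOfFin_mem hm i)
  have hsurj : ∀ t ∈ V, ∃ i, e i = t := by
    intro t ht
    have : t ∈ range e := by
      rw [he, Finset.range_orderEmbOfFin]
      exact (hFm t).2 ht
    exact this
  have hX : ∀ i : Fin (m + 1), (fun k => if h : k < m + 1 then e ⟨k, h⟩ else 1) (i : ℕ) = e i := by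
    intro i
    simp [i.2]
  refine ⟨m, fun k => if h : k < m + 1 then e ⟨k, h⟩ else 1, ?_, ?_, by simp, ?_⟩
  · intro i hi j hj hij
    have hi' : i < m + 1 := lt_of_lt_of_le hij hj
    by_cases hj' : j < m + 1
    · simp only [hi', hj', dite_true]
      exact e.strictMono hij
    · simp only [hi', hj', dite_true, dite_false]
      exact (h1 (hmem _)).2
  · obtain ⟨i, hi⟩ := hsurj 0 h0
    have : e 0 ≤ e i := e.monotone (Fin.zero_le i)
    rw [hi] at this
    have := le_antisymm this (h1 (hmem 0)).1
    simpa using this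
  · ext t
    constructor
    · rintro ⟨k, hk, rfl⟩
      have hk' : k < m + 1 := Nat.lt_succ_of_le hk
      simp only [hk', dite_true]
      exact hmem _
    · intro ht
      obtain ⟨i, rfl⟩ := hsurj t ht
      exact ⟨i, Nat.lt_succ_iff.1 i.2, hX i⟩

theorem exists_mem_Ico_of_partition {m : ℕ} {X : ℕ → ℝ} {t : ℝ} (h0 : X 0 ≤ t)
    (h1 : t < X (m + 1)) : ∃ k ≤ m, t ∈ Ico (X k) (X (k + 1)) := by
  induction m with
  | zero => exact ⟨0, le_rfl, h0, h1⟩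
  | succ m ih =>
    rcases lt_or_ge t (X (m + 1)) with h | h
    · obtain ⟨k, hk, hk2⟩ := ih h
      exact ⟨k, hk.trans (Nat.le_succ m), hk2⟩
    · exact ⟨m + 1, le_rfl, h, h1⟩

namespace PlaneLoop

variable {γ : ℝ → Plane} {c c' : ℝ → ℂ}

/-- The parameter 0 is always made a vertex, so that there is a side even without crossings. If 0 is
not a crossing, `τ` fixes the side starting there; `σ` is the cyclic shift. -/
theorem exists_isSides (P : PlaneLoop γ c c') :
    ∃ (m : ℕ) (a b : Fin (m + 1) → ℝ) (σ τ : Equiv.Perm (Fin (m + 1))), IsSides γ a b σ τ := by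
  classical
  set V : Set ℝ := insert 0 (crossingParams γ ∩ Ico 0 1) with hVdef
  have hVfin : V.Finite := by
    have := P.finite_crossingParams_inter 0
    rw [zero_add] at this
    exact this.insert 0
  have hV1 : V ⊆ Ico 0 1 := insert_subset ⟨le_rfl, one_pos⟩ inter_subset_right
  obtain ⟨m, X, hX, hX0, hX1, hXV⟩ := exists_partition hVfin (mem_insert _ _) hV1
  have hXle : ∀ k ≤ m + 1, 0 ≤ X k := fun k hk => by
    rw [← hX0]
    exact hX.monotoneOn (Nat.zero_le _) hk (Nat.zero_le k)
  have hXge : ∀ k ≤ m + 1, X k ≤ 1 := fun k hk => by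
    rw [← hX1]
    exact hX.monotoneOn hk (mem_Iic.2 le_rfl) hk
  have hm : ∀ j : Fin (m + 1), (j : ℕ) ≤ m := fun j => Nat.lt_succ_iff.1 j.2
  have hlt : ∀ j : Fin (m + 1), X j < X (j + 1) := fun j =>
    hX (mem_Iic.2 j.2.le) (mem_Iic.2 j.2) (Nat.lt_succ_self _)
  have h01 : ∀ j : Fin (m + 1), Ico (X j) (X (j + 1)) ⊆ Ico 0 (0 + 1) := fun j t ht =>
    ⟨(hXle _ j.2.le).trans ht.1, by rw [zero_add]; exact ht.2.trans_le (hXge _ j.2)⟩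
  have hidx : ∀ j k : Fin (m + 1), ∀ t, t ∈ Ico (X j) (X (j + 1)) → t ∈ Ico (X k) (X (k + 1)) →
      j = k := by
    have key : ∀ j k : Fin (m + 1), ∀ t, t ∈ Ico (X j) (X (j + 1)) →
        t ∈ Ico (X k) (X (k + 1)) → j ≤ k := by
      intro j k t hj hk
      by_contra! hcon
      have : X (k + 1) ≤ X j := hX.monotoneOn (mem_Iic.2 k.2) (mem_Iic.2 j.2.le) hcon
      linarith [hj.1, hk.2]
    exact fun j k t hj hk => le_antisymm (key j k t hj hk) (key k j t hk hj)
  have huniq : ∀ j k : Fin (m + 1), ∀ s ∈ Ico (X j) (X (j + 1)), ∀ t ∈ Ico (X k) (X (k + 1)),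
      (s : UnitAddCircle) = (t : UnitAddCircle) → s = t ∧ j = k := by
    intro j k s hs t ht hst
    have e := (AddCircle.coe_eq_coe_iff_of_mem_Ico (p := (1 : ℝ)) (h01 j hs) (h01 k ht)).1 hst
    subst e
    exact ⟨rfl, hidx j k s hs ht⟩
  have hpart : ∀ j : Fin (m + 1), ∀ t, IsCrossing γ (X j) t → ∃ i : Fin (m + 1),
      (t : UnitAddCircle) = (X i : ℝ) := by
    intro j t ht
    have e : ((Int.fract t : ℝ) : UnitAddCircle) = t := by simp
    have : Int.fract t ∈ V := Or.inr ⟨(P.mem_crossingParams_congr e).2 ⟨_, isCrossing_symm ht⟩,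
      Int.fract_nonneg t, Int.fract_lt_one t⟩
    rw [← hXV] at this
    obtain ⟨i, hi, hi2⟩ := this
    exact ⟨⟨i, Nat.lt_succ_of_le hi⟩, by rw [← e, ← hi2]⟩
  have hleft : ∀ j : Fin (m + 1), X j ∈ Ico (X j) (X (j + 1)) := fun j => ⟨le_rfl, hlt j⟩
  have hτ : ∀ j : Fin (m + 1), ∃ i : Fin (m + 1), (IsCrossing γ (X j) (X i) ∧ i ≠ j) ∨
      (i = j ∧ X j ∉ crossingParams γ) := by
    intro j
    by_cases h : X j ∈ crossingParams γ
    · obtain ⟨t, ht⟩ := h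
      obtain ⟨i, hi⟩ := hpart j t ht
      have := (P.isCrossing_congr rfl hi).1 ht
      exact ⟨i, Or.inl ⟨this, fun h => this.1 (by rw [h])⟩⟩
    · exact ⟨j, Or.inr ⟨rfl, h⟩⟩
  choose T hT using hτ
  -- Crossings are double points, so changing strands twice leads back.
  have hTT : Function.Involutive T := by
    intro j
    rcases hT j with ⟨h1, h2⟩ | ⟨h1, h2⟩
    · rcases hT (T j) with ⟨h3, h4⟩ | ⟨h3, h4⟩
      · have := P.double _ _ _ h3 (isCrossing_symm h1)
        exact (huniq _ _ _ (hleft _) _ (hleft _) this).2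
      · exact absurd ⟨_, isCrossing_symm h1⟩ h4
    · rw [h1, h1]
  refine ⟨m, fun j => X j, fun j => X (j + 1), finRotate (m + 1), hTT.toPerm T, ?_⟩
  refine ⟨hlt, fun j => ?_, fun j => ?_, fun j hj => ?_, fun j hj => ?_, hTT, fun t => ?_, huniq,
    fun θ => ?_⟩
  · refine disjoint_left.2 fun t ht htX => ?_
    have h := h01 j ⟨ht.1.le, ht.2⟩
    rw [zero_add] at h
    have hV' : t ∈ V := Or.inr ⟨htX, h⟩
    rw [← hXV] at hV'
    obtain ⟨i, hi, rfl⟩ := hV'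
    have h1 : (j : ℕ) < i := (hX.lt_iff_lt (mem_Iic.2 j.2.le)
      (mem_Iic.2 (hi.trans (Nat.le_succ m)))).1 ht.1
    have h2 : i < (j : ℕ) + 1 := (hX.lt_iff_lt (mem_Iic.2 (hi.trans (Nat.le_succ m)))
      (mem_Iic.2 j.2)).1 ht.2
    omega
  · rcases (hm j).lt_or_eq with h | h
    · have : ((finRotate (m + 1) j : Fin (m + 1)) : ℕ) = j + 1 := by
        rw [finRotate_apply, Fin.val_add_one_of_lt]
        exact Fin.lt_def.2 (by simpa using h)
      simp only [this]
    · have hj : j = Fin.last m := Fin.ext h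
      subst hj
      simp [hX0, hX1]
  · rcases hT j with h | h
    · exact h.1
    · exact absurd h.1 hj
  · rcases hT j with h | h
    · exact absurd hj h.2
    · exact h.2
  · obtain ⟨k, hk, hk2⟩ := exists_mem_Ico_of_partition (m := m) (X := X) (t := Int.fract t)
      (by rw [hX0]; exact Int.fract_nonneg t) (by rw [hX1]; exact Int.fract_lt_one t)
    refine ⟨⟨k, Nat.lt_succ_of_le hk⟩, -⌊t⌋, ?_⟩
    rwa [Int.cast_neg, ← sub_eq_add_neg, Int.self_sub_floor]
  · rw [Fin.sum_univ_eq_sum_range (fun j => θ (X (j + 1)) - θ (X j)),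
      Finset.sum_range_sub (fun j => θ (X j)), hX0, hX1]

end PlaneLoop

namespace IsSides

variable {γ : ℝ → Plane} {c c' : ℝ → ℂ} {ι : Type} [Fintype ι] {a b : ι → ℝ}
  {σ τ : Equiv.Perm ι}

/-- The midpoint of a side. -/
noncomputable def mid (a b : ι → ℝ) (j : ι) : ℝ := (a j + b j) / 2

theorem mid_mem (Q : IsSides γ a b σ τ) (j : ι) : mid a b j ∈ Ioo (a j) (b j) := by
  have := Q.lt j
  constructor <;> rw [mid] <;> linarith

theorem mid_notMem (Q : IsSides γ a b σ τ) (j : ι) : mid a b j ∉ crossingParams γ :=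
  disjoint_left.1 (Q.disjoint j) (Q.mid_mem j)

theorem left_mem (Q : IsSides γ a b σ τ) (j : ι) : a j ∈ Ico (a j) (b j) := ⟨le_rfl, Q.lt j⟩

theorem eqvGen_mid (Q : IsSides γ a b σ τ) {j : ι} {t : ℝ} (ht : t ∈ Ioo (a j) (b j)) :
    Relation.EqvGen (SeifertStep γ) (mid a b j) t :=
  PlaneLoop.eqvGen_of_disjoint ordConnected_Ioo (Q.disjoint j) (Q.mid_mem j) ht

/-- The side to which a parameter belongs. -/
noncomputable def sideOf (Q : IsSides γ a b σ τ) (t : ℝ) : ι := (Q.exists_mem t).choose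

theorem sideOf_spec (Q : IsSides γ a b σ τ) (t : ℝ) :
    ∃ n : ℤ, t + n ∈ Ico (a (Q.sideOf t)) (b (Q.sideOf t)) := (Q.exists_mem t).choose_spec

theorem sideOf_eq (Q : IsSides γ a b σ τ) {j : ι} {s t : ℝ} (ht : t ∈ Ico (a j) (b j))
    (h : (s : UnitAddCircle) = (t : UnitAddCircle)) : Q.sideOf s = j := by
  obtain ⟨n, hn⟩ := Q.sideOf_spec s
  exact (Q.unique _ _ _ hn _ ht ((coe_add_intCast s n).trans h)).2

theorem sideOf_congr (Q : IsSides γ a b σ τ) {s t : ℝ}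
    (h : (s : UnitAddCircle) = (t : UnitAddCircle)) : Q.sideOf s = Q.sideOf t := by
  obtain ⟨n, hn⟩ := Q.sideOf_spec t
  exact Q.sideOf_eq hn (h.trans (coe_add_intCast t n).symm)

theorem eventually_sideOf_right (Q : IsSides γ a b σ τ) (t : ℝ) :
    ∀ᶠ y in 𝓝[>] t, Q.sideOf y = Q.sideOf t := by
  obtain ⟨n, hn⟩ := Q.sideOf_spec t
  filter_upwards [Ioo_mem_nhdsGT (show t < b (Q.sideOf t) - n by linarith [hn.2])] with y hy
  exact Q.sideOf_eq (t := y + n) ⟨by linarith [hy.1, hn.1], by linarith [hy.2]⟩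
    (coe_add_intCast y n).symm

theorem eventually_sideOf_left (Q : IsSides γ a b σ τ) {j : ι} {t : ℝ}
    (h : (t : UnitAddCircle) = (a (σ j) : UnitAddCircle)) :
    ∀ᶠ y in 𝓝[<] t, Q.sideOf y = j := by
  obtain ⟨n, rfl⟩ := coe_unitAddCircle_eq_iff.1 (h.trans (Q.coe_next j).symm)
  have := Q.lt j
  filter_upwards [Ioo_mem_nhdsLT (show a j + n < b j + n by linarith)] with y hy
  have e : ((y - n : ℝ) : UnitAddCircle) = y := by
    have := coe_add_intCast (y - n) n
    rwa [sub_add_cancel, eq_comm] at this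
  exact Q.sideOf_eq (t := y - n) ⟨by linarith [hy.1], by linarith [hy.2]⟩ e.symm

theorem coe_eq_of_mem (Q : IsSides γ a b σ τ) (P : PlaneLoop γ c c') {t : ℝ}
    (ht : t ∈ crossingParams γ) : (t : UnitAddCircle) = (a (Q.sideOf t) : UnitAddCircle) := by
  obtain ⟨n, hn⟩ := Q.sideOf_spec t
  rcases hn.1.lt_or_eq with h | h
  · exact absurd ((P.mem_crossingParams_add_intCast t n).2 ht)
      (disjoint_left.1 (Q.disjoint _) ⟨h, hn.2⟩)
  · rw [h, coe_add_intCast]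

/-- The side changes off the crossings only at a vertex fixed by `τ`; there `τ * σ` carries the
preceding side to the following one. -/
theorem eventually_sameCycle (Q : IsSides γ a b σ τ) (P : PlaneLoop γ c c') {t : ℝ}
    (ht : t ∉ crossingParams γ) :
    ∀ᶠ y in 𝓝 t, (τ * σ).SameCycle (Q.sideOf t) (Q.sideOf y) := by
  rw [← nhdsLE_sup_nhdsGT t, ← Iio_insert, nhdsWithin_insert, eventually_sup, eventually_sup,
    eventually_pure]
  refine ⟨⟨.refl _ _, ?_⟩, ?_⟩
  · obtain ⟨n, hn⟩ := Q.sideOf_spec t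
    rcases hn.1.lt_or_eq with h | h
    · filter_upwards [Ioo_mem_nhdsLT (show a (Q.sideOf t) - n < t by linarith)] with y hy
      rw [Q.sideOf_eq (s := y) (t := y + n) ⟨by linarith [hy.1], by linarith [hy.2, hn.2]⟩
        (coe_add_intCast y n).symm]
    · have hτ : τ (Q.sideOf t) = Q.sideOf t := by
        by_contra hne
        have := Q.crossing _ hne
        rw [h] at this
        exact ht ((P.mem_crossingParams_add_intCast t n).1 ⟨_, this⟩)
      have e : (t : UnitAddCircle) = (a (σ (σ.symm (Q.sideOf t))) : UnitAddCircle) := by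
        rw [Equiv.apply_symm_apply, h, coe_add_intCast]
      filter_upwards [Q.eventually_sideOf_left e] with y hy
      rw [hy, ← Equiv.Perm.sameCycle_apply_right, Equiv.Perm.mul_apply, Equiv.apply_symm_apply, hτ]
  · filter_upwards [Q.eventually_sideOf_right t] with y hy
    rw [hy]

theorem sameCycle_of_disjoint (Q : IsSides γ a b σ τ) (P : PlaneLoop γ c c') {J : Set ℝ}
    (hJ : IsPreconnected J) (hd : Disjoint J (crossingParams γ)) {s t : ℝ} (hs : s ∈ J)
    (ht : t ∈ J) : (τ * σ).SameCycle (Q.sideOf s) (Q.sideOf t) :=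
  hJ.induction₂ (fun s t => (τ * σ).SameCycle (Q.sideOf s) (Q.sideOf t))
    (fun _ hx => nhdsWithin_le_nhds (Q.eventually_sameCycle P (disjoint_left.1 hd hx)))
    (fun _ _ _ _ _ _ h1 h2 => h1.trans h2) (fun _ _ _ _ h => h.symm) hs ht

theorem sameCycle_of_step (Q : IsSides γ a b σ τ) (P : PlaneLoop γ c c') {s t : ℝ}
    (h : SeifertStep γ s t) : (τ * σ).SameCycle (Q.sideOf s) (Q.sideOf t) := by
  cases h with
  | period ht => rw [Q.sideOf_congr (s := s + 1) (t := s) (by simp)]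
  | along _ hst h =>
    exact Q.sameCycle_of_disjoint P isPreconnected_Icc h (left_mem_Icc.2 hst) (right_mem_Icc.2 hst)
  | switch u v _ hs hsu huv ht hvt =>
    have hu := Q.coe_eq_of_mem P ⟨v, huv⟩
    have hv := Q.coe_eq_of_mem P ⟨u, PlaneLoop.isCrossing_symm huv⟩
    set j := Q.sideOf u
    set k := Q.sideOf v
    -- The other strand is unique, since no point has three parameters on the circle.
    have hjk : τ j = k := by
      have h1 : τ j ≠ j := fun h => Q.notMem j h ((P.mem_crossingParams_congr hu).1 ⟨v, huv⟩)
      have h2 := P.double _ _ _ (Q.crossing j h1) ((P.isCrossing_congr hu hv).1 huv)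
      exact (Q.unique _ _ _ (Q.left_mem _) _ (Q.left_mem _) h2).2
    obtain ⟨x, hx1, hx2⟩ := ((Q.eventually_sideOf_left (j := σ.symm j) (t := u)
      (by rw [Equiv.apply_symm_apply, hu])).and (Ico_mem_nhdsLT hs)).exists
    obtain ⟨y, hy1, hy2⟩ := ((Q.eventually_sideOf_right v).and (Ioc_mem_nhdsGT ht)).exists
    have e1 := Q.sameCycle_of_disjoint P isPreconnected_Ico hsu (show s ∈ Ico s u from ⟨le_rfl, hs⟩) hx2
    have e2 := Q.sameCycle_of_disjoint P isPreconnected_Ioc hvt hy2 (show t ∈ Ioc v t from ⟨ht, le_rfl⟩)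
    refine e1.trans (.trans ?_ e2)
    rw [hx1, hy1, ← Equiv.Perm.sameCycle_apply_left, Equiv.Perm.mul_apply, Equiv.apply_symm_apply,
      hjk]

theorem sameCycle_of_eqvGen (Q : IsSides γ a b σ τ) (P : PlaneLoop γ c c') {s t : ℝ}
    (h : Relation.EqvGen (SeifertStep γ) s t) :
    (τ * σ).SameCycle (Q.sideOf s) (Q.sideOf t) := by
  induction h with
  | rel _ _ h => exact Q.sameCycle_of_step P h
  | refl => exact .refl _ _
  | symm _ _ _ ih => exact ih.symm
  | trans _ _ _ _ _ ih1 ih2 => exact ih1.trans ih2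

/-- One application of `τ * σ` runs to the end of a side and then changes strands, or simply
continues if the vertex is not a crossing. -/
theorem eqvGen_mid_next (Q : IsSides γ a b σ τ) (P : PlaneLoop γ c c') (j : ι) :
    Relation.EqvGen (SeifertStep γ) (mid a b j) (mid a b ((τ * σ) j)) := by
  have hd : ∀ k, a k ∉ crossingParams γ → Disjoint (Icc (a k) (mid a b k)) (crossingParams γ) := by
    intro k hk
    refine disjoint_left.2 fun t ht => ?_
    rcases ht.1.lt_or_eq with h | h
    · exact disjoint_left.1 (Q.disjoint k) ⟨h, ht.2.trans_lt (Q.mid_mem k).2⟩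
    · rwa [← h]
  by_cases h : τ (σ j) = σ j
  · have h1 := Q.notMem _ h
    have h2 := (P.mem_crossingParams_congr (Q.coe_next j)).not.2 h1
    have h3 : Disjoint (Icc (mid a b j) (b j)) (crossingParams γ) := by
      refine disjoint_left.2 fun t ht => ?_
      rcases ht.2.lt_or_eq with h | h
      · exact disjoint_left.1 (Q.disjoint j) ⟨(Q.mid_mem j).1.trans_le ht.1, h⟩
      · rwa [h]
    rw [Equiv.Perm.mul_apply, h]
    refine .trans _ (b j) _ (.rel _ _ (.along _ _ (Q.mid_mem j).2.le h3)) (.trans _ (a (σ j)) _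
      (P.eqvGen_of_coe_eq h2 (Q.coe_next j))
      (.rel _ _ (.along _ _ (Q.mid_mem _).1.le (hd _ h1))))
  · refine .rel _ _ (.switch _ (b j) (a (τ (σ j))) _ (Q.mid_mem j).2 ?_ ?_ (Q.mid_mem _).1 ?_)
    · exact (Q.disjoint j).mono_left (Ico_subset_Ioo_left (Q.mid_mem j).1)
    · exact (P.isCrossing_congr (Q.coe_next j) rfl).2 (Q.crossing _ h)
    · exact (Q.disjoint _).mono_left (Ioc_subset_Ioo_right (Q.mid_mem _).2)

theorem eqvGen_mid_of_sameCycle (Q : IsSides γ a b σ τ) (P : PlaneLoop γ c c') {j k : ι}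
    (h : (τ * σ).SameCycle j k) : Relation.EqvGen (SeifertStep γ) (mid a b j) (mid a b k) := by
  obtain ⟨n, rfl⟩ := h.exists_nat_pow_eq
  clear h
  induction n with
  | zero => exact .refl _
  | succ n ih =>
    rw [pow_succ', Equiv.Perm.mul_apply (τ * σ)]
    exact ih.trans _ _ _ (Q.eqvGen_mid_next P _)

theorem sideOf_mid (Q : IsSides γ a b σ τ) (j : ι) : Q.sideOf (mid a b j) = j :=
  Q.sideOf_eq (Ioo_subset_Ico_self (Q.mid_mem j)) rfl

theorem eqvGen_mid_sideOf (Q : IsSides γ a b σ τ) (P : PlaneLoop γ c c') {t : ℝ}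
    (ht : t ∉ crossingParams γ) :
    Relation.EqvGen (SeifertStep γ) t (mid a b (Q.sideOf t)) := by
  obtain ⟨n, hn⟩ := Q.sideOf_spec t
  have hn' := (P.mem_crossingParams_add_intCast t n).not.2 ht
  refine .trans _ _ _ (P.eqvGen_add_intCast ht n)
    (PlaneLoop.eqvGen_of_disjoint (J := insert (t + n) (Ioo (a (Q.sideOf t)) (b (Q.sideOf t)))) ?_ ?_
    (mem_insert _ _) (mem_insert_of_mem _ (Q.mid_mem _)))
  · rcases hn.1.lt_or_eq with h | h
    · rw [insert_eq_of_mem (show t + n ∈ Ioo _ _ from ⟨h, hn.2⟩)]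
      exact ordConnected_Ioo
    · rw [← h, Ioo_insert_left (Q.lt _)]
      exact ordConnected_Ico
  · rw [disjoint_insert_left]
    exact ⟨hn', Q.disjoint _⟩

/-- The Seifert circle through a side. -/
def circle (γ : ℝ → Plane) (a b : ι → ℝ) (j : ι) : Set ℝ :=
  {s | s ∉ crossingParams γ ∧ Relation.EqvGen (SeifertStep γ) (mid a b j) s}

theorem circle_mem (Q : IsSides γ a b σ τ) (j : ι) : circle γ a b j ∈ seifertCircles γ :=
  ⟨_, Q.mid_notMem j, rfl⟩

/-- This turns the equivalence classes of moves, which live on the real line, into cycles of a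
permutation of a finite set. -/
theorem circle_eq_circle_iff (Q : IsSides γ a b σ τ) (P : PlaneLoop γ c c') {j k : ι} :
    circle γ a b j = circle γ a b k ↔ (τ * σ).SameCycle j k := by
  constructor
  · intro h
    have : mid a b k ∈ circle γ a b j := by
      rw [h]
      exact ⟨Q.mid_notMem k, .refl _⟩
    simpa only [sideOf_mid] using Q.sameCycle_of_eqvGen P this.2
  · intro h
    have := Q.eqvGen_mid_of_sameCycle P h
    ext s
    exact and_congr_right fun _ => ⟨fun h => (this.symm _ _).trans _ _ _ h,
      fun h => this.trans _ _ _ h⟩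

theorem seifertCircles_eq_range (Q : IsSides γ a b σ τ) (P : PlaneLoop γ c c') :
    seifertCircles γ = range (circle γ a b) := by
  refine subset_antisymm ?_ (range_subset_iff.2 Q.circle_mem)
  rintro _ ⟨t, ht, rfl⟩
  have := Q.eqvGen_mid_sideOf P ht
  refine ⟨Q.sideOf t, ?_⟩
  ext s
  exact and_congr_right fun _ => ⟨fun h => this.trans _ _ _ h,
    fun h => (this.symm _ _).trans _ _ _ h⟩

theorem Ioo_subset_circle (Q : IsSides γ a b σ τ) (P : PlaneLoop γ c c') {j k : ι}
    (h : (τ * σ).SameCycle j k) : Ioo (a k) (b k) ⊆ circle γ a b j := fun _ ht =>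
  ⟨disjoint_left.1 (Q.disjoint k) ht,
    (Q.eqvGen_mid_of_sameCycle P h).trans _ _ _ (Q.eqvGen_mid ht)⟩

/-- Transversality excludes cusps: the two tangents are independent, or equal at a vertex that is
not a crossing. -/
theorem corner (Q : IsSides γ a b σ τ) (P : PlaneLoop γ c c') (i : ι) :
    c' (a (τ i)) / c' (a i) ∈ Complex.slitPlane := by
  have h0 := P.regular (a i)
  by_cases h : τ i = i
  · rw [h, div_self h0]
    exact Complex.one_mem_slitPlane
  · have := P.transverse _ _ (Q.crossing i h)
    refine Complex.mem_slitPlane_iff.2 (Or.inr fun hcon => this ?_)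
    have e : c' (a (τ i)) = c' (a (τ i)) / c' (a i) * c' (a i) := (div_mul_cancel₀ _ h0).symm
    set z := c' (a (τ i)) / c' (a i)
    rw [e, cross, Complex.mul_re, Complex.mul_im, hcon]
    ring

/-- The exterior angles at all the vertices add up to zero. -/
theorem sum_arg (Q : IsSides γ a b σ τ) (P : PlaneLoop γ c c') :
    ∑ j, (c' (a ((τ * σ) j)) / c' (b j)).arg = 0 := by
  have e1 : ∑ j, (c' (a ((τ * σ) j)) / c' (b j)).arg = ∑ i, (c' (a (τ i)) / c' (a i)).arg := by
    rw [← Equiv.sum_comp σ fun i => (c' (a (τ i)) / c' (a i)).arg]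
    refine Finset.sum_congr rfl fun j _ => ?_
    rw [Equiv.Perm.mul_apply, P.deriv_eq_of_coe_eq (Q.coe_next j)]
  -- The two corners at a crossing turn between the same two tangents in opposite senses. The
  -- argument is odd under inversion since it is never π.
  have e2 : ∀ i, (c' (a (τ (τ i))) / c' (a (τ i))).arg = -(c' (a (τ i)) / c' (a i)).arg := by
    intro i
    rw [Q.invol, ← inv_div, Complex.arg_inv, if_neg]
    exact Complex.slitPlane_arg_ne_pi (Q.corner P i)
  have e3 : ∑ i, (c' (a (τ i)) / c' (a i)).arg = -∑ i, (c' (a (τ i)) / c' (a i)).arg := by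
    conv_lhs => rw [← Equiv.sum_comp τ]
    rw [← Finset.sum_neg_distrib]
    exact Finset.sum_congr rfl fun i _ => e2 i
  rw [e1]
  linarith

end IsSides
end SpiralIndex

namespace SpiralIndex

/-! ### The closed curve traced by a Seifert circle -/

/-- The mean of the derivative along the chord between two points of a piece of a curve that is
run through at the constant rate `ℓ` from the parameter `p` on. -/
noncomputable def chord (c' : ℝ → ℂ) (p ℓ : ℝ) (q : ℝ × ℝ) : ℂ :=
  ℓ * ∫ r in (0 : ℝ)..1, c' (p + ℓ * (q.1 + r * (q.2 - q.1)))

theorem chord_self (c' : ℝ → ℂ) (p ℓ u : ℝ) : chord c' p ℓ (u, u) = ℓ * c' (p + ℓ * u) := by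
  simp [chord]

theorem continuous_chord {c' : ℝ → ℂ} (hc : Continuous c') (p ℓ : ℝ) :
    Continuous (chord c' p ℓ) := by
  refine continuous_const.mul ?_
  exact intervalIntegral.continuous_parametric_intervalIntegral_of_continuous
    (f := fun (q : ℝ × ℝ) r => c' (p + ℓ * (q.1 + r * (q.2 - q.1))))
    (by fun_prop) continuous_const

/-- The curve whose `k`-th piece, over the unit interval from `k` on, is `h k`. -/
noncomputable def concat (N : ℕ) (h : ℕ → ℝ → ℂ) (t : ℝ) : ℂ :=
  -- The cap at `N` makes the final parameter N + 1 belong to the last piece.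
  h (min ⌊t⌋₊ N) (t - (min ⌊t⌋₊ N : ℕ))

theorem concat_add {N : ℕ} {h : ℕ → ℝ → ℂ} (hglue : ∀ k < N, h (k + 1) 0 = h k 1) {k : ℕ}
    (hk : k ≤ N) {u : ℝ} (hu : u ∈ Icc (0 : ℝ) 1) : concat N h (k + u) = h k u := by
  rcases hu.2.lt_or_eq with h1 | rfl
  · have e : ⌊(k + u : ℝ)⌋₊ = k := by
      rw [Nat.floor_eq_iff (by have := hu.1; positivity)]
      constructor <;> linarith [hu.1]
    rw [concat, e, min_eq_left hk, add_sub_cancel_left]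
  · have e : ⌊(k + 1 : ℝ)⌋₊ = k + 1 := by exact_mod_cast Nat.floor_natCast (k + 1)
    rcases hk.lt_or_eq with h2 | rfl
    · rw [concat, e, min_eq_left h2]
      push_cast
      rw [sub_self, hglue k h2]
    · rw [concat, e, min_eq_right (Nat.le_succ k), add_sub_cancel_left]

namespace PlaneLoop

variable {γ : ℝ → Plane} {c c' : ℝ → ℂ}

/-- By the fundamental theorem of calculus, `chord` is the difference quotient off the diagonal; as
an integral mean it is continuous across it. -/
theorem sub_eq_chord (P : PlaneLoop γ c c') (p ℓ u v : ℝ) :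
    c (p + ℓ * v) - c (p + ℓ * u) = (v - u : ℝ) * chord c' p ℓ (u, v) := by
  have hd : ∀ r ∈ uIcc (0 : ℝ) 1, HasDerivAt (fun r => c (p + ℓ * (u + r * (v - u))))
      ((ℓ * (v - u)) • c' (p + ℓ * (u + r * (v - u)))) r := by
    intro r _
    refine (P.deriv _).scomp r ?_
    have := ((((hasDerivAt_id r).mul_const (v - u)).const_add u).const_mul ℓ).const_add p
    simpa using this
  have hc := P.cont_deriv
  have := intervalIntegral.integral_eq_sub_of_hasDerivAt hd
    (Continuous.intervalIntegrable (by fun_prop) _ _)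
  rw [intervalIntegral.integral_smul] at this
  simp only [one_mul, add_sub_cancel, zero_mul, add_zero] at this
  rw [← this, chord, Complex.real_smul]
  push_cast
  ring

/-- Rescaling the pieces to unit intervals multiplies tangents by positive lengths only. This
affects neither the corner condition nor the direction at the base point, where the factor is a
quotient of lengths. -/
theorem piecewiseLoop (P : PlaneLoop γ c c') {N : ℕ} (hN : 1 ≤ N) {A B : ℕ → ℝ}
    (hAB : ∀ k, A k < B k) (hglue : ∀ k < N, c (A (k + 1)) = c (B k))
    (hcorner : ∀ k < N, c' (A (k + 1)) / c' (B k) ∈ Complex.slitPlane) (hbase : B N = A 0)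
    (hinj : ∀ k ≤ N, ∀ l ≤ N, ∀ s ∈ Ico (A k) (B k), ∀ t ∈ Ico (A l) (B l), c s = c t →
      k = l ∧ s = t) :
    PiecewiseLoop N (concat N fun k u => c (A k + (B k - A k) * u))
      (fun k u => c (A k + (B k - A k) * u)) (fun k => chord c' (A k) (B k - A k)) := by
  have hg : ∀ k < N, c (A (k + 1) + (B (k + 1) - A (k + 1)) * 0) =
      c (A k + (B k - A k) * 1) := by
    intro k hk
    rw [mul_zero, add_zero, mul_one, add_sub_cancel, hglue k hk]
  have hpos : ∀ k, 0 < B k - A k := fun k => sub_pos.2 (hAB k)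
  have hne : ∀ k, ((B k - A k : ℝ) : ℂ) ≠ 0 := fun k => Complex.ofReal_ne_zero.2 (hpos k).ne'
  have hval : ∀ k ≤ N, ∀ u ∈ Icc (0 : ℝ) 1,
      concat N (fun k u => c (A k + (B k - A k) * u)) (k + u) = c (A k + (B k - A k) * u) :=
    fun k hk u hu => concat_add (h := fun k u => c (A k + (B k - A k) * u)) hg hk hu
  have hclosed : concat N (fun k u => c (A k + (B k - A k) * u)) (N + 1) =
      concat N (fun k u => c (A k + (B k - A k) * u)) 0 := by
    have h1 := hval N le_rfl 1 ⟨zero_le_one, le_rfl⟩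
    have h0 := hval 0 (Nat.zero_le _) 0 ⟨le_rfl, zero_le_one⟩
    rw [Nat.cast_zero, zero_add] at h0
    rw [h0, h1, mul_one, add_sub_cancel, hbase, mul_zero, add_zero]
  have hinjOn : InjOn (concat N fun k u => c (A k + (B k - A k) * u)) (Ico 0 (N + 1)) := by
    have key : ∀ s ∈ Ico (0 : ℝ) (N + 1), ⌊s⌋₊ ≤ N ∧ s - ⌊s⌋₊ ∈ Ico (0 : ℝ) 1 := by
      intro s hs
      have h1 := Nat.floor_le hs.1
      have h2 := Nat.lt_floor_add_one s
      refine ⟨Nat.lt_succ_iff.1 ((Nat.floor_lt hs.1).2 (by push_cast; exact hs.2)), ?_, ?_⟩ <;>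
        linarith
    have hmem : ∀ k, ∀ u ∈ Ico (0 : ℝ) 1, A k + (B k - A k) * u ∈ Ico (A k) (B k) := by
      intro k u hu
      constructor <;> nlinarith [hpos k, hu.1, hu.2]
    intro s hs t ht hst
    obtain ⟨k1, k2⟩ := key s hs
    obtain ⟨l1, l2⟩ := key t ht
    have e1 := hval _ k1 _ (Ico_subset_Icc_self k2)
    have e2 := hval _ l1 _ (Ico_subset_Icc_self l2)
    rw [add_sub_cancel] at e1 e2
    rw [e1, e2] at hst
    obtain ⟨f1, f2⟩ := hinj _ k1 _ l1 _ (hmem _ _ k2) _ (hmem _ _ l2) hst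
    rw [f1] at f2
    have := mul_left_cancel₀ (hpos _).ne' (add_left_cancel f2)
    linarith
  refine ⟨hN, fun k => continuous_chord P.cont_deriv _ _, fun k u v => P.sub_eq_chord _ _ _ _,
    hval, fun k _ u _ => ?_, fun k hk => ?_, ⟨(B N - A N) / (B 0 - A 0), div_pos (hpos N) (hpos 0),
    ?_⟩, hclosed, fun s t hs hst ht h => ?_⟩
  · simp only [chord_self]
    exact mul_ne_zero (hne k) (P.regular _)
  · simp only [chord_self]
    rw [mul_zero, add_zero, mul_one, add_sub_cancel, mul_div_mul_comm, ← Complex.ofReal_div]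
    have := div_pos (hpos (k + 1)) (hpos k)
    rcases Complex.mem_slitPlane_iff.1 (hcorner k hk) with h | h
    · exact Complex.mem_slitPlane_iff.2 (Or.inl (by
        rw [Complex.re_ofReal_mul]; exact mul_pos this h))
    · exact Complex.mem_slitPlane_iff.2 (Or.inr (by
        rw [Complex.im_ofReal_mul]; exact mul_ne_zero this.ne' h))
  · have := hne 0
    simp only [chord_self]
    rw [mul_zero, add_zero, mul_one, add_sub_cancel, hbase, ← mul_assoc, Complex.ofReal_div,
      div_mul_cancel₀ _ this]
  · rcases ht.lt_or_eq with h1 | rfl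
    · exact absurd (hinjOn ⟨hs, hst.trans h1⟩ ⟨hs.trans hst.le, h1⟩ h) hst.ne
    · rw [hclosed] at h
      exact ⟨hinjOn ⟨hs, hst⟩ ⟨le_rfl, by positivity⟩ h, rfl⟩

end PlaneLoop
end SpiralIndex

/-! ### One cycle of sides as a simple closed curve, and the count of all circles. -/

namespace SpiralIndex
namespace IsSides

theorem sameCycle_iterate {ι : Type} (S : Equiv.Perm ι) (j : ι) (k : ℕ) :
    S.SameCycle j (S^[k] j) := by
  rw [← Equiv.Perm.coe_pow]
  exact ⟨k, by simp⟩

variable {γ : ℝ → Plane} {c c' : ℝ → ℂ} {ι : Type} [Fintype ι] {a b : ι → ℝ}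
  {σ τ : Equiv.Perm ι}

theorem minimalPeriod_pos (S : Equiv.Perm ι) (j : ι) : 0 < Function.minimalPeriod S j :=
  Function.minimalPeriod_pos_of_mem_periodicPts (S.injective.mem_periodicPts j)

theorem sum_range_minimalPeriod (S : Equiv.Perm ι) (j : ι) (f : ι → ℝ)
    [DecidablePred (S.SameCycle j)] :
    ∑ k ∈ Finset.range (Function.minimalPeriod S j), f (S^[k] j) =
      ∑ i with S.SameCycle j i, f i := by
  refine Finset.sum_bij (fun k _ => S^[k] j) (fun k _ => ?_) (fun k hk l hl h => ?_)
    (fun i hi => ?_) (fun _ _ => rfl)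
  · simpa using sameCycle_iterate S j k
  · exact Function.iterate_injOn_Iio_minimalPeriod (Finset.mem_range.1 hk)
      (Finset.mem_range.1 hl) h
  · obtain ⟨n, rfl⟩ := (Finset.mem_filter.1 hi).2.exists_nat_pow_eq
    refine ⟨n % Function.minimalPeriod S j,
      Finset.mem_range.2 (Nat.mod_lt _ (minimalPeriod_pos S j)), ?_⟩
    rw [Function.iterate_mod_minimalPeriod_eq, Equiv.Perm.coe_pow]

/-- The initial parameter of the `k`-th piece of a Seifert circle when it is run through from the
midpoint of a side. -/
noncomputable def start (a b : ι → ℝ) (S : Equiv.Perm ι) (j : ι) (k : ℕ) : ℝ :=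
  if k = 0 then mid a b j else a (S^[k] j)

/-- The final parameter of the `k`-th piece of a Seifert circle when it is run through from the
midpoint of a side. -/
noncomputable def finish (a b : ι → ℝ) (S : Equiv.Perm ι) (j : ι) (k : ℕ) : ℝ :=
  if k = Function.minimalPeriod S j then mid a b j else b (S^[k] j)

theorem le_start (Q : IsSides γ a b σ τ) (S : Equiv.Perm ι) (j : ι) (k : ℕ) :
    a (S^[k] j) ≤ start a b S j k := by
  rw [start]
  split_ifs with h
  · rw [h]
    exact (Q.mid_mem j).1.le
  · exact le_rfl

theorem finish_le (Q : IsSides γ a b σ τ) (S : Equiv.Perm ι) (j : ι) (k : ℕ) :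
    finish a b S j k ≤ b (S^[k] j) := by
  rw [finish]
  split_ifs with h
  · rw [h, Function.iterate_minimalPeriod]
    exact (Q.mid_mem j).2.le
  · exact le_rfl

theorem start_lt_finish (Q : IsSides γ a b σ τ) (S : Equiv.Perm ι) (j : ι) (k : ℕ) :
    start a b S j k < finish a b S j k := by
  have hp := minimalPeriod_pos S j
  by_cases h : k = 0
  · rw [start, if_pos h, finish, if_neg (by omega), h]
    exact (Q.mid_mem j).2
  · by_cases h' : k = Function.minimalPeriod S j
    · rw [start, if_neg h, finish, if_pos h', h', Function.iterate_minimalPeriod]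
      exact (Q.mid_mem j).1
    · rw [start, if_neg h, finish, if_neg h']
      exact Q.lt _

/-- The first and the last piece are the two halves of the side `j`, so together they contribute the
increment over that side. -/
theorem sum_finish_sub_start (S : Equiv.Perm ι) (j : ι) (f : ℝ → ℝ) :
    ∑ k ∈ Finset.range (Function.minimalPeriod S j + 1),
        (f (finish a b S j k) - f (start a b S j k)) =
      ∑ k ∈ Finset.range (Function.minimalPeriod S j), (f (b (S^[k] j)) - f (a (S^[k] j))) := by
  have e1 : ∑ k ∈ Finset.range (Function.minimalPeriod S j + 1), f (finish a b S j k) =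
      ∑ k ∈ Finset.range (Function.minimalPeriod S j), f (b (S^[k] j)) + f (mid a b j) := by
    rw [Finset.sum_range_succ, finish, if_pos rfl]
    congr 1
    refine Finset.sum_congr rfl fun k hk => ?_
    rw [finish, if_neg (Finset.mem_range.1 hk).ne]
  have e2 : ∑ k ∈ Finset.range (Function.minimalPeriod S j + 1), f (start a b S j k) =
      ∑ k ∈ Finset.range (Function.minimalPeriod S j), f (a (S^[k + 1] j)) + f (mid a b j) := by
    rw [Finset.sum_range_succ', start, if_pos rfl]
    congr 1
  have e3 : ∑ k ∈ Finset.range (Function.minimalPeriod S j), f (a (S^[k + 1] j)) =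
      ∑ k ∈ Finset.range (Function.minimalPeriod S j), f (a (S^[k] j)) := by
    have h1 := Finset.sum_range_succ (fun k => f (a (S^[k] j))) (Function.minimalPeriod S j)
    have h2 := Finset.sum_range_succ' (fun k => f (a (S^[k] j))) (Function.minimalPeriod S j)
    rw [h1, Function.iterate_minimalPeriod] at h2
    simpa using h2.symm
  rw [Finset.sum_sub_distrib, Finset.sum_sub_distrib, e1, e2, e3]
  ring

/-- This is why a Seifert circle is simple. The two outgoing arms of a crossing have the left
indices of the two incoming ones, in the other order; these differ, whereas the left index is
constant on a circle. -/
theorem right_ne (Q : IsSides γ a b σ τ) (P : PlaneLoop γ c c') {i j k : ι}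
    (hi : (τ * σ).SameCycle i j) (hk : (τ * σ).SameCycle i k) : ¬ IsCrossing γ (a j) (a k) := by
  intro h
  obtain ⟨ρ, hρ, -, h2, -⟩ := P.exists_smoothing h
  have hj := Q.lt j
  have hk' := Q.lt k
  set x := min (ρ / 2) (min ((b j - a j) / 2) ((b k - a k) / 2)) with hx
  have hx0 : 0 < x := lt_min (by linarith) (lt_min (by linarith) (by linarith))
  have hxρ : x < ρ := (min_le_left _ _).trans_lt (by linarith)
  have hxj : x ≤ (b j - a j) / 2 := (min_le_right _ _).trans (min_le_left _ _)
  have hxk : x ≤ (b k - a k) / 2 := (min_le_right _ _).trans (min_le_right _ _)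
  obtain ⟨h3, -, h5⟩ := h2 x ⟨hx0, hxρ⟩ x ⟨hx0, hxρ⟩
  obtain ⟨-, h4, -⟩ := h2 x ⟨hx0, hxρ⟩ x ⟨hx0, hxρ⟩
  have e1 := (Q.Ioo_subset_circle P hi (show a j + x ∈ _ from ⟨by linarith, by linarith⟩)).2
  have e2 := (Q.Ioo_subset_circle P hk (show a k + x ∈ _ from ⟨by linarith, by linarith⟩)).2
  have := P.leftIndex_eq_of_eqvGen ((e1.symm _ _).trans _ _ _ e2)
  rw [← h3, ← h4] at this
  exact h5 this.symm

/-- Starting from the midpoint of a side makes the base point smooth, at the price of one piece more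
than the cycle has sides. -/
theorem piecewiseLoop (Q : IsSides γ a b σ τ) (P : PlaneLoop γ c c') (j : ι) :
    PiecewiseLoop (Function.minimalPeriod (τ * σ) j)
      (concat (Function.minimalPeriod (τ * σ) j) fun k u =>
        c (start a b (τ * σ) j k + (finish a b (τ * σ) j k - start a b (τ * σ) j k) * u))
      (fun k u => c (start a b (τ * σ) j k +
        (finish a b (τ * σ) j k - start a b (τ * σ) j k) * u))
      (fun k => chord c' (start a b (τ * σ) j k)
        (finish a b (τ * σ) j k - start a b (τ * σ) j k)) := by
  set S := τ * σ with hS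
  set m := Function.minimalPeriod S j with hm
  have hp : 0 < m := minimalPeriod_pos S j
  have hstart : ∀ k < m, start a b S j (k + 1) = a (τ (σ (S^[k] j))) := by
    intro k _
    rw [start, if_neg (Nat.succ_ne_zero k), Function.iterate_succ_apply', hS]
    rfl
  have hfinish : ∀ k < m, finish a b S j k = b (S^[k] j) := by
    intro k hk
    rw [finish, if_neg hk.ne]
  refine P.piecewiseLoop hp (Q.start_lt_finish S j) (fun k hk => ?_) (fun k hk => ?_) ?_ ?_
  · rw [hstart k hk, hfinish k hk, P.eq_of_coe_eq (Q.coe_next _)]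
    by_cases h : τ (σ (S^[k] j)) = σ (S^[k] j)
    · rw [h]
    · exact (P.isCrossing_iff.1 (Q.crossing _ h)).2.symm
  · rw [hstart k hk, hfinish k hk, P.deriv_eq_of_coe_eq (Q.coe_next _)]
    exact Q.corner P _
  · rw [finish, if_pos rfl, start, if_pos rfl]
  · intro k hk l hl s hs t ht hst
    have hs' : s ∈ Ico (a (S^[k] j)) (b (S^[k] j)) :=
      ⟨(Q.le_start S j k).trans hs.1, hs.2.trans_le (Q.finish_le S j k)⟩
    have ht' : t ∈ Ico (a (S^[l] j)) (b (S^[l] j)) :=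
      ⟨(Q.le_start S j l).trans ht.1, ht.2.trans_le (Q.finish_le S j l)⟩
    by_cases hcoe : (s : UnitAddCircle) = (t : UnitAddCircle)
    · obtain ⟨rfl, e⟩ := Q.unique _ _ s hs' t ht' hcoe
      refine ⟨?_, rfl⟩
      -- The only side visited twice is `j`, by the pieces 0 and `m`; these are its two halves and
      -- share no parameter.
      have key : ∀ k l, k ≤ m → l ≤ m → S^[k] j = S^[l] j → s ∈ Ico (start a b S j k)
          (finish a b S j k) → s ∈ Ico (start a b S j l) (finish a b S j l) → k = m → k = l := by
        intro k l hk hl e hs ht hkm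
        by_contra hne
        have hlm : l < m := lt_of_le_of_ne hl fun h => hne (hkm.trans h.symm)
        have h0 : S^[l] j = S^[0] j := by
          rw [← e, hkm, hm, Function.iterate_minimalPeriod]
          rfl
        have hl0 : l = 0 := Function.iterate_injOn_Iio_minimalPeriod (f := S) (x := j)
          (mem_Iio.2 hlm) (mem_Iio.2 hp) h0
        have h1 := hs.2
        have h2 := ht.1
        rw [finish, if_pos hkm] at h1
        rw [start, if_pos hl0] at h2
        linarith
      rcases hk.lt_or_eq with h1 | h1
      · rcases hl.lt_or_eq with h2 | h2
        · exact Function.iterate_injOn_Iio_minimalPeriod (mem_Iio.2 h1) (mem_Iio.2 h2) e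
        · exact (key l k hl hk e.symm ht hs h2).symm
      · exact key k l hk hl e hs ht h1
    -- A coincidence of different points of the parameter circle is a crossing, so both parameters
    -- are initial points of sides of this circle, which `right_ne` forbids.
    · have hcr : IsCrossing γ s t := P.isCrossing_iff.2 ⟨hcoe, hst⟩
      have e1 : s = a (S^[k] j) := by
        by_contra hne
        exact disjoint_left.1 (Q.disjoint _) ⟨lt_of_le_of_ne hs'.1 (Ne.symm hne), hs'.2⟩ ⟨t, hcr⟩
      have e2 : t = a (S^[l] j) := by
        by_contra hne
        exact disjoint_left.1 (Q.disjoint _) ⟨lt_of_le_of_ne ht'.1 (Ne.symm hne), ht'.2⟩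
          ⟨s, PlaneLoop.isCrossing_symm hcr⟩
      rw [e1, e2] at hcr
      exact absurd hcr (Q.right_ne P (sameCycle_iterate S j k) (sameCycle_iterate S j l))

theorem Icc_subset_closure_circle (Q : IsSides γ a b σ τ) (P : PlaneLoop γ c c') {j k : ι}
    (h : (τ * σ).SameCycle j k) : Icc (a k) (b k) ⊆ closure (circle γ a b j) := by
  rw [← closure_Ioo (Q.lt k).ne]
  exact closure_mono (Q.Ioo_subset_circle P h)

/-- The dichotomy for a Seifert circle in terms of its sides. -/
theorem dichotomy (Q : IsSides γ a b σ τ) (P : PlaneLoop γ c c') {θ : ℝ → ℝ}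
    (hθ : AngleLift c' θ univ) (j : ι) {ν : ℝ}
    (hν : ∑ k ∈ Finset.range (Function.minimalPeriod (τ * σ) j), (fun i => θ (b i) - θ (a i) +
      (c' (a ((τ * σ) i)) / c' (b i)).arg) ((τ * σ)^[k] j) = ν * (2 * Real.pi)) :
    (ν = 1 ∧ ∀ t ∈ circle γ a b j,
      Bornology.IsBounded (leftComp c c' (c '' closure (circle γ a b j)) t) ∧
      ¬ Bornology.IsBounded (rightComp c c' (c '' closure (circle γ a b j)) t)) ∨
    (ν = -1 ∧ ∀ t ∈ circle γ a b j,
      ¬ Bornology.IsBounded (leftComp c c' (c '' closure (circle γ a b j)) t) ∧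
      Bornology.IsBounded (rightComp c c' (c '' closure (circle γ a b j)) t)) := by
  set S := τ * σ with hS
  set m := Function.minimalPeriod S j with hm
  have H := Q.piecewiseLoop P j
  have hlt := Q.start_lt_finish S j
  have hpos : ∀ k, 0 < finish a b S j k - start a b S j k := fun k => sub_pos.2 (hlt k)
  have hp : 0 < m := minimalPeriod_pos S j
  refine P.circle_dichotomy (Q.circle_mem j) H
    (θ := fun k u => θ (start a b S j k + (finish a b S j k - start a b S j k) * u))
    (fun k hk => ?_) ?_ (t₀ := mid a b j) ⟨Q.mid_notMem j, .refl _⟩ ?_ (hpos 0) ?_ ?_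
  · refine AngleLift.smul_pos (f := fun u => c' (start a b S j k +
      (finish a b S j k - start a b S j k) * u))
      (hθ.comp (φ := fun u => start a b S j k + (finish a b S j k - start a b S j k) * u)
      (by fun_prop) (mapsTo_univ _ _)) (r := fun _ => finish a b S j k - start a b S j k)
      (fun _ _ => (hpos k).le) fun u _ => ?_
    rw [chord_self]
  · rintro _ ⟨t, ht, rfl⟩
    have hk : ∃ k ≤ m, ∃ u ∈ Icc (0 : ℝ) 1, t = k + u := by
      rcases ht.2.lt_or_eq with h | h
      · refine ⟨⌊t⌋₊, Nat.lt_succ_iff.1 ((Nat.floor_lt ht.1).2 (by push_cast; exact h)),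
          t - ⌊t⌋₊, ⟨?_, ?_⟩, by ring⟩
        · linarith [Nat.floor_le ht.1]
        · linarith [Nat.lt_floor_add_one t]
      · exact ⟨m, le_rfl, 1, ⟨zero_le_one, le_rfl⟩, h⟩
    obtain ⟨k, hk, u, hu, rfl⟩ := hk
    rw [H.glue k hk u hu]
    refine ⟨_, Q.Icc_subset_closure_circle P (sameCycle_iterate S j k) ⟨?_, ?_⟩, rfl⟩
    · exact (Q.le_start S j k).trans (le_add_of_nonneg_right (mul_nonneg (hpos k).le hu.1))
    · refine le_trans ?_ (Q.finish_le S j k)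
      nlinarith [hpos k, hu.2]
  · have := H.glue 0 (Nat.zero_le _) 0 ⟨le_rfl, zero_le_one⟩
    rw [Nat.cast_zero, add_zero] at this
    rw [this, mul_zero, add_zero, start, if_pos rfl]
  · rw [chord_self, mul_zero, add_zero]
    rw [show start a b S j 0 = mid a b j by rw [start, if_pos rfl]]
  · rw [← hν, Finset.sum_add_distrib]
    congr 1
    · rw [← sum_finish_sub_start S j θ]
      refine Finset.sum_congr rfl fun k _ => ?_
      rw [mul_one, add_sub_cancel, mul_zero, add_zero]
    · refine Finset.sum_congr rfl fun k hk => ?_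
      have hk' := Finset.mem_range.1 hk
      rw [chord_self, chord_self, mul_zero, add_zero, mul_one, add_sub_cancel, mul_div_mul_comm,
        ← Complex.ofReal_div, Complex.arg_real_mul _ (div_pos (hpos _) (hpos _)), start,
        if_neg (Nat.succ_ne_zero k), finish, if_neg hk'.ne, Function.iterate_succ_apply']

end IsSides

/-- The region to the left of the Seifert circle `C` is bounded, the one to its right is not. -/
def LeftInside (c c' : ℝ → ℂ) (C : Set ℝ) : Prop :=
  ∀ t ∈ C, Bornology.IsBounded (leftComp c c' (c '' closure C) t) ∧
    ¬ Bornology.IsBounded (rightComp c c' (c '' closure C) t)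

/-- The region to the right of the Seifert circle `C` is bounded, the one to its left is not. -/
def RightInside (c c' : ℝ → ℂ) (C : Set ℝ) : Prop :=
  ∀ t ∈ C, ¬ Bornology.IsBounded (leftComp c c' (c '' closure C) t) ∧
    Bornology.IsBounded (rightComp c c' (c '' closure C) t)

theorem sum_ite_one_neg_one {α : Type*} (F : Finset α) (p q : α → Prop) [DecidablePred p]
    (h : ∀ x ∈ F, ¬ p x ↔ q x) :
    ∑ x ∈ F, (if p x then (1 : ℝ) else -1) =
      ({x ∈ (F : Set α) | p x}.ncard : ℝ) - ({x ∈ (F : Set α) | q x}.ncard : ℝ) := by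
  classical
  have e1 : {x ∈ (F : Set α) | p x} = (F.filter p : Finset α) := by
    ext x
    simp
  have e2 : {x ∈ (F : Set α) | q x} = (F.filter (fun x => ¬ p x) : Finset α) := by
    ext x
    simp only [Finset.coe_filter, mem_ofPred_eq, Finset.mem_coe]
    exact and_congr_right fun hx => (h x hx).symm
  rw [e1, e2, Set.ncard_coe_finset, Set.ncard_coe_finset, Finset.sum_ite]
  simp [sub_eq_add_neg]

/-- The rotation number of a plane curve counts its Seifert circles with their orientations. -/
theorem PlaneLoop.rotation_eq {γ : ℝ → Plane} {c c' : ℝ → ℂ} (P : PlaneLoop γ c c') {θ : ℝ → ℝ}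
    (hθ : AngleLift c' θ univ) {n : ℤ} (hn : θ 1 - θ 0 = n * (2 * Real.pi)) :
    (seifertCircles γ).Finite ∧ (∀ C ∈ seifertCircles γ, LeftInside c c' C ∨ RightInside c c' C) ∧
      n = ({C ∈ seifertCircles γ | LeftInside c c' C}.ncard : ℤ) -
        ({C ∈ seifertCircles γ | RightInside c c' C}.ncard : ℤ) := by
  classical
  obtain ⟨m, a, b, σ, τ, Q⟩ := P.exists_isSides
  set f := fun i => θ (b i) - θ (a i) + (c' (a ((τ * σ) i)) / c' (b i)).arg with hf
  set F : Finset (Set ℝ) := Finset.univ.image (IsSides.circle γ a b) with hF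
  have hFc : seifertCircles γ = F := by
    rw [Q.seifertCircles_eq_range P, hF]
    simp
  have hpi : (2 * Real.pi) ≠ 0 := by positivity
  have key : ∀ C ∈ F, (LeftInside c c' C ∨ RightInside c c' C) ∧
      (¬ LeftInside c c' C ↔ RightInside c c' C) ∧
      ∑ i with IsSides.circle γ a b i = C, f i =
        (if LeftInside c c' C then 1 else -1) * (2 * Real.pi) := by
    intro C hC
    obtain ⟨j, -, rfl⟩ := Finset.mem_image.1 hC
    have h1 : ∑ i with IsSides.circle γ a b i = IsSides.circle γ a b j, f i =
        ∑ k ∈ Finset.range (Function.minimalPeriod (τ * σ) j), f ((τ * σ)^[k] j) := by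
      rw [IsSides.sum_range_minimalPeriod]
      refine Finset.sum_congr (Finset.filter_congr fun i _ => ?_) fun _ _ => rfl
      rw [Q.circle_eq_circle_iff P, Equiv.Perm.sameCycle_comm]
    rw [h1]
    obtain ⟨t, ht⟩ := PlaneLoop.circle_nonempty (Q.circle_mem j)
    have hnot : ¬ (LeftInside c c' (IsSides.circle γ a b j) ∧
        RightInside c c' (IsSides.circle γ a b j)) := fun h => (h.2 t ht).1 (h.1 t ht).1
    -- No integrality is needed beforehand: the turning is divided by 2π, and the dichotomy itself
    -- shows that the quotient is 1 or -1.
    have h2 : ∑ k ∈ Finset.range (Function.minimalPeriod (τ * σ) j), f ((τ * σ)^[k] j) =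
        (∑ k ∈ Finset.range (Function.minimalPeriod (τ * σ) j), f ((τ * σ)^[k] j)) /
          (2 * Real.pi) * (2 * Real.pi) := (div_mul_cancel₀ _ hpi).symm
    rcases Q.dichotomy P hθ j h2 with ⟨h3, h4⟩ | ⟨h3, h4⟩
    · have hl : LeftInside c c' (IsSides.circle γ a b j) := h4
      have hr : ¬ RightInside c c' (IsSides.circle γ a b j) := fun h => hnot ⟨hl, h⟩
      refine ⟨Or.inl hl, by simp [hl, hr], ?_⟩
      rw [h2, h3, if_pos hl]
    · have hr : RightInside c c' (IsSides.circle γ a b j) := h4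
      have hl : ¬ LeftInside c c' (IsSides.circle γ a b j) := fun h => hnot ⟨h, hr⟩
      refine ⟨Or.inr hr, by simp [hl, hr], ?_⟩
      rw [h2, h3, if_neg hl]
  refine ⟨hFc ▸ F.finite_toSet, fun C hC => (key C (by rw [hFc] at hC; exact hC)).1, ?_⟩
  -- Over all sides the increments of the angle telescope to the whole turning and the exterior
  -- angles cancel. Regrouping the same sum by circles gives the signed count.
  have htot : ∑ i, f i = n * (2 * Real.pi) := by
    rw [hf, Finset.sum_add_distrib, Q.telescope θ, Q.sum_arg P, add_zero, hn]
  rw [← Finset.sum_fiberwise_of_maps_to (t := F) (g := IsSides.circle γ a b)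
    (fun i _ => Finset.mem_image_of_mem _ (Finset.mem_univ i)),
    Finset.sum_congr rfl fun C hC => (key C hC).2.2, ← Finset.sum_mul] at htot
  have h5 := mul_right_cancel₀ hpi htot
  rw [sum_ite_one_neg_one F _ _ fun C hC => (key C hC).2.1, ← hFc] at h5
  exact_mod_cast h5.symm

end SpiralIndex

namespace SpiralIndex

/-- Used to read the sign of the derivative next to a critical point from the sine of the angle
difference. -/
theorem cos_eq_of_cos_eq_zero {p q : ℝ} (h : Real.cos p = 0) :
    Real.cos q = -(Real.sin p * Real.sin (q - p)) := by
  conv_lhs => rw [show q = p + (q - p) by ring, Real.cos_add, h]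
  ring

/-! ### Maxima of functions whose derivative turns monotonically -/

section Maxima

variable {f ρ ψ : ℝ → ℝ}

theorem exists_sub_eq_mul_cos (hf : ∀ t, HasDerivAt f (ρ t * Real.cos (ψ t)) t) {x y : ℝ}
    (hxy : x < y) : ∃ z ∈ Ioo x y, f y - f x = ρ z * Real.cos (ψ z) * (y - x) := by
  obtain ⟨z, hz, h⟩ := exists_hasDerivAt_eq_slope f _ hxy
    (fun t _ => (hf t).continuousAt.continuousWithinAt) fun t _ => hf t
  exact ⟨z, hz, by rw [h, div_mul_cancel₀ _ (sub_pos.2 hxy).ne']⟩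

/-- If the angle increased, it would by continuity take a value larger by some `d` with 0 < d ≤ π/2,
where the cosine is not zero. -/
theorem eq_of_cos_eq_zero (hψ : Continuous ψ) (hm : Monotone ψ) {a b : ℝ}
    (h : ∀ x ∈ Icc a b, Real.cos (ψ x) = 0) {x : ℝ} (hx : x ∈ Icc a b) : ψ x = ψ a := by
  by_contra hne
  have hlt : ψ a < ψ x := lt_of_le_of_ne (hm hx.1) (Ne.symm hne)
  have hpi := Real.pi_pos
  set d := min (ψ x - ψ a) (Real.pi / 2) with hd
  have hd0 : 0 < d := lt_min (by linarith) (by linarith)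
  have hdx : d ≤ ψ x - ψ a := min_le_left _ _
  have hdpi : d ≤ Real.pi / 2 := min_le_right _ _
  obtain ⟨z, hz, hz2⟩ := intermediate_value_Icc hx.1 hψ.continuousOn
    (show ψ a + d ∈ Icc (ψ a) (ψ x) from ⟨by linarith, by linarith⟩)
  have ha := h a ⟨le_rfl, hx.1.trans hx.2⟩
  have h1 := h z ⟨hz.1, hz.2.trans hx.2⟩
  rw [cos_eq_of_cos_eq_zero ha, hz2, add_sub_cancel_left, neg_eq_zero, mul_eq_zero] at h1
  have h2 := Real.sin_pos_of_pos_of_lt_pi hd0 (by linarith)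
  have h3 := Real.sin_sq_add_cos_sq (ψ a)
  rcases h1 with h1 | h1
  · rw [h1, ha] at h3
    norm_num at h3
  · exact h2.ne' h1

/-- The starts of maxima are the points at which the angle arrives at a right angle. -/
theorem isMaximumStart_iff (hf : ∀ t, HasDerivAt f (ρ t * Real.cos (ψ t)) t) (hρ : ∀ t, 0 < ρ t)
    (hψ : Continuous ψ) (hm : Monotone ψ) {n : ℤ} (hn : ∀ t, ψ (t + 1) = ψ t + n * (2 * Real.pi))
    (a : ℝ) : IsMaximumStart f a ↔ Real.sin (ψ a) = 1 ∧ ∀ x < a, ψ x < ψ a := by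
  have hpi := Real.pi_pos
  constructor
  · rintro ⟨b, hab, hconst, hL, hR⟩
    have hcos : ∀ x ∈ Icc a b, Real.cos (ψ x) = 0 := by
      intro x hx
      refine (mul_eq_zero.1 ?_).resolve_left (hρ x).ne'
      rcases hab.lt_or_eq with h | rfl
      · have h1 : HasDerivWithinAt f 0 (Icc a b) x :=
          (hasDerivWithinAt_const x (Icc a b) (f a)).congr hconst (hconst x hx)
        exact (uniqueDiffOn_Icc h x hx).eq_deriv _ (hf x).hasDerivWithinAt h1
      · obtain rfl : x = a := le_antisymm hx.2 hx.1
        refine IsLocalMax.hasDerivAt_eq_zero ?_ (hf x)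
        rw [IsLocalMax, IsMaxFilter, ← nhdsLT_sup_nhdsGE, ← Ioi_insert, nhdsWithin_insert,
          eventually_sup, eventually_sup, eventually_pure]
        exact ⟨hL.mono fun _ h => h.le, le_rfl, hR.mono fun _ h => h.le⟩
    have ha := hcos a ⟨le_rfl, hab⟩
    have hb : ψ b = ψ a := eq_of_cos_eq_zero hψ hm hcos ⟨hab, le_rfl⟩
    have hfb := hconst b ⟨hab, le_rfl⟩
    have hsin : Real.sin (ψ a) = 1 := by
      have h3 := Real.sin_sq_add_cos_sq (ψ a)
      rw [ha] at h3
      have h4 : (Real.sin (ψ a) - 1) * (Real.sin (ψ a) + 1) = 0 := by linarith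
      rcases mul_eq_zero.1 h4 with h | h
      · linarith
      -- With sine -1 the point is a minimum in disguise: the angle increases further, and the
      -- function cannot decrease right after `b`.
      · exfalso
        have h5 : ∀ᶠ y in 𝓝[>] b, ψ y < ψ a + Real.pi :=
          nhdsWithin_le_nhds (hψ.continuousAt.eventually_lt_const (by rw [hb]; linarith))
        obtain ⟨y, ⟨hy1, hy2⟩, hy3⟩ := ((h5.and hR).and self_mem_nhdsWithin).exists
        obtain ⟨z, hz, hz2⟩ := exists_sub_eq_mul_cos hf hy3
        have h6 := hm hz.1.le
        have h7 := hm hz.2.le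
        rw [cos_eq_of_cos_eq_zero ha, show Real.sin (ψ a) = -1 by linarith] at hz2
        have h8 := Real.sin_nonneg_of_nonneg_of_le_pi (x := ψ z - ψ a) (by linarith) (by linarith)
        have h9 : 0 ≤ ρ z * -(-1 * Real.sin (ψ z - ψ a)) * (y - b) :=
          mul_nonneg (mul_nonneg (hρ z).le (by linarith)) (sub_nonneg.2 (le_of_lt hy3))
        linarith
    refine ⟨hsin, fun x hx => lt_of_le_of_ne (hm hx.le) fun he => ?_⟩
    obtain ⟨y, hy1, hy2⟩ := (hL.and (Ioo_mem_nhdsLT hx)).exists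
    obtain ⟨z, hz, hz2⟩ := exists_sub_eq_mul_cos hf hy2.2
    have e : ψ z = ψ a :=
      le_antisymm (hm hz.2.le) (he ▸ hm (hy2.1.trans hz.1).le)
    rw [e, ha] at hz2
    linarith
  · rintro ⟨hsin, hlt⟩
    have ha : Real.cos (ψ a) = 0 := by
      have h3 := Real.sin_sq_add_cos_sq (ψ a)
      rw [hsin] at h3
      exact pow_eq_zero_iff two_ne_zero |>.1 (by linarith)
    -- The strict increase up to `a`, moved by one period, shows that the angle leaves the value `ψ
    -- a` again; so the flat part is bounded.
    have hn1 : ψ a < ψ (a + 1) := by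
      have h1 := hlt (a - 1) (by linarith)
      have h2 := hn (a - 1)
      rw [sub_add_cancel] at h2
      linarith [hn a]
    -- Its supremum `b` is the last parameter with the angle `ψ a`, hence the end of the flat
    -- maximum.
    set T := {x | ψ x ≤ ψ a} with hT
    have haT : a ∈ T := le_refl (ψ a)
    have hbdd : BddAbove T := ⟨a + 1, fun x hx => by
      by_contra! h
      have : ψ x ≤ ψ a := hx
      linarith [hm h.le]⟩
    have hbT : sSup T ∈ T := (isClosed_le hψ continuous_const).csSup_mem ⟨a, haT⟩ hbdd
    have hab : a ≤ sSup T := le_csSup hbdd haT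
    set b := sSup T
    have hb : ψ b = ψ a := le_antisymm hbT (hm hab)
    have hbx : ∀ x, b < x → ψ a < ψ x := fun x hx => by
      by_contra! h
      exact hx.not_ge (le_csSup hbdd h)
    have hconst : ∀ x ∈ Icc a b, f x = f a := by
      intro x hx
      rcases hx.1.lt_or_eq with h | rfl
      · obtain ⟨z, hz, hz2⟩ := exists_sub_eq_mul_cos hf h
        have e : ψ z = ψ a :=
          le_antisymm (hb ▸ hm (hz.2.le.trans hx.2)) (hm hz.1.le)
        rw [e, ha] at hz2
        linarith
      · rfl
    refine ⟨b, hab, hconst, ?_, ?_⟩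
    · have h5 : ∀ᶠ y in 𝓝[<] a, ψ a - Real.pi < ψ y :=
        nhdsWithin_le_nhds (hψ.continuousAt.eventually_const_lt (by linarith))
      filter_upwards [h5, self_mem_nhdsWithin] with x hx1 hx2
      obtain ⟨z, hz, hz2⟩ := exists_sub_eq_mul_cos hf hx2
      rw [cos_eq_of_cos_eq_zero ha, hsin, one_mul, ← Real.sin_neg] at hz2
      have h8 := Real.sin_pos_of_pos_of_lt_pi (x := -(ψ z - ψ a)) (by linarith [hlt z hz.2])
        (by linarith [hm hz.1.le])
      have := mul_pos (mul_pos (hρ z) h8) (sub_pos.2 hx2)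
      linarith
    · have h5 : ∀ᶠ y in 𝓝[>] b, ψ y < ψ a + Real.pi :=
        nhdsWithin_le_nhds (hψ.continuousAt.eventually_lt_const (by rw [hb]; linarith))
      filter_upwards [h5, self_mem_nhdsWithin] with x hx1 hx2
      obtain ⟨z, hz, hz2⟩ := exists_sub_eq_mul_cos hf hx2
      rw [cos_eq_of_cos_eq_zero ha, hsin, one_mul, hconst b ⟨hab, le_rfl⟩] at hz2
      have h8 := Real.sin_pos_of_pos_of_lt_pi (x := ψ z - ψ a) (by linarith [hbx z hz.1])
        (by linarith [hm hz.2.le])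
      have := mul_pos (mul_pos (hρ z) h8) (sub_pos.2 hx2)
      linarith

theorem add_intCast_of_add_one {n : ℤ} {r : ℝ} (hn : ∀ t, ψ (t + 1) = ψ t + n * r) (t : ℝ)
    (j : ℤ) : ψ (t + j) = ψ t + j * n * r := by
  induction j using Int.induction_on with
  | zero => simp
  | succ j ih =>
    have := hn (t + j)
    push_cast at ih ⊢
    rw [← add_assoc, this, ih]
    ring
  | pred j ih =>
    have := hn (t + (-j - 1))
    push_cast at ih ⊢
    rw [show t + (-(j : ℝ) - 1) + 1 = t + -j by ring, ih] at this
    linarith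

/-- A function whose derivative turns monotonically `n` times in every period has `n` maxima. -/
theorem ncard_maxima (hf : ∀ t, HasDerivAt f (ρ t * Real.cos (ψ t)) t) (hρ : ∀ t, 0 < ρ t)
    (hψ : Continuous ψ) (hm : Monotone ψ) {n : ℤ}
    (hn : ∀ t, ψ (t + 1) = ψ t + n * (2 * Real.pi)) :
    ((fun t : ℝ => (t : UnitAddCircle)) '' {a | IsMaximumStart f a}).Finite ∧
      (((fun t : ℝ => (t : UnitAddCircle)) '' {a | IsMaximumStart f a}).ncard : ℤ) = n := by
  have hpi := Real.two_pi_pos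
  have hE : {a | IsMaximumStart f a} = {a | Real.sin (ψ a) = 1 ∧ ∀ x < a, ψ x < ψ a} :=
    Set.ext fun a => isMaximumStart_iff hf hρ hψ hm hn a
  rw [hE]
  have hn0 : 0 ≤ n := by
    by_contra! h
    have h1 := hn 0
    have h2 := hm (show (0 : ℝ) ≤ 0 + 1 by norm_num)
    have h3 : (n : ℝ) < 0 := by exact_mod_cast h
    nlinarith
  rcases hn0.eq_or_lt with h0 | hpos
  · have : {a | Real.sin (ψ a) = 1 ∧ ∀ x < a, ψ x < ψ a} = ∅ := by
      refine eq_empty_of_forall_notMem fun a ha => ?_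
      have h1 := ha.2 (a - 1) (by linarith)
      have h2 := hn (a - 1)
      rw [sub_add_cancel, ← h0] at h2
      push_cast at h2
      linarith
    rw [this]
    simp [h0.symm]
  · have hnr : (1 : ℝ) ≤ n := by exact_mod_cast hpos
    -- The angle is unbounded in both directions, so there is a first parameter at which it reaches
    -- the `k`-th right angle. These `A k` are all the maxima on the line.
    have hex : ∀ k : ℤ, ∃ a, ψ a = Real.pi / 2 + k * (2 * Real.pi) ∧ ∀ x < a, ψ x < ψ a := by
      intro k
      set y := Real.pi / 2 + k * (2 * Real.pi)
      have hlow : ∃ x, ψ x < y := by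
        obtain ⟨j, hj⟩ := exists_nat_gt ((ψ 0 - y) / (2 * Real.pi))
        refine ⟨0 + (-j : ℤ), ?_⟩
        rw [add_intCast_of_add_one hn]
        rw [div_lt_iff₀ hpi] at hj
        push_cast
        have : (j : ℝ) * 1 ≤ j * n := mul_le_mul_of_nonneg_left hnr (Nat.cast_nonneg j)
        nlinarith
      have hhigh : ∃ x, y < ψ x := by
        obtain ⟨j, hj⟩ := exists_nat_gt ((y - ψ 0) / (2 * Real.pi))
        refine ⟨0 + (j : ℤ), ?_⟩
        rw [add_intCast_of_add_one hn]
        rw [div_lt_iff₀ hpi] at hj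
        push_cast
        have : (j : ℝ) * 1 ≤ j * n := mul_le_mul_of_nonneg_left hnr (Nat.cast_nonneg j)
        nlinarith
      obtain ⟨x1, hx1⟩ := hlow
      obtain ⟨x2, hx2⟩ := hhigh
      set T := {x | y ≤ ψ x} with hT
      have hbdd : BddBelow T := ⟨x1, fun x hx => by
        by_contra! h
        have : y ≤ ψ x := hx
        linarith [hm h.le]⟩
      have haT : sInf T ∈ T := (isClosed_le continuous_const hψ).csInf_mem ⟨x2, hx2.le⟩ hbdd
      have hlt : ∀ x < sInf T, ψ x < y := fun x hx => by
        by_contra! h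
        exact hx.not_ge (csInf_le hbdd h)
      have he : ψ (sInf T) = y := by
        refine le_antisymm ?_ haT
        refine le_of_tendsto (hψ.continuousAt.tendsto.mono_left
          (nhdsWithin_le_nhds (s := Iio (sInf T)))) ?_
        filter_upwards [self_mem_nhdsWithin] with x hx using (hlt x hx).le
      exact ⟨sInf T, he, fun x hx => by rw [he]; exact hlt x hx⟩
    choose A hA1 hA2 using hex
    have hinj : ∀ k : ℤ, ∀ a, ψ a = Real.pi / 2 + k * (2 * Real.pi) → (∀ x < a, ψ x < ψ a) →
        a = A k := by
      intro k a h1 h2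
      by_contra hne
      rcases lt_or_gt_of_ne hne with h | h
      · have := hA2 k a h
        rw [hA1, h1] at this
        exact lt_irrefl _ this
      · have := h2 _ h
        rw [hA1, h1] at this
        exact lt_irrefl _ this
    -- One period raises the angle by `n` turns, so on the circle the maxima are indexed by `k`
    -- modulo `n`.
    have hshift : ∀ k j : ℤ, A (k + j * n) = A k + j := by
      intro k j
      refine (hinj _ _ ?_ fun x hx => ?_).symm
      · rw [add_intCast_of_add_one hn, hA1]
        push_cast
        ring
      · have h1 := hA2 k (x - j) (by linarith)
        have h2 := add_intCast_of_add_one hn (x - j) j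
        rw [sub_add_cancel] at h2
        rw [h2, add_intCast_of_add_one hn]
        linarith
    have himg : (fun t : ℝ => (t : UnitAddCircle)) '' {a | Real.sin (ψ a) = 1 ∧ ∀ x < a, ψ x < ψ a}
        = ((Finset.Ico 0 n).image fun k => ((A k : ℝ) : UnitAddCircle) : Set UnitAddCircle) := by
      rw [Finset.coe_image, Finset.coe_Ico]
      ext p
      constructor
      · rintro ⟨a, ⟨h1, h2⟩, rfl⟩
        obtain ⟨k, hk⟩ := Real.sin_eq_one_iff.1 h1
        refine ⟨k % n, ⟨Int.emod_nonneg k hpos.ne', Int.emod_lt_of_pos k hpos⟩, ?_⟩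
        have h3 := hshift (k % n) (k / n)
        rw [mul_comm, Int.emod_add_mul_ediv] at h3
        rw [hinj k a hk.symm h2, h3]
        exact (coe_add_intCast _ _).symm
      · rintro ⟨k, -, rfl⟩
        exact ⟨A k, ⟨Real.sin_eq_one_iff.2 ⟨k, (hA1 k).symm⟩, hA2 k⟩, rfl⟩
    rw [himg]
    refine ⟨Finset.finite_toSet _, ?_⟩
    rw [Set.ncard_coe_finset, Finset.card_image_of_injOn, Int.card_Ico, sub_zero,
      Int.toNat_of_nonneg hn0]
    intro k hk l hl hkl
    obtain ⟨j, hj⟩ := coe_unitAddCircle_eq_iff.1 hkl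
    rw [← hshift] at hj
    have h1 : (k : ℝ) * (2 * Real.pi) = (l + j * n : ℤ) * (2 * Real.pi) := by
      have := hA1 k
      rw [hj, hA1] at this
      linarith
    have h2 : k = l + j * n := by exact_mod_cast mul_right_cancel₀ hpi.ne' h1
    rw [Finset.coe_Ico] at hk hl
    have hj0 : j = 0 := by
      by_contra hne
      rcases lt_or_gt_of_ne hne with h | h
      · nlinarith [hk.1, hl.2]
      · nlinarith [hk.2, hl.1]
    rw [h2, hj0, zero_mul, add_zero]

end Maxima
end SpiralIndex

namespace SpiralIndex

/-! ### The plane as the complex line -/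

/-- The isometry of the Euclidean plane with the complex line. -/
noncomputable def toComplex : Plane ≃ₗᵢ[ℝ] ℂ := Complex.orthonormalBasisOneI.repr.symm

theorem toComplex_apply (x : Plane) : toComplex x = x 0 + x 1 * Complex.I :=
  Complex.orthonormalBasisOneI_repr_symm_apply x

@[simp] theorem toComplex_re (x : Plane) : (toComplex x).re = x 0 := by simp [toComplex_apply]

@[simp] theorem toComplex_im (x : Plane) : (toComplex x).im = x 1 := by simp [toComplex_apply]

theorem cross_toComplex (x y : Plane) : cross (toComplex x) (toComplex y) = det x y := by
  simp [cross, det]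

theorem toComplex_rot (x : Plane) : toComplex (rot x) = Complex.I * toComplex x := by
  apply Complex.ext <;> simp [rot]

theorem isBounded_image_toComplex {S : Set Plane} :
    Bornology.IsBounded (toComplex '' S) ↔ Bornology.IsBounded S := by
  refine ⟨fun h => ?_, fun h => toComplex.lipschitz.isBounded_image h⟩
  have := toComplex.symm.lipschitz.isBounded_image h
  rwa [← image_comp, show (toComplex.symm : ℂ → Plane) ∘ toComplex = id from
    funext toComplex.symm_apply_apply, image_id] at this

theorem isBounded_connectedComponentIn_iff {S : Set Plane} {p : Plane} (hp : p ∉ S) :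
    Bornology.IsBounded (connectedComponentIn Sᶜ p) ↔
      Bornology.IsBounded (connectedComponentIn (toComplex '' S)ᶜ (toComplex p)) := by
  have h := toComplex.toHomeomorph.image_connectedComponentIn (s := Sᶜ) hp
  have e : toComplex.toHomeomorph '' Sᶜ = (toComplex '' S)ᶜ :=
    image_compl_eq toComplex.bijective
  rw [e] at h
  rw [← isBounded_image_toComplex]
  exact iff_of_eq (congrArg _ h)

theorem not_inside_and_outside {S : Set Plane} {p : Plane} : ¬ (Inside S p ∧ Outside S p) :=
  fun h => h.2.2 h.1.2

/-! ### Curves in spiral form -/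

/-- A positive value followed by a negative one encloses a switch. With `b` the infimum of the later
negative parameters and `a` the supremum of the positive ones up to `b`, the curvature vanishes on
`[a, b]` and has both signs arbitrarily near. -/
theorem IsSpiralForm.curvature_nonneg_or_nonpos {γ : ℝ → Plane} (h : IsSpiralForm γ)
    (hc : Continuous (curvature γ)) (hp : Function.Periodic (curvature γ) 1) :
    (∀ t, 0 ≤ curvature γ t) ∨ ∀ t, curvature γ t ≤ 0 := by
  by_contra! hcon
  obtain ⟨⟨q', hq'⟩, p, hp0⟩ := hcon
  set κ := curvature γ with hκ
  -- Periodicity moves the negative value to the right of the positive one.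
  obtain ⟨q, hpq, hq⟩ : ∃ q, p < q ∧ κ q < 0 := by
    obtain ⟨n, hn⟩ := exists_nat_gt (p - q')
    refine ⟨q' + n, by linarith, ?_⟩
    have := hp.nat_mul n q'
    rw [mul_one] at this
    rwa [this]
  set T := {x | p ≤ x ∧ κ x < 0} with hT
  have hTb : BddBelow T := ⟨p, fun x hx => hx.1⟩
  have hTq : q ∈ T := ⟨hpq.le, hq⟩
  set b := sInf T with hb
  have hpb : p ≤ b := le_csInf ⟨q, hTq⟩ fun x hx => hx.1
  have hnonneg : ∀ x, p ≤ x → x < b → 0 ≤ κ x := fun x h1 h2 => by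
    by_contra! h3
    exact h2.not_ge (csInf_le hTb ⟨h1, h3⟩)
  have hbT : ∀ ε > 0, ∃ x ∈ Ico b (b + ε), κ x < 0 := by
    intro ε hε
    obtain ⟨x, hx, hx2⟩ := exists_lt_of_csInf_lt ⟨q, hTq⟩ (show sInf T < b + ε by linarith)
    exact ⟨x, ⟨csInf_le hTb hx, hx2⟩, hx.2⟩
  have hb0 : κ b ≤ 0 := by
    by_contra! h1
    obtain ⟨ε, hε, h2⟩ := Metric.eventually_nhds_iff.1 (hc.continuousAt.eventually_const_lt h1)
    obtain ⟨x, hx, hx2⟩ := hbT ε hε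
    have := h2 (y := x) (by
      rw [Real.dist_eq, abs_lt]
      constructor <;> linarith [hx.1, hx.2])
    linarith
  have hpb' : p < b := lt_of_le_of_ne hpb fun h => by
    rw [← h] at hb0
    linarith
  set U := {x | x ≤ b ∧ 0 < κ x} with hU
  have hUb : BddAbove U := ⟨b, fun x hx => hx.1⟩
  have hUp : p ∈ U := ⟨hpb, hp0⟩
  set a := sSup U with ha
  have hab : a ≤ b := csSup_le ⟨p, hUp⟩ fun x hx => hx.1
  have hpa : p ≤ a := le_csSup hUb hUp
  have hnonpos : ∀ x, a < x → x ≤ b → κ x ≤ 0 := fun x h1 h2 => by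
    by_contra! h3
    exact h1.not_ge (le_csSup hUb ⟨h2, h3⟩)
  have haU : ∀ ε > 0, ∃ x ∈ Ioc (a - ε) a, 0 < κ x := by
    intro ε hε
    obtain ⟨x, hx, hx2⟩ := exists_lt_of_lt_csSup ⟨p, hUp⟩ (show a - ε < sSup U by linarith)
    exact ⟨x, ⟨hx2, le_csSup hUb hx⟩, hx.2⟩
  have hb1 : 0 ≤ κ b := by
    refine ge_of_tendsto (hc.continuousAt.tendsto.mono_left
      (nhdsWithin_le_nhds (s := Iio b))) ?_
    filter_upwards [Ioo_mem_nhdsLT hpb'] with x hx using hnonneg x hx.1.le hx.2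
  have ha1 : κ a ≤ 0 := by
    rcases hab.lt_or_eq with h1 | h1
    · refine le_of_tendsto (hc.continuousAt.tendsto.mono_left
        (nhdsWithin_le_nhds (s := Ioi a))) ?_
      filter_upwards [Ioo_mem_nhdsGT h1] with x hx using hnonpos x hx.1 hx.2.le
    · rw [h1]
      exact hb0
  refine h a ⟨a, b, le_rfl, hab, fun x hx => le_antisymm ?_ ?_, fun ε hε => ⟨?_, ?_⟩⟩
  · rcases hx.1.lt_or_eq with h1 | rfl
    · exact hnonpos x h1 hx.2
    · exact ha1
  · rcases hx.2.lt_or_eq with h1 | h1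
    · exact hnonneg x (hpa.trans hx.1) h1
    · rw [h1]
      exact hb1
  · obtain ⟨x, hx, hx2⟩ := haU ε hε
    exact ⟨x, ⟨hx.1, by linarith [hx.2]⟩, hx2⟩
  · obtain ⟨x, hx, hx2⟩ := hbT ε hε
    exact ⟨x, ⟨by linarith [hx.1], hx.2⟩, hx2⟩

/-! ### The tangent angle -/

/-- A nowhere vanishing differentiable function has a differentiable angle. -/
theorem exists_angleLift_hasDerivAt {f f' : ℝ → ℂ} (hf : ∀ t, HasDerivAt f (f' t) t)
    (hf' : Continuous f') (h0 : ∀ t, f t ≠ 0) :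
    ∃ θ : ℝ → ℝ, AngleLift f θ univ ∧ ∀ t, HasDerivAt θ (f' t / f t).im t := by
  have hcont : Continuous f := continuous_iff_continuousAt.2 fun t => (hf t).continuousAt
  have hq : Continuous fun t => f' t / f t := hf'.div hcont h0
  -- A logarithm of `f`, obtained by integrating its logarithmic derivative; its imaginary part is
  -- the angle.
  set L : ℝ → ℂ := fun t => Complex.log (f 0) + ∫ s in (0 : ℝ)..t, f' s / f s with hL
  have hLd : ∀ t, HasDerivAt L (f' t / f t) t := fun t =>
    (intervalIntegral.integral_hasDerivAt_right (hq.intervalIntegrable _ _)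
      (hq.stronglyMeasurableAtFilter _ _) hq.continuousAt).const_add _
  have hexp : ∀ t, f t = Complex.exp (L t) := by
    have h1 : ∀ t, HasDerivAt (fun t => f t * Complex.exp (-L t)) 0 t := by
      intro t
      have := (hf t).mul (hLd t).neg.cexp
      convert! this using 1
      field_simp [h0 t]
      ring
    intro t
    have h2 := is_const_of_deriv_eq_zero (fun t => (h1 t).differentiableAt)
      (fun t => (h1 t).deriv) t 0
    simp only [hL, intervalIntegral.integral_same, add_zero, Complex.exp_neg,
      Complex.exp_log (h0 0), mul_inv_cancel₀ (h0 0)] at h2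
    rw [← div_eq_mul_inv, div_eq_one_iff_eq (Complex.exp_ne_zero _)] at h2
    exact h2
  refine ⟨fun t => (L t).im, ⟨?_, fun t _ => ?_⟩, fun t => ?_⟩
  · have : Continuous L := continuous_iff_continuousAt.2 fun t => (hLd t).continuousAt
    exact (Complex.continuous_im.comp this).continuousOn
  · rw [hexp t, Complex.norm_exp, Complex.ofReal_exp, ← Complex.exp_add, Complex.re_add_im]
  · exact (Complex.imCLM.hasFDerivAt.comp_hasDerivAt t (hLd t))

theorem re_mul_conj_eq {z w : ℂ} {θ : ℝ} (hz : z = ‖z‖ * Complex.exp (θ * Complex.I))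
    (hw : ‖w‖ = 1) : z.re * w.re + z.im * w.im = ‖z‖ * Real.cos (θ - w.arg) := by
  have e1 : z.re = ‖z‖ * Real.cos θ := by
    conv_lhs => rw [hz]
    rw [Complex.re_ofReal_mul, Complex.exp_ofReal_mul_I_re]
  have e2 : z.im = ‖z‖ * Real.sin θ := by
    conv_lhs => rw [hz]
    rw [Complex.im_ofReal_mul, Complex.exp_ofReal_mul_I_im]
  have hw0 : w ≠ 0 := norm_pos_iff.1 (by rw [hw]; exact one_pos)
  rw [e1, e2, Real.cos_sub, Complex.cos_arg hw0, Complex.sin_arg, hw]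
  ring

end SpiralIndex

namespace SpiralIndex

variable {γ : ℝ → Plane}

/-! ### Smooth closed plane curves -/

theorem hasDerivAt_toComplex {f : ℝ → Plane} (hf : Differentiable ℝ f) (t : ℝ) :
    HasDerivAt (fun t => toComplex (f t)) (toComplex (deriv f t)) t :=
  toComplex.toContinuousLinearEquiv.hasFDerivAt.comp_hasDerivAt t (hf t).hasDerivAt

theorem IsRegularProjection.planeLoop (hreg : IsRegularProjection γ) (hs : ContDiff ℝ ∞ γ)
    (hp : Function.Periodic γ 1) :
    PlaneLoop γ (fun t => toComplex (γ t)) (fun t => toComplex (deriv γ t)) where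
  eq_iff s t := toComplex.injective.eq_iff
  deriv := hasDerivAt_toComplex (hs.differentiable (by simp))
  cont_deriv := toComplex.continuous.comp (hs.continuous_deriv (by simp))
  periodic t := congrArg toComplex (hp t)
  regular t := by simpa using hreg.immersed t
  transverse s t h := by
    rw [cross_toComplex]
    exact hreg.transverse s t h
  double := hreg.double
  finite := hreg.finite

/-- The imaginary part of the logarithmic derivative of the velocity is the rate of turning of the
tangent, so the sign of the curvature controls the monotonicity of the angle. -/
theorem curvature_eq (hreg : IsRegularProjection γ) (t : ℝ) :
    (toComplex (deriv (deriv γ) t) / toComplex (deriv γ t)).im =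
      curvature γ t * ‖deriv γ t‖ := by
  have h0 : toComplex (deriv γ t) ≠ 0 := by simpa using hreg.immersed t
  have hn : ‖deriv γ t‖ ≠ 0 := norm_ne_zero_iff.2 (hreg.immersed t)
  have h1 : Complex.normSq (toComplex (deriv γ t)) = ‖deriv γ t‖ ^ 2 := by
    rw [Complex.normSq_eq_norm_sq, LinearIsometryEquiv.norm_map]
  rw [Complex.div_im, h1, curvature, det]
  simp only [toComplex_re, toComplex_im]
  field_simp

theorem continuous_curvature (hreg : IsRegularProjection γ) (hs : ContDiff ℝ ∞ γ) :
    Continuous (curvature γ) := by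
  have h1 : ContDiff ℝ ∞ (deriv γ) := hs.deriv'
  have h2 : Continuous (deriv (deriv γ)) := h1.continuous_deriv (by simp)
  have h3 := h1.continuous
  refine Continuous.div ?_ (h3.norm.pow 3)
    fun t => pow_ne_zero _ (norm_ne_zero_iff.2 (hreg.immersed t))
  unfold det
  fun_prop

theorem periodic_deriv_of_periodic {f : ℝ → Plane} (hp : Function.Periodic f 1) :
    Function.Periodic (deriv f) 1 := by
  intro t
  rw [← deriv_comp_add_const, funext hp]

theorem periodic_curvature (hp : Function.Periodic γ 1) : Function.Periodic (curvature γ) 1 := by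
  have h1 := periodic_deriv_of_periodic hp
  have h2 := periodic_deriv_of_periodic h1
  intro t
  rw [curvature, curvature, h1 t, h2 t]

/-- The tangent angle of a smooth closed curve and its rotation number. -/
theorem exists_tangentAngle (hreg : IsRegularProjection γ) (hs : ContDiff ℝ ∞ γ)
    (hp : Function.Periodic γ 1) :
    ∃ (θ : ℝ → ℝ) (n : ℤ), AngleLift (fun t => toComplex (deriv γ t)) θ univ ∧
      (∀ t, HasDerivAt θ (curvature γ t * ‖deriv γ t‖) t) ∧
      ∀ t, θ (t + 1) = θ t + n * (2 * Real.pi) := by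
  have h1 : ContDiff ℝ ∞ (deriv γ) := hs.deriv'
  have P := hreg.planeLoop hs hp
  obtain ⟨θ, hθ, hθd⟩ := exists_angleLift_hasDerivAt
    (hasDerivAt_toComplex (h1.differentiable (by simp)))
    (toComplex.continuous.comp (h1.continuous_deriv (by simp))) P.regular
  simp only [curvature_eq hreg] at hθd
  obtain ⟨n, hn⟩ := hθ.exp_eq (mem_univ 1) (mem_univ 0)
    (by simpa using P.periodic_deriv 0) (P.regular 1)
  refine ⟨θ, n, hθ, hθd, fun t => ?_⟩
  have hd : ∀ t, HasDerivAt (fun t => θ (t + 1) - θ t) 0 t := by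
    intro t
    have := ((hθd (t + 1)).comp_add_const t 1).sub (hθd t)
    rwa [periodic_curvature hp, periodic_deriv_of_periodic hp, sub_self] at this
  have := is_const_of_deriv_eq_zero (fun t => (hd t).differentiableAt)
    (fun t => (hd t).deriv) t 0
  simp only [zero_add] at this
  linarith

/-- The derivative of the height in the direction `w` in terms of the tangent angle. -/
theorem hasDerivAt_inner (hs : ContDiff ℝ ∞ γ) {θ : ℝ → ℝ}
    (hθ : AngleLift (fun t => toComplex (deriv γ t)) θ univ) {w : Plane} (hw : ‖w‖ = 1) (t : ℝ) :
    HasDerivAt (fun t => inner ℝ (γ t) w)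
      (‖toComplex (deriv γ t)‖ * Real.cos (θ t - (toComplex w).arg)) t := by
  have h1 := ((hs.differentiable (by simp)) t).hasDerivAt.inner ℝ (hasDerivAt_const t w)
  have h2 := re_mul_conj_eq (hθ.2 t (mem_univ t)) ((toComplex.norm_map w).trans hw)
  rw [← h2]
  convert! h1 using 1
  simp [PiLp.inner_apply, Fin.sum_univ_two]
  ring

/-- A closed curve is curved somewhere. -/
theorem exists_curvature_ne_zero (hreg : IsRegularProjection γ) (hs : ContDiff ℝ ∞ γ)
    (hp : Function.Periodic γ 1) : ∃ s, curvature γ s ≠ 0 := by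
  by_contra! h
  obtain ⟨θ, n, hθ, hθd, -⟩ := exists_tangentAngle hreg hs hp
  have hconst : ∀ t, θ t = θ 0 := fun t => is_const_of_deriv_eq_zero
    (fun t => (hθd t).differentiableAt) (fun t => by rw [(hθd t).deriv, h, zero_mul]) t 0
  -- Were the tangent angle constant, the height in this direction would have the speed as its
  -- derivative, although a closed curve returns to its initial height.
  set w : Plane := toComplex.symm (Complex.exp (θ 0 * Complex.I)) with hw
  have hw1 : ‖w‖ = 1 := by
    rw [hw, LinearIsometryEquiv.norm_map, Complex.norm_exp_ofReal_mul_I]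
  have harg : Real.cos (θ 0 - (toComplex w).arg) = 1 := by
    rw [hw, LinearIsometryEquiv.apply_symm_apply, Complex.arg_exp_mul_I,
      Real.cos_eq_one_iff]
    refine ⟨toIocDiv Real.two_pi_pos (-Real.pi) (θ 0), ?_⟩
    rw [← self_sub_toIocDiv_zsmul, zsmul_eq_mul]
    ring
  obtain ⟨z, -, hz⟩ := exists_hasDerivAt_eq_slope (fun t => inner ℝ (γ t) w) _ zero_lt_one
    (fun t _ => (hasDerivAt_inner hs hθ hw1 t).continuousAt.continuousWithinAt)
    fun t _ => hasDerivAt_inner hs hθ hw1 t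
  have h1 : γ 1 = γ 0 := by simpa using hp 0
  rw [hconst, harg, mul_one, h1, sub_self, zero_div, norm_eq_zero] at hz
  exact (hreg.planeLoop hs hp).regular z hz

/-! ### The two kinds of Seifert circles -/

theorem toComplex_image_trace (γ : ℝ → Plane) (C : Set ℝ) :
    toComplex '' trace γ C = (fun t => toComplex (γ t)) '' closure C := by
  rw [trace, image_image]

theorem inside_of_isBounded {C : Set ℝ} {p : Plane} {A : Set ℂ}
    (hp : toComplex p ∉ range fun t => toComplex (γ t))
    (hA : connectedComponentIn ((fun t => toComplex (γ t)) '' closure C)ᶜ (toComplex p) = A) :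
    (Bornology.IsBounded A → Inside (trace γ C) p) ∧
      (¬ Bornology.IsBounded A → Outside (trace γ C) p) := by
  have h1 : p ∉ trace γ C := by
    rintro ⟨t, -, rfl⟩
    exact hp ⟨t, rfl⟩
  rw [← hA, ← toComplex_image_trace, ← isBounded_connectedComponentIn_iff h1]
  exact ⟨fun h => ⟨h1, h⟩, fun h => ⟨h1, h⟩⟩

/-- Rotation of the tangent by a right angle is multiplication by `I` and points left, so the sign
of `μ` selects the region entered. -/
theorem eventually_side (P : PlaneLoop γ (fun t => toComplex (γ t))
    (fun t => toComplex (deriv γ t))) {C : Set ℝ} (hC : C ∈ seifertCircles γ) {t : ℝ} (ht : t ∈ C)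
    {μ : ℝ} {A : Set ℂ}
    (hA : (0 < μ ∧ A = leftComp (fun t => toComplex (γ t)) (fun t => toComplex (deriv γ t))
        ((fun t => toComplex (γ t)) '' closure C) t) ∨
      (μ < 0 ∧ A = rightComp (fun t => toComplex (γ t)) (fun t => toComplex (deriv γ t))
        ((fun t => toComplex (γ t)) '' closure C) t)) :
    (Bornology.IsBounded A →
      ∀ᶠ ε in 𝓝[>] (0 : ℝ), Inside (trace γ C) (γ t + ε • μ • rot (deriv γ t))) ∧
    (¬ Bornology.IsBounded A →
      ∀ᶠ ε in 𝓝[>] (0 : ℝ), Outside (trace γ C) (γ t + ε • μ • rot (deriv γ t))) := by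
  have hS : (fun t => toComplex (γ t)) '' closure C ⊆ range fun t => toComplex (γ t) :=
    image_subset_range _ _
  have htX := PlaneLoop.notMem_of_mem_circle hC ht
  have hq : ∀ ε : ℝ, toComplex (γ t + ε • μ • rot (deriv γ t)) =
      toComplex (γ t) + ε * (μ * (Complex.I * toComplex (deriv γ t))) := by
    intro ε
    rw [map_add, map_smul, map_smul, toComplex_rot, Complex.real_smul, Complex.real_smul]
  have hcr : cross (toComplex (deriv γ t)) (μ * (Complex.I * toComplex (deriv γ t))) =
      μ * cross (toComplex (deriv γ t)) (Complex.I * toComplex (deriv γ t)) := by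
    simp only [cross, Complex.re_ofReal_mul, Complex.im_ofReal_mul]
    ring
  have hpos := cross_self_I_mul (P.regular t)
  have key : ∀ᶠ ε : ℝ in 𝓝[>] 0, toComplex (γ t + ε • μ • rot (deriv γ t)) ∉
      (range fun t => toComplex (γ t)) ∧
      connectedComponentIn ((fun t => toComplex (γ t)) '' closure C)ᶜ
        (toComplex (γ t + ε • μ • rot (deriv γ t))) = A := by
    simp only [hq]
    rcases hA with ⟨h1, rfl⟩ | ⟨h1, rfl⟩
    · exact P.eventually_comp_eq_leftComp hS htX
        (q := fun ε => toComplex (γ t) + ε * (μ * (Complex.I * toComplex (deriv γ t))))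
        (by simp) (hasDerivWithinAt_add_mul _ _ _ _) (by rw [hcr]; exact mul_pos h1 hpos)
    · exact P.eventually_comp_eq_rightComp hS htX
        (q := fun ε => toComplex (γ t) + ε * (μ * (Complex.I * toComplex (deriv γ t))))
        (by simp) (hasDerivWithinAt_add_mul _ _ _ _)
        (by rw [hcr]; exact mul_neg_of_neg_of_pos h1 hpos)
  exact ⟨fun h => key.mono fun ε hε => (inside_of_isBounded hε.1 hε.2).1 h,
    fun h => key.mono fun ε hε => (inside_of_isBounded hε.1 hε.2).2 h⟩

/-- Guarantees that the conditions for o- and i-circles are not vacuous, even for a circle with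
straight sides only; without it a circle might be both. -/
theorem exists_curvesToward {C : Set ℝ} (hne : C.Nonempty) (hκ : ∃ s, curvature γ s ≠ 0) :
    ∃ t ∈ C, ∃ w, CurvesToward γ C t w := by
  by_cases h : ∀ u ∈ C, curvature γ u = 0
  · obtain ⟨t, ht⟩ := hne
    obtain ⟨s, hs⟩ := hκ
    exact ⟨t, ht, _, Or.inr ⟨h, s, hs, rfl⟩⟩
  · push Not at h
    obtain ⟨t, ht, h⟩ := h
    exact ⟨t, ht, _, Or.inl ⟨h, rfl⟩⟩

theorem CurvesToward.exists_eq {C : Set ℝ} {t : ℝ} {w : Plane} (h : CurvesToward γ C t w) :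
    ∃ s, curvature γ s ≠ 0 ∧ w = curvature γ s • rot (deriv γ t) := by
  rcases h with ⟨h1, h2⟩ | ⟨-, s, h1, h2⟩
  · exact ⟨t, h1, h2⟩
  · exact ⟨s, h1, h2⟩

theorem not_isOCircle_and_isICircle {C : Set ℝ} (hne : C.Nonempty)
    (hκ : ∃ s, curvature γ s ≠ 0) : ¬ (IsOCircle γ C ∧ IsICircle γ C) := by
  rintro ⟨ho, hi⟩
  obtain ⟨t, ht, w, hw⟩ := exists_curvesToward hne hκ
  obtain ⟨ε, hε⟩ := ((ho t ht w hw).and (hi t ht w hw)).exists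
  exact not_inside_and_outside hε

/-- The vector to which a circle curves is always a nonzero value of the curvature times the left
normal, also by the convention for straight sides. So the left region alone decides the type. -/
theorem classify_of_nonneg (P : PlaneLoop γ (fun t => toComplex (γ t))
    (fun t => toComplex (deriv γ t))) (hκ : ∀ t, 0 ≤ curvature γ t) {C : Set ℝ}
    (hC : C ∈ seifertCircles γ) :
    (LeftInside (fun t => toComplex (γ t)) (fun t => toComplex (deriv γ t)) C → IsOCircle γ C) ∧
    (RightInside (fun t => toComplex (γ t)) (fun t => toComplex (deriv γ t)) C →
      IsICircle γ C) := by
  constructor <;> intro h t ht w hw <;> obtain ⟨s, hs, rfl⟩ := hw.exists_eq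
  · exact (eventually_side P hC ht (Or.inl ⟨lt_of_le_of_ne (hκ s) hs.symm, rfl⟩)).1 (h t ht).1
  · exact (eventually_side P hC ht (Or.inl ⟨lt_of_le_of_ne (hκ s) hs.symm, rfl⟩)).2 (h t ht).1

theorem classify_of_nonpos (P : PlaneLoop γ (fun t => toComplex (γ t))
    (fun t => toComplex (deriv γ t))) (hκ : ∀ t, curvature γ t ≤ 0) {C : Set ℝ}
    (hC : C ∈ seifertCircles γ) :
    (RightInside (fun t => toComplex (γ t)) (fun t => toComplex (deriv γ t)) C →
      IsOCircle γ C) ∧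
    (LeftInside (fun t => toComplex (γ t)) (fun t => toComplex (deriv γ t)) C →
      IsICircle γ C) := by
  constructor <;> intro h t ht w hw <;> obtain ⟨s, hs, rfl⟩ := hw.exists_eq
  · exact (eventually_side P hC ht (Or.inr ⟨lt_of_le_of_ne (hκ s) hs, rfl⟩)).1 (h t ht).2
  · exact (eventually_side P hC ht (Or.inr ⟨lt_of_le_of_ne (hκ s) hs, rfl⟩)).2 (h t ht).2

/-- The implications from sides to types reverse, since the sides exhaust all cases and the types
exclude each other. -/
theorem sep_eq_of_dichotomy {α : Type*} {F : Set α} {p q o i : α → Prop}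
    (h1 : ∀ x ∈ F, p x → o x) (h2 : ∀ x ∈ F, q x → i x) (h3 : ∀ x ∈ F, p x ∨ q x)
    (h4 : ∀ x ∈ F, ¬ (o x ∧ i x)) :
    {x ∈ F | o x} = {x ∈ F | p x} ∧ {x ∈ F | i x} = {x ∈ F | q x} := by
  constructor <;> ext x <;> refine and_congr_right fun hx => ⟨fun h => ?_, fun h => ?_⟩
  · exact (h3 x hx).resolve_right fun hq => h4 x hx ⟨h, h2 x hx hq⟩
  · exact h1 x hx h
  · exact (h3 x hx).resolve_left fun hp => h4 x hx ⟨h1 x hx hp, h⟩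
  · exact h2 x hx h

/-- The spiral number of a smooth closed plane curve in spiral form is the number of its o-circles
minus the number of its i-circles. -/
theorem spiral_index (hreg : IsRegularProjection γ) (hspiral : IsSpiralForm γ)
    (hs : ContDiff ℝ ∞ γ) (hp : Function.Periodic γ 1) :
    (seifertCircles γ).Finite ∧
    (∀ C ∈ seifertCircles γ, (IsOCircle γ C ∨ IsICircle γ C) ∧
      ¬ (IsOCircle γ C ∧ IsICircle γ C)) ∧
    ∀ w : Plane, ‖w‖ = 1 → (maxima γ w).Finite ∧
      ((maxima γ w).ncard : ℤ) = ({C ∈ seifertCircles γ | IsOCircle γ C}.ncard : ℤ) -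
        ({C ∈ seifertCircles γ | IsICircle γ C}.ncard : ℤ) := by
  have P := hreg.planeLoop hs hp
  obtain ⟨θ, n, hθ, hθd, hn⟩ := exists_tangentAngle hreg hs hp
  obtain ⟨hfin, hdich, hcount⟩ := P.rotation_eq hθ (n := n) (by
    have := hn 0
    rw [zero_add] at this
    linarith)
  have hκ0 := exists_curvature_ne_zero hreg hs hp
  have hnot : ∀ C ∈ seifertCircles γ, ¬ (IsOCircle γ C ∧ IsICircle γ C) := fun C hC =>
    not_isOCircle_and_isICircle (PlaneLoop.circle_nonempty hC) hκ0
  have hθc : Continuous θ := continuous_iff_continuousAt.2 fun t => (hθd t).continuousAt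
  have hρ : ∀ t, 0 < ‖toComplex (deriv γ t)‖ := fun t => norm_pos_iff.2 (P.regular t)
  refine ⟨hfin, ?_⟩
  rcases hspiral.curvature_nonneg_or_nonpos (continuous_curvature hreg hs) (periodic_curvature hp)
    with hκ | hκ
  · have hcl := fun C hC => classify_of_nonneg P hκ (C := C) hC
    refine ⟨fun C hC => ⟨(hdich C hC).imp (hcl C hC).1 (hcl C hC).2, hnot C hC⟩, fun w hw => ?_⟩
    obtain ⟨e1, e2⟩ := sep_eq_of_dichotomy (fun C hC => (hcl C hC).1) (fun C hC => (hcl C hC).2)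
      hdich hnot
    have hm : Monotone fun t => θ t - (toComplex w).arg := fun x y hxy => sub_le_sub_right
      (monotone_of_hasDerivAt_nonneg hθd
        (fun t => mul_nonneg (hκ t) (norm_nonneg _)) hxy) _
    rw [e1, e2, ← hcount]
    exact ncard_maxima (hasDerivAt_inner hs hθ hw) hρ (by fun_prop) hm
      fun t => by rw [hn]; ring
  · have hcl := fun C hC => classify_of_nonpos P hκ (C := C) hC
    refine ⟨fun C hC => ⟨(hdich C hC).symm.imp (hcl C hC).1 (hcl C hC).2, hnot C hC⟩,
      fun w hw => ?_⟩
    obtain ⟨e1, e2⟩ := sep_eq_of_dichotomy (fun C hC => (hcl C hC).1) (fun C hC => (hcl C hC).2)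
      (fun C hC => (hdich C hC).symm) hnot
    -- For nonpositive curvature the reflected angle increases and turns `-n` times; the cosine is
    -- even, so the height has the same derivative. The sign agrees with the exchanged roles of the
    -- circles.
    have hm : Monotone fun t => (toComplex w).arg - θ t := fun x y hxy => sub_le_sub_left
      (antitone_of_hasDerivAt_nonpos hθd
        (fun t => mul_nonpos_of_nonpos_of_nonneg (hκ t) (norm_nonneg _)) hxy) _
    have hd : ∀ t, HasDerivAt (fun t => inner ℝ (γ t) w)
        (‖toComplex (deriv γ t)‖ * Real.cos ((toComplex w).arg - θ t)) t := by
      intro t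
      rw [← Real.cos_neg, neg_sub]
      exact hasDerivAt_inner hs hθ hw t
    rw [e1, e2, ← neg_sub, ← hcount]
    exact ncard_maxima hd hρ (by fun_prop) hm
      fun t => by rw [hn]; push_cast; ring

/-! ### Projections of knots -/

theorem Knot.contDiff_projection (K : Knot) (v : Space)
    (b : OrthonormalBasis (Fin 2) ℝ (Submodule.span ℝ {v})ᗮ) :
    ContDiff ℝ ∞ (K.projection v b) :=
  b.repr.contDiff.comp
    ((Submodule.span ℝ {v})ᗮ.orthogonalProjectionOnto.contDiff.comp K.smooth)

theorem Knot.periodic_projection (K : Knot) (v : Space)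
    (b : OrthonormalBasis (Fin 2) ℝ (Submodule.span ℝ {v})ᗮ) :
    Function.Periodic (K.projection v b) 1 := fun t => by
  rw [Knot.projection, Knot.projection, K.periodic]

end SpiralIndex

theorem mainTheorem3 (K : SpiralIndex.Knot) (v : SpiralIndex.Space) (hv : ‖v‖ = 1)
    (b : OrthonormalBasis (Fin 2) ℝ (Submodule.span ℝ {v})ᗮ)
    (hreg : SpiralIndex.IsRegularProjection (K.projection v b))
    (hspiral : SpiralIndex.IsSpiralForm (K.projection v b)) :
    (SpiralIndex.seifertCircles (K.projection v b)).Finite ∧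
    (∀ C ∈ SpiralIndex.seifertCircles (K.projection v b),
      (SpiralIndex.IsOCircle (K.projection v b) C ∨
        SpiralIndex.IsICircle (K.projection v b) C) ∧
      ¬ (SpiralIndex.IsOCircle (K.projection v b) C ∧
        SpiralIndex.IsICircle (K.projection v b) C)) ∧
    ∀ w : SpiralIndex.Plane, ‖w‖ = 1 →
      (SpiralIndex.maxima (K.projection v b) w).Finite ∧
      ((SpiralIndex.maxima (K.projection v b) w).ncard : ℤ) =
        ({C ∈ SpiralIndex.seifertCircles (K.projection v b) |
            SpiralIndex.IsOCircle (K.projection v b) C}.ncard : ℤ) -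
        ({C ∈ SpiralIndex.seifertCircles (K.projection v b) |
            SpiralIndex.IsICircle (K.projection v b) C}.ncard : ℤ) := by
  exact SpiralIndex.spiral_index hreg hspiral (K.contDiff_projection v b)
    (K.periodic_projection v b)
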